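/- Let $H$ be a real separable Hilbert space with inner product $\langle\cdot,\cdot\rangle$, norm $\|\cdot\|$ and orthonormal basis $(\psi_j)_{j\ge1}$. For $h\in H$ write $[h]_j=\langle h,\psi_j\rangle$, $[h]_{\underline m}=([h]_1,\dots,[h]_m)^t$, and for a strictly positive sequence $w$ put $\|h\|_w^2=\sum_j w_j[h]_j^2$. For an operator $T$ on $H$ let $[T]_{\underline m}=(\langle\psi_j,T\psi_l\rangle)_{1\le j,l\le m}$. Let $\|\cdot\|_s$ be the spectral norm of matrices, $[\mathrm{D}_w]_{\underline m}=\mathrm{diag}(w_1,\dots,w_m)$, $(a)_+=\max(a,0)$, $a\vee b=\max(a,b)$, and let $\arg\min$ denote the smallest minimiser. **Weights and classes.** Let $\omega,b,\gamma$ be strictly positive sequences with $\omega_1=b_1=\gamma_1=1$ and $\sum_j\gamma_j<\infty$, such that $b^{-1}$, $\omega b^{-1}$, $\gamma$ and $\gamma^2\omega^{-1}$ are nonincreasing and converge to zero. For $r>0$ and $d\ge1$ let $\mathcal F_b^r=\{h\in H:\|h\|_b^2\le r\}$, and let $\mathcal G_\gamma^d$ be the set of strictly positive (self-adjoint) nuclear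 operators $T$ on $H$ with $d^{-2}\|f\|_{\gamma^2}^2\le\|Tf\|^2\le d^2\|f\|_{\gamma^2}^2$ for all $f\in H$. **Dimension bounds.** For a sequence $[K]=([K]_{\underline k})_{k\ge1}$ of $k\times k$ matrices put $$\Delta_m^{[K]}=\max_{1\le k\le m}\bigl\|[\mathrm D_\omega]_{\underline k}^{1/2}[K]_{\underline k}^{-1}[\mathrm D_\omega]_{\underline k}^{1/2}\bigr\|_s,\qquad \delta_m^{[K]}=m\,\Delta_m^{[K]}\,\frac{\log(\Delta_m^{[K]}\vee(m+2))}{\log(m+2)},$$ and $\Delta_m^\gamma=\Delta_m^{[\mathrm D_\gamma]}$, $\delta_m^\gamma=\delta_m^{[\mathrm D_\gamma]}$. Put $\omega_{(m)}=\max_{k\le m}\omega_k$, $M_n^\omega=\max\{1\le m\le\lfloor n^{1/4}\rfloor:\omega_{(m)}\le n\}$ and, for a sequence $a$, $$M_n(a)=\min\Bigl\{2\le m\le M_n^\omega:\ m\,\omega_{(m)}a_m>\frac n{1+\log n}\Bigr\}-1,$$ with $M_n(a)=M_n^\omega$ if this set is empty. Let $M_n^-=M_n(16d^3\gamma^{-1})$,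 $M_n^+=M_n((4d\gamma)^{-1})$ and $m_n^\diamond=\arg\min_{1\le m\le M_n^-}\max(\omega_m/b_m,\ \delta_m^\gamma/n)$. Let $\Sigma$ be any finite constant with $$\Sigma\ge\sum_{j\ge1}\gamma_j,\qquad \Sigma\ge\sum_{m\ge1}\Delta_m^\gamma\exp\Bigl(-\frac{m\log(\Delta_m^\gamma\vee(m+2))}{16(1+\log d)\log(m+2)}\Bigr).$$ **Model.** Let $Y=\langle\varphi,X\rangle+\sigma\epsilon$ with $\sigma>0$ and $\varphi\in\mathcal F_b^r$, where $X$ is a centred $H$-valued random variable, $\epsilon$ is standard normal and independent of $X$, the joint distribution of $X$ and $\epsilon$ is normal, and the covariance operator $\Gamma$ of $X$ belongs to $\mathcal G_\gamma^d$. Let $(Y_i,X_i)_{1\le i\le n}$ be an i.i.d. sample of $(Y,X)$. Put $[g]_j=\mathbb E(Y[X]_j)$, let $\varphi^m\in\mathrm{span}(\psi_1,\dots,\psi_m)$ have coefficients $[\varphi^m]_{\underline m}=[\Gamma]_{\underline m}^{-1}[g]_{\underline m}$, and with $\kappa=96$ put $$\mathrm{pen}_m=\kappa\,\sigma_m^2\,\delta_m^{[\Gamma]}\,n^{-1},\qquad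 \sigma_m^2=2\bigl(\mathbb EY^2+[g]_{\underline m}^t[\Gamma]_{\underline m}^{-1}[g]_{\underline m}\bigr).$$ **Estimator.** Let $[\hat g]_{\underline m}=n^{-1}\sum_iY_i[X_i]_{\underline m}$ and $[\hat\Gamma]_{\underline m}=n^{-1}\sum_i[X_i]_{\underline m}[X_i]_{\underline m}^t$. Let $\hat\varphi_m\in\mathrm{span}(\psi_1,\dots,\psi_m)$ have coefficients $[\hat\Gamma]_{\underline m}^{-1}[\hat g]_{\underline m}$ if $[\hat\Gamma]_{\underline m}$ is nonsingular with $\|[\hat\Gamma]_{\underline m}^{-1}\|_s\le n$, and $\hat\varphi_m=0$ otherwise. With $\kappa=96$ put $$\widehat{\mathrm{pen}}_m=14\,\kappa\,\hat\sigma_m^2\,\delta_m^{[\hat\Gamma]}\,n^{-1},\quad \hat\sigma_m^2=2\Bigl(\frac1n\sum_iY_i^2+[\hat g]_{\underline m}^t[\hat\Gamma]_{\underline m}^{-1}[\hat g]_{\underline m}\Bigr),\quad \hat M=M_n\bigl((\|[\hat\Gamma]_{\underline m}^{-1}\|_s)_{m\ge1}\bigr),$$ $$\Psi_m=\max_{m\le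 k\le\hat M}\bigl\{\|\hat\varphi_k-\hat\varphi_m\|_\omega^2-\widehat{\mathrm{pen}}_k\bigr\},\qquad \hat m=\arg\min_{1\le m\le\hat M}\{\Psi_m+\widehat{\mathrm{pen}}_m\}$$ (the matrices $[\hat\Gamma]_{\underline m}$, $m\le n^{1/4}$, are almost surely nonsingular), and let $$\mathcal E_n=\bigl\{\mathrm{pen}_k\le\widehat{\mathrm{pen}}_k\le72\,\mathrm{pen}_k\ \ \forall\,1\le k\le M_n^+\bigr\}\cap\bigl\{M_n^-\le\hat M\le M_n^+\bigr\}.$$ **Proposition.** For every $d\ge1$ there are finite constants $C_1=C_1(d)>0$ and $C_2=C_2(d)>0$, depending on $d$ only, such that for all $H$, $(\psi_j)$, $\omega$, $b$, $\gamma$, $r>0$, $\Sigma$ and $\sigma>0$ as above and all $n\ge1$, $$\sup_{\varphi\in\mathcal F_b^r}\ \sup_{\Gamma\in\mathcal G_\gamma^d}\mathbb E\Bigl\{\max_{m_n^\diamond\le k\le M_n^+}\Bigl(\|\hat\varphi_k-\varphi^k\|_\omega^2-\tfrac16\mathrm{pen}_k\Bigr)_+\Bigr\}\le C_1(\sigma^2+r)\,\Sigma\,n^{-1},$$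 $$\sup_{\varphi\in\mathcal F_b^r}\ \sup_{\Gamma\in\mathcal G_\gamma^d}\mathbb E\bigl(\|\hat\varphi_{\hat m}-\varphi\|_\omega^2\,\mathbf 1_{\mathcal E_n^c}\bigr)\le C_2(\sigma^2+r)\,\Sigma\,n^{-1}.$$ -/

import Mathlib

open MeasureTheory ProbabilityTheory
open scoped ENNReal RealInnerProductSpace

namespace FLR

noncomputable section

/-! Indexing conventions.  Sequences over the basis (weights, coordinates) are indexed by `ℕ`
starting at `0`, so `w j` is the weight that is written `w_{j+1}` when counting starts at one.
Sequences over the dimension are indexed by the dimension `m ≥ 1` itself; the `m`-dimensional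
objects use the indices `0, …, m - 1`. -/

/-! ### Weights, matrices, dimension bounds -/

/-- `w_(m)`, the maximum of the first `m` weights. -/
def wMax (w : ℕ → ℝ) (m : ℕ) : ℝ := ⨆ k : Fin m, w k

/-- The spectral norm of a square matrix: the operator norm for the Euclidean norm. -/
def specNorm {m : ℕ} (A : Matrix (Fin m) (Fin m) ℝ) : ℝ :=
  ‖Matrix.toEuclideanCLM (n := Fin m) (𝕜 := ℝ) A‖

/-- A sequence `([K]_m)` of square matrices, `[K]_m` being `m × m`. -/
abbrev MatSeq : Type := ∀ m : ℕ, Matrix (Fin m) (Fin m) ℝ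

/-- The diagonal matrices built from the first entries of a sequence of weights. -/
def diagMat (w : ℕ → ℝ) : MatSeq := fun _ => Matrix.diagonal fun j => w j

/-- `Δ_m^[K] = max_{1 ≤ k ≤ m} ‖[D_w]_k^{1/2} [K]_k⁻¹ [D_w]_k^{1/2}‖_s`. -/
def bigDelta (w : ℕ → ℝ) (K : MatSeq) (m : ℕ) : ℝ :=
  ⨆ k : Finset.Icc 1 m,
    specNorm (diagMat (fun j => √(w j)) k * (K k)⁻¹ * diagMat (fun j => √(w j)) k)

/-- `δ_m^[K] = m Δ_m^[K] log (Δ_m^[K] ∨ (m + 2)) / log (m + 2)`. -/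
def smallDelta (w : ℕ → ℝ) (K : MatSeq) (m : ℕ) : ℝ :=
  m * bigDelta w K m * (Real.log (max (bigDelta w K m) (m + 2)) / Real.log (m + 2))

/-- `M_n^w = max {1 ≤ m ≤ ⌊n^{1/4}⌋ : w_(m) ≤ n}`. -/
def dimBound (w : ℕ → ℝ) (n : ℕ) : ℕ :=
  sSup {m : ℕ | 1 ≤ m ∧ m ≤ ⌊(n : ℝ) ^ (1 / 4 : ℝ)⌋₊ ∧ wMax w m ≤ n}

/-- The set `{2 ≤ m ≤ M_n^w : m w_(m) a_m > n / (1 + log n)}`. -/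
def cutSet (w : ℕ → ℝ) (n : ℕ) (a : ℕ → ℝ) : Set ℕ :=
  {m : ℕ | 2 ≤ m ∧ m ≤ dimBound w n ∧ (n : ℝ) / (1 + Real.log n) < m * wMax w m * a m}

open Classical in
/-- `M_n(a)`: the minimum of `cutSet w n a` minus one, and `M_n^w` if that set is empty. -/
def dimCut (w : ℕ → ℝ) (n : ℕ) (a : ℕ → ℝ) : ℕ :=
  if (cutSet w n a).Nonempty then sInf (cutSet w n a) - 1 else dimBound w n

/-- The smallest minimiser of `f` over `{1, …, M}`. -/
def argminUpTo (M : ℕ) (f : ℕ → ℝ) : ℕ :=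
  sInf {m : ℕ | m ∈ Finset.Icc 1 M ∧ ∀ m' ∈ Finset.Icc 1 M, f m ≤ f m'}

/-- `M_n^-`, that is `M_n(16 d³ γ⁻¹)`. -/
def dimMinus (w γ : ℕ → ℝ) (d : ℝ) (n : ℕ) : ℕ :=
  dimCut w n fun m => 16 * d ^ 3 * (γ (m - 1))⁻¹

/-- `M_n^+`, that is `M_n((4 d γ)⁻¹)`. -/
def dimPlus (w γ : ℕ → ℝ) (d : ℝ) (n : ℕ) : ℕ :=
  dimCut w n fun m => (4 * d * γ (m - 1))⁻¹

/-- `m_n^⋄`, the minimiser of `max (w_m / b_m, δ_m^γ / n)` over `1 ≤ m ≤ M_n^-`. -/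
def dimDiamond (w b γ : ℕ → ℝ) (d : ℝ) (n : ℕ) : ℕ :=
  argminUpTo (dimMinus w γ d n) fun m =>
    max (w (m - 1) / b (m - 1)) (smallDelta w (diagMat γ) m / n)

/-- The regularity conditions on the weight sequences. -/
structure RegularWeights (w b γ : ℕ → ℝ) : Prop where
  w_pos : ∀ j, 0 < w j
  b_pos : ∀ j, 0 < b j
  γ_pos : ∀ j, 0 < γ j
  w_one : w 0 = 1
  b_one : b 0 = 1
  γ_one : γ 0 = 1
  γ_summable : Summable γ
  b_inv_anti : Antitone fun j => (b j)⁻¹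
  b_inv_zero : Filter.Tendsto (fun j => (b j)⁻¹) Filter.atTop (nhds 0)
  w_b_anti : Antitone fun j => w j * (b j)⁻¹
  w_b_zero : Filter.Tendsto (fun j => w j * (b j)⁻¹) Filter.atTop (nhds 0)
  γ_anti : Antitone γ
  γ_zero : Filter.Tendsto γ Filter.atTop (nhds 0)
  γ_w_anti : Antitone fun j => γ j ^ 2 * (w j)⁻¹
  γ_w_zero : Filter.Tendsto (fun j => γ j ^ 2 * (w j)⁻¹) Filter.atTop (nhds 0)

/-- The two lower bounds that the constant `S` (called `Σ`) has to satisfy: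
`∑_{j ≥ 1} γ_j ≤ S` and
`∑_{m ≥ 1} Δ_m^γ exp (- m log (Δ_m^γ ∨ (m + 2)) / (16 (1 + log d) log (m + 2))) ≤ S`.
The series are summed in `[0, ∞]`, so that convergence is part of the condition. -/
def IsSigmaConst (w γ : ℕ → ℝ) (d S : ℝ) : Prop :=
  (∑' j : ℕ, ENNReal.ofReal (γ j)) ≤ ENNReal.ofReal S ∧
  (∑' m : {m : ℕ // 1 ≤ m}, ENNReal.ofReal (bigDelta w (diagMat γ) m *
      Real.exp (-((m : ℝ) * Real.log (max (bigDelta w (diagMat γ) m) ((m : ℝ) + 2)) /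
        (16 * (1 + Real.log d) * Real.log ((m : ℝ) + 2)))))) ≤ ENNReal.ofReal S

/-! ### Classes of slope functions and of covariance operators -/

section Hilbert

variable {H : Type*} [NormedAddCommGroup H] [InnerProductSpace ℝ H]

/-- The squared weighted norm `‖h‖_w² = ∑_j w_j [h]_j²`, with values in `[0, ∞]`. -/
def wNormSq (ψ : HilbertBasis ℕ ℝ H) (w : ℕ → ℝ) (h : H) : ℝ≥0∞ :=
  ∑' j : ℕ, ENNReal.ofReal (w j * ⟪ψ j, h⟫ ^ 2)

/-- The ellipsoid `{h : ‖h‖_b² ≤ r}`.  (For weights `b ≥ 1` the completion of `H` with respect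
to `‖·‖_b` is the set of the `h` in `H` with `‖h‖_b < ∞`.) -/
def ellipsoid (ψ : HilbertBasis ℕ ℝ H) (b : ℕ → ℝ) (r : ℝ) : Set H :=
  {h : H | wNormSq ψ b h ≤ ENNReal.ofReal r}

/-- Nuclear operators: absolutely convergent sums of rank-one operators. -/
def IsNuclear (T : H →L[ℝ] H) : Prop :=
  ∃ u v : ℕ → H, Summable (fun k => ‖u k‖ * ‖v k‖) ∧
    ∀ f : H, HasSum (fun k => ⟪u k, f⟫ • v k) (T f)

/-- The class of the strictly positive (self-adjoint) nuclear operators `T` with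
`d⁻² ‖f‖²_{γ²} ≤ ‖T f‖² ≤ d² ‖f‖²_{γ²}` for all `f`. -/
def opClass (ψ : HilbertBasis ℕ ℝ H) (γ : ℕ → ℝ) (d : ℝ) : Set (H →L[ℝ] H) :=
  {T | T.IsPositive ∧ (∀ f : H, f ≠ 0 → 0 < ⟪T f, f⟫) ∧ IsNuclear T ∧
    ∀ f : H,
      ENNReal.ofReal ((d ^ 2)⁻¹) * wNormSq ψ (fun j => γ j ^ 2) f ≤ ENNReal.ofReal (‖T f‖ ^ 2) ∧
      ENNReal.ofReal (‖T f‖ ^ 2) ≤ ENNReal.ofReal (d ^ 2) * wNormSq ψ (fun j => γ j ^ 2) f}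

/-! ### Galerkin solutions and penalties

The same formulas are used at the population level and, with the empirical second moment
of the response, the empirical `g` and the empirical covariance matrices, at the sample level. -/

/-- `[g]_m`, the first `m` coordinates. -/
def headVec (g : ℕ → ℝ) (m : ℕ) : Fin m → ℝ := fun j => g j

/-- The element of `span {ψ_1, …, ψ_m}` with coefficient vector `[K]_m⁻¹ [g]_m`. -/
def galerkin (ψ : HilbertBasis ℕ ℝ H) (K : MatSeq) (g : ℕ → ℝ) (m : ℕ) : H :=
  ∑ j : Fin m, ((K m)⁻¹.mulVec (headVec g m)) j • ψ j

/-- `2 (E Y² + [g]_mᵗ [K]_m⁻¹ [g]_m)`. -/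
def sigmaSq (y2 : ℝ) (K : MatSeq) (g : ℕ → ℝ) (m : ℕ) : ℝ :=
  2 * (y2 + headVec g m ⬝ᵥ (K m)⁻¹.mulVec (headVec g m))

/-- The penalty with constant `c`: `c σ_m² δ_m^[K] / n`. -/
def penalty (c : ℝ) (w : ℕ → ℝ) (y2 : ℝ) (K : MatSeq) (g : ℕ → ℝ) (n m : ℕ) : ℝ :=
  c * sigmaSq y2 K g m * smallDelta w K m / n

/-- `[T]_m`, with the entries `⟨ψ_j, T ψ_l⟩`, `1 ≤ j, l ≤ m`. -/
def opMat (ψ : HilbertBasis ℕ ℝ H) (T : H →L[ℝ] H) : MatSeq :=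
  fun _ => Matrix.of fun j l => ⟪ψ j, T (ψ l)⟫

/-! ### The estimator, as a function of the data `(y_i, x_i)`, `1 ≤ i ≤ n`

Matrix inverses of singular matrices have the value `0` in Mathlib.  Under a strictly positive
covariance operator the empirical covariance matrices of the dimensions `m ≤ n` are almost
surely nonsingular in the Gaussian model, and only dimensions `m ≤ n^{1/4}` are used. -/

section Data

variable (ψ : HilbertBasis ℕ ℝ H) {n : ℕ} (y : Fin n → ℝ) (x : Fin n → H)

/-- The coordinates of `n⁻¹ ∑_i y_i x_i`. -/
def empG (j : ℕ) : ℝ := (n : ℝ)⁻¹ * ∑ i, y i * ⟪x i, ψ j⟫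

/-- The empirical covariance matrices `n⁻¹ ∑_i [x_i]_m [x_i]_mᵗ`. -/
def empMat : MatSeq :=
  fun _ => Matrix.of fun j l => (n : ℝ)⁻¹ * ∑ i, ⟪x i, ψ j⟫ * ⟪x i, ψ l⟫

/-- `n⁻¹ ∑_i y_i²`. -/
def empY2 : ℝ := (n : ℝ)⁻¹ * ∑ i, y i ^ 2

open Classical in
/-- The thresholded projection estimator of dimension `m`. -/
def estimator (m : ℕ) : H :=
  if IsUnit (empMat ψ x m).det ∧ specNorm (empMat ψ x m)⁻¹ ≤ n then
    galerkin ψ (empMat ψ x) (empG ψ y x) m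
  else 0

/-- The random penalty, with constant `14 κ`. -/
def hpen (κ : ℝ) (w : ℕ → ℝ) (m : ℕ) : ℝ :=
  penalty (14 * κ) w (empY2 y) (empMat ψ x) (empG ψ y x) n m

/-- The random upper bound for the dimension. -/
def hDim (w : ℕ → ℝ) : ℕ := dimCut w n fun m => specNorm (empMat ψ x m)⁻¹

/-- The contrast `max_{m ≤ k ≤ M̂} (‖φ̂_k - φ̂_m‖_w² - p̂en_k)`. -/
def contrast (κ : ℝ) (w : ℕ → ℝ) (m : ℕ) : ℝ :=
  ⨆ k : Finset.Icc m (hDim ψ x w),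
    ((wNormSq ψ w (estimator ψ y x k - estimator ψ y x m)).toReal - hpen ψ y x κ w k)

/-- The selected dimension. -/
def selected (κ : ℝ) (w : ℕ → ℝ) : ℕ :=
  argminUpTo (hDim ψ x w) fun m => contrast ψ y x κ w m + hpen ψ y x κ w m

end Data

/-! ### The Gaussian functional linear model -/

section Model

variable [CompleteSpace H] [MeasurableSpace H] [BorelSpace H]

/-- The regressor `X` is centred, the error `ε` is standard normal, `X` and `ε` are independent,
and their joint distribution is normal. -/
structure GaussianDesign {Ω : Type*} [MeasurableSpace Ω] (P : Measure Ω)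
    (X : Ω → H) (ε : Ω → ℝ) : Prop where
  joint : HasGaussianLaw (fun ω => (X ω, ε ω)) P
  centred : ∀ h : H, ∫ ω, ⟪X ω, h⟫ ∂P = 0
  error : P.map ε = gaussianReal 0 1
  indep : IndepFun X ε P

/-- The response `Y = ⟨φ, X⟩ + σ ε`. -/
def response {Ω : Type*} (φ : H) (σ : ℝ) (X : Ω → H) (ε : Ω → ℝ) (ω : Ω) : ℝ :=
  ⟪φ, X ω⟫ + σ * ε ω

/-- The coordinates `[g]_j = E[Y ⟨X, ψ_j⟩]`. -/
def popG {Ω : Type*} [MeasurableSpace Ω] (ψ : HilbertBasis ℕ ℝ H) (P : Measure Ω)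
    (X : Ω → H) (Y : Ω → ℝ) (j : ℕ) : ℝ :=
  ∫ ω, Y ω * ⟪X ω, ψ j⟫ ∂P

/-- The covariance matrices `[Γ]_m` of the covariance operator of `X`. -/
def popMat {Ω : Type*} [MeasurableSpace Ω] (ψ : HilbertBasis ℕ ℝ H) (P : Measure Ω)
    (X : Ω → H) : MatSeq :=
  opMat ψ (covarianceOperator (P.map X))

/-- The theoretical penalty, with constant `κ`. -/
def pen {Ω : Type*} [MeasurableSpace Ω] (ψ : HilbertBasis ℕ ℝ H) (P : Measure Ω)
    (X : Ω → H) (Y : Ω → ℝ) (κ : ℝ) (w : ℕ → ℝ) (n m : ℕ) : ℝ :=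
  penalty κ w (∫ ω, Y ω ^ 2 ∂P) (popMat ψ P X) (popG ψ P X Y) n m

/-- The Galerkin solution `φ^m` at the population level. -/
def galerkinSol {Ω : Type*} [MeasurableSpace Ω] (ψ : HilbertBasis ℕ ℝ H) (P : Measure Ω)
    (X : Ω → H) (Y : Ω → ℝ) (m : ℕ) : H :=
  galerkin ψ (popMat ψ P X) (popG ψ P X Y) m

/-- `(Y_i, X_i)`, `1 ≤ i ≤ n`, are independent copies of `(Y, X)`. -/
structure IsSample {Ω₀ Ω : Type*} [MeasurableSpace Ω₀] [MeasurableSpace Ω]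
    (P₀ : Measure Ω₀) (Y : Ω₀ → ℝ) (X : Ω₀ → H)
    (P : Measure Ω) {n : ℕ} (Ys : Fin n → Ω → ℝ) (Xs : Fin n → Ω → H) : Prop where
  indep : iIndepFun (fun i ω => (Ys i ω, Xs i ω)) P
  copies : ∀ i, IdentDistrib (fun ω => (Ys i ω, Xs i ω)) (fun ω => (Y ω, X ω)) P P₀

end Model

end Hilbert

end

end FLR

set_option linter.unusedSectionVars false

namespace FLR

open Matrix

/-! ### Spectral norms as inequalities between quadratic forms -/

section SpectralNorm

variable {m : ℕ}

/-! One probabilistic fact carries the first bound. Since φ^m solves the Galerkin equations, the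
residual U = Y - ⟨φ^m, X⟩ is uncorrelated with the first m coordinates of X, hence independent of
them by joint normality. If [Γ]_m = CᵀC, the coordinates of X along the columns of C⁻¹ are
independent standard normal variables Z_1, …, Z_m, and the estimation error is governed by Q = Σ_j
(n⁻¹ Σ_i U_i Z_ij)². Given the residuals, nQ is n⁻¹ Σ U_i² times a χ² variable with m degrees of
freedom, so exp(nQ / (8v)) has expectation at most 2^{m/2} on {Σ U_i² ≤ 2nv}, where v = E Y²
(`lintegral_exp_residualSq_le`).

When the form of [Γ̂]_k is within the fraction 1/8 of that of [Γ]_k for all k ≤ m, the untruncated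
estimator satisfies ‖φ̂_m - φ^m‖_ω² ≤ (64/49) Δ_m Q, while pen_m / 6 is at least 32 v δ_m / n. With
δ_m = m Δ_m L_m, the excess of the error over pen_m / 6 is at most a multiple of v Δ_m n⁻¹ exp(nQ /
(8v) - 3 m L_m), whose expectation is of order v n⁻¹ Δ_m exp(-2 m L_m). Summation over m is what Σ
controls (`sum_lintegral_mainBound_le`). For m ≤ M_n^+ the truncation can act on such data only if n
≤ exp(3d²), which costs a constant depending on d (`le_exp_of_not_branch`).

Bad data are measured by a nonnegative function R (`totalExcess`), a sum of Chernoff exponentials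
that is at least 1 as soon as one of the required empirical second moments deviates too far. All
dimensions are at most n^{1/4}, so E R is at most 8n exp(-√n / 1024), smaller than any power of n.
Where R ≥ 1, the truncation level n and eighth moments give a polynomial bound for the error
(`crudeBound`), whose integral is O(n⁻²) for each dimension. Where R < 1, the event E_n holds
(`good_event_of_totalExcess_lt`). Hence E_nᶜ lies in {R ≥ 1}, and the second bound follows by
summing the crude bound over all dimensions, which also disposes of the random index m̂. Maxima and
random indices are bounded pointwise by sums of measurable functions, and only these sums are
integrated term by term.

Uniformity over the classes comes from operator monotonicity of the square root
(`inner_le_inner_of_norm_le`), which turns the condition on ‖Γf‖ into d⁻¹ Σ γ_j f_j² ≤ ⟨Γf, f⟩ ≤ d Σ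
γ_j f_j² (`opClass_form_bounds`). Matrix norms are read as inequalities between quadratic forms
(`specNorm_weighted_inv_le_iff`), so that Δ^Γ and Δ^γ agree up to the factor d, and the bias is
bounded by a multiple of d² r (`wNormSq_galerkin_sub_le`). -/

theorem specNorm_nonneg (A : Matrix (Fin m) (Fin m) ℝ) : 0 ≤ specNorm A := norm_nonneg _

theorem norm_toLp_sq (v : Fin m → ℝ) : ‖WithLp.toLp 2 v‖ ^ 2 = v ⬝ᵥ v := by
  rw [EuclideanSpace.norm_sq_eq]
  simp [dotProduct, sq]

theorem mulVec_dotProduct_self_le (A : Matrix (Fin m) (Fin m) ℝ) (v : Fin m → ℝ) :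
    (A *ᵥ v) ⬝ᵥ (A *ᵥ v) ≤ specNorm A ^ 2 * (v ⬝ᵥ v) := by
  rw [← norm_toLp_sq, ← norm_toLp_sq, ← mul_pow, ← Matrix.toEuclideanCLM_toLp]
  exact pow_le_pow_left₀ (norm_nonneg _) (ContinuousLinearMap.le_opNorm _ _) 2

theorem specNorm_le_of_forall {A : Matrix (Fin m) (Fin m) ℝ} {t : ℝ} (ht : 0 ≤ t)
    (h : ∀ v : Fin m → ℝ, (A *ᵥ v) ⬝ᵥ (A *ᵥ v) ≤ t ^ 2 * (v ⬝ᵥ v)) : specNorm A ≤ t := by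
  refine ContinuousLinearMap.opNorm_le_bound _ ht fun x => ?_
  have hx := h (WithLp.ofLp x)
  rw [← norm_toLp_sq, ← norm_toLp_sq, ← mul_pow, ← Matrix.toEuclideanCLM_toLp] at hx
  exact (sq_le_sq₀ (norm_nonneg _) (by positivity)).1 hx

theorem dotProduct_sq_le (v u : Fin m → ℝ) : (v ⬝ᵥ u) ^ 2 ≤ (v ⬝ᵥ v) * (u ⬝ᵥ u) := by
  have := Finset.sum_mul_sq_le_sq_mul_sq Finset.univ v u
  simpa [dotProduct, sq] using this

theorem dotProduct_self_nonneg' (v : Fin m → ℝ) : 0 ≤ v ⬝ᵥ v :=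
  Finset.sum_nonneg fun i _ => mul_self_nonneg (v i)

theorem dotProduct_mulVec_comm {A : Matrix (Fin m) (Fin m) ℝ} (hA : A.IsHermitian)
    (v u : Fin m → ℝ) : v ⬝ᵥ A *ᵥ u = u ⬝ᵥ A *ᵥ v := by
  rw [Matrix.dotProduct_mulVec, ← Matrix.mulVec_transpose, dotProduct_comm]
  have : Aᵀ = A := by simpa [Matrix.IsHermitian] using hA
  rw [this]

theorem posSemidef_form_nonneg {A : Matrix (Fin m) (Fin m) ℝ} (hA : A.PosSemidef)
    (v : Fin m → ℝ) : 0 ≤ v ⬝ᵥ A *ᵥ v := by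
  simpa using hA.dotProduct_mulVec_nonneg v

/-- The Cauchy-Schwarz inequality for the form of a positive semidefinite matrix. -/
theorem form_sq_le {A : Matrix (Fin m) (Fin m) ℝ} (hA : A.PosSemidef) (v u : Fin m → ℝ) :
    (v ⬝ᵥ A *ᵥ u) ^ 2 ≤ (v ⬝ᵥ A *ᵥ v) * (u ⬝ᵥ A *ᵥ u) := by
  have h : ∀ s : ℝ, 0 ≤ (u ⬝ᵥ A *ᵥ u) * (s * s) + (2 * (v ⬝ᵥ A *ᵥ u)) * s + v ⬝ᵥ A *ᵥ v := by
    intro s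
    have h0 := posSemidef_form_nonneg hA (v + s • u)
    have : (v + s • u) ⬝ᵥ A *ᵥ (v + s • u) =
        (u ⬝ᵥ A *ᵥ u) * (s * s) + (2 * (v ⬝ᵥ A *ᵥ u)) * s + v ⬝ᵥ A *ᵥ v := by
      simp only [Matrix.mulVec_add, Matrix.mulVec_smul, dotProduct_add, add_dotProduct,
        dotProduct_smul, smul_dotProduct, smul_eq_mul, dotProduct_mulVec_comm hA.isHermitian u v]
      ring
    rwa [this] at h0
  have := discrim_le_zero h
  rw [discrim] at this
  nlinarith

theorem diagMat_mulVec (w : ℕ → ℝ) (v : Fin m → ℝ) :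
    diagMat w m *ᵥ v = fun j : Fin m => w j * v j := by
  ext j; simp [diagMat, Matrix.mulVec_diagonal]

theorem PosDef.mul_inv_mulVec {A : Matrix (Fin m) (Fin m) ℝ} (hA : IsUnit A.det)
    (v : Fin m → ℝ) : A *ᵥ (A⁻¹ *ᵥ v) = v := by
  rw [Matrix.mulVec_mulVec, Matrix.mul_nonsing_inv _ hA, Matrix.one_mulVec]

theorem posDef_isUnit_det {A : Matrix (Fin m) (Fin m) ℝ} (hA : A.PosDef) : IsUnit A.det :=
  (Matrix.isUnit_iff_isUnit_det A).1 hA.isUnit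

/-- The norm of `D^{1/2} A⁻¹ D^{1/2}` is at most `t` if and only if `D ≤ t A`. -/
theorem specNorm_weighted_inv_le_iff {w : ℕ → ℝ} (hw : ∀ j, 0 ≤ w j)
    {A : Matrix (Fin m) (Fin m) ℝ} (hA : A.PosDef) {t : ℝ} (ht : 0 ≤ t) :
    specNorm (diagMat (fun j => √(w j)) m * A⁻¹ * diagMat (fun j => √(w j)) m) ≤ t ↔
      ∀ v : Fin m → ℝ, ∑ j : Fin m, w j * v j ^ 2 ≤ t * (v ⬝ᵥ A *ᵥ v) := by
  set D := diagMat (fun j => √(w j)) m with hD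
  have hDv : ∀ v : Fin m → ℝ, ∑ j : Fin m, w j * v j ^ 2 = (D *ᵥ v) ⬝ᵥ (D *ᵥ v) := by
    intro v
    rw [hD, diagMat_mulVec]
    refine Finset.sum_congr rfl fun j _ => ?_
    calc w j * v j ^ 2 = (√(w j) * √(w j)) * v j ^ 2 := by rw [Real.mul_self_sqrt (hw j)]
      _ = _ := by ring
  have hDs : ∀ u v : Fin m → ℝ, (D *ᵥ u) ⬝ᵥ v = u ⬝ᵥ (D *ᵥ v) := by
    intro u v
    rw [hD, diagMat_mulVec, diagMat_mulVec]
    exact Finset.sum_congr rfl fun j _ => by ring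
  have hU := posDef_isUnit_det hA
  have hM : ∀ y, (D * A⁻¹ * D) *ᵥ y = D *ᵥ (A⁻¹ *ᵥ (D *ᵥ y)) := by
    intro y; simp [Matrix.mulVec_mulVec, Matrix.mul_assoc]
  constructor
  · intro h v
    rw [hDv]
    -- With M = D A⁻¹ D (here D is the square root of the weights), Cauchy-Schwarz for the form of A
    -- gives |y|⁴ ≤ (v, Av)(x, Ax) = (v, Av)(y, My) ≤ (v, Av) t |y|².
    set y := D *ᵥ v with hy
    set x := A⁻¹ *ᵥ (D *ᵥ y) with hx
    have hAx : A *ᵥ x = D *ᵥ y := PosDef.mul_inv_mulVec hU _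
    have h1 : y ⬝ᵥ y = v ⬝ᵥ A *ᵥ x := by rw [hAx, ← hDs v y]
    have h2 : x ⬝ᵥ A *ᵥ x = y ⬝ᵥ ((D * A⁻¹ * D) *ᵥ y) := by
      rw [hAx, hM, ← hDs, dotProduct_comm, ← hDs, hDs, hDs]
    have h3 := form_sq_le hA.posSemidef v x
    rw [← h1, h2] at h3
    have h4 : (y ⬝ᵥ ((D * A⁻¹ * D) *ᵥ y)) ≤ t * (y ⬝ᵥ y) := by
      have h5 := dotProduct_sq_le y ((D * A⁻¹ * D) *ᵥ y)
      have h6 := mulVec_dotProduct_self_le (D * A⁻¹ * D) y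
      have h7 : specNorm (D * A⁻¹ * D) ^ 2 ≤ t ^ 2 := pow_le_pow_left₀ (specNorm_nonneg _) h 2
      have hyy := dotProduct_self_nonneg' y
      refine abs_le_of_sq_le_sq' ?_ (mul_nonneg ht hyy) |>.2
      calc _ ≤ _ := h5
        _ ≤ (y ⬝ᵥ y) * (t ^ 2 * (y ⬝ᵥ y)) := by
          gcongr
          exact h6.trans (by gcongr)
        _ = _ := by ring
    have hv := posSemidef_form_nonneg hA.posSemidef v
    have hyy := dotProduct_self_nonneg' y
    rcases hyy.eq_or_lt with h0 | h0
    · rw [← h0]; exact mul_nonneg ht hv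
    · have : (y ⬝ᵥ y) * (y ⬝ᵥ y) ≤ (t * (v ⬝ᵥ A *ᵥ v)) * (y ⬝ᵥ y) := by
        nlinarith [mul_le_mul_of_nonneg_left h4 hv]
      exact le_of_mul_le_mul_right this h0
  · intro h
    refine specNorm_le_of_forall ht fun y => ?_
    rw [hM]
    -- Testing the hypothesis at x gives |Dx|² ≤ t (Dx, y), and Dx is the image of y.
    set x := A⁻¹ *ᵥ (D *ᵥ y) with hx
    have hAx : A *ᵥ x = D *ᵥ y := PosDef.mul_inv_mulVec hU _
    have h1 := h x
    rw [hDv, hAx, ← hDs x y] at h1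
    have h5 := dotProduct_sq_le (D *ᵥ x) y
    have hx0 := dotProduct_self_nonneg' (D *ᵥ x)
    have hy0 := dotProduct_self_nonneg' y
    generalize (D *ᵥ x) ⬝ᵥ (D *ᵥ x) = p at *
    generalize (D *ᵥ x) ⬝ᵥ y = q at *
    generalize y ⬝ᵥ y = s at *
    have hsq : p * p ≤ (t ^ 2 * s) * p := by
      calc p * p ≤ (t * q) * (t * q) := mul_self_le_mul_self hx0 h1
        _ = t ^ 2 * q ^ 2 := by ring
        _ ≤ t ^ 2 * (p * s) := mul_le_mul_of_nonneg_left h5 (sq_nonneg t)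
        _ = _ := by ring
    rcases hx0.eq_or_lt with h0 | h0
    · rw [← h0]; exact mul_nonneg (sq_nonneg t) hy0
    · exact le_of_mul_le_mul_right hsq h0

theorem specNorm_inv_le_iff {A : Matrix (Fin m) (Fin m) ℝ} (hA : A.PosDef) {t : ℝ} (ht : 0 ≤ t) :
    specNorm A⁻¹ ≤ t ↔ ∀ v : Fin m → ℝ, v ⬝ᵥ v ≤ t * (v ⬝ᵥ A *ᵥ v) := by
  have h := specNorm_weighted_inv_le_iff (w := fun _ => 1) (fun _ => zero_le_one) hA ht
  have h1 : diagMat (fun _ => √(1 : ℝ)) m = 1 := by simp [diagMat]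
  rw [h1] at h
  simpa [dotProduct, sq] using h

end SpectralNorm

/-! ### Comparison of positive definite matrices -/

section FormComparison

variable {m : ℕ} {A B : Matrix (Fin m) (Fin m) ℝ}

/-- Both norms are best constants in inequalities "weights ≤ constant times form", so the constants
multiply. -/
theorem specNorm_weighted_inv_le_mul {w : ℕ → ℝ} (hw : ∀ j, 0 ≤ w j) (hA : A.PosDef)
    (hB : B.PosDef) {c : ℝ} (hc : 0 ≤ c)
    (h : ∀ v : Fin m → ℝ, v ⬝ᵥ A *ᵥ v ≤ c * (v ⬝ᵥ B *ᵥ v)) :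
    specNorm (diagMat (fun j => √(w j)) m * B⁻¹ * diagMat (fun j => √(w j)) m) ≤
      c * specNorm (diagMat (fun j => √(w j)) m * A⁻¹ * diagMat (fun j => √(w j)) m) := by
  set t := specNorm (diagMat (fun j => √(w j)) m * A⁻¹ * diagMat (fun j => √(w j)) m) with ht
  have ht0 : 0 ≤ t := specNorm_nonneg _
  refine (specNorm_weighted_inv_le_iff hw hB (by positivity)).2 fun v => ?_
  have h1 := (specNorm_weighted_inv_le_iff hw hA ht0).1 le_rfl v
  calc _ ≤ _ := h1
    _ ≤ t * (c * (v ⬝ᵥ B *ᵥ v)) := by gcongr; exact h v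
    _ = _ := by ring

/-- A symmetric matrix that dominates a positive definite one is positive definite. -/
theorem posDef_of_form_ge (hA : A.PosDef) (hB : B.IsHermitian) {c : ℝ} (hc : 0 < c)
    (h : ∀ v : Fin m → ℝ, c * (v ⬝ᵥ A *ᵥ v) ≤ v ⬝ᵥ B *ᵥ v) : B.PosDef := by
  refine Matrix.PosDef.of_dotProduct_mulVec_pos hB fun {x} hx => ?_
  have h1 := hA.dotProduct_mulVec_pos hx
  simp only [star_trivial] at h1 ⊢
  exact (mul_pos hc h1).trans_le (h x)

/-- Perturbed linear systems: if `c A ≤ B` and `B x = v`, then `c² (x, A x) ≤ (v, A⁻¹ v)`. -/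
theorem form_solution_le (hA : A.PosDef) {c : ℝ} (hc : 0 < c)
    (h : ∀ v : Fin m → ℝ, c * (v ⬝ᵥ A *ᵥ v) ≤ v ⬝ᵥ B *ᵥ v) {x v : Fin m → ℝ}
    (hx : B *ᵥ x = v) : c ^ 2 * (x ⬝ᵥ A *ᵥ x) ≤ v ⬝ᵥ A⁻¹ *ᵥ v := by
  have hU := posDef_isUnit_det hA
  set z := A⁻¹ *ᵥ v with hz
  have hAz : A *ᵥ z = v := PosDef.mul_inv_mulVec hU _
  have h1 := h x
  rw [hx, ← hAz] at h1
  have h2 := form_sq_le hA.posSemidef x z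
  have h3 : v ⬝ᵥ z = z ⬝ᵥ A *ᵥ z := by rw [hAz, dotProduct_comm]
  rw [h3]
  have hx0 := posSemidef_form_nonneg hA.posSemidef x
  rcases hx0.eq_or_lt with h0 | h0
  · rw [← h0, mul_zero]; exact posSemidef_form_nonneg hA.posSemidef z
  · have : (c ^ 2 * (x ⬝ᵥ A *ᵥ x)) * (x ⬝ᵥ A *ᵥ x) ≤ (z ⬝ᵥ A *ᵥ z) * (x ⬝ᵥ A *ᵥ x) := by
      calc _ = (c * (x ⬝ᵥ A *ᵥ x)) ^ 2 := by ring
        _ ≤ (x ⬝ᵥ A *ᵥ z) ^ 2 := pow_le_pow_left₀ (by positivity) h1 2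
        _ ≤ _ := by rw [mul_comm]; exact h2
    exact le_of_mul_le_mul_right this h0

/-- A positive definite matrix has a whitening matrix `C`: `A = Cᵀ C` with `C` invertible. -/
theorem exists_whitening (hA : A.PosDef) :
    ∃ C : Matrix (Fin m) (Fin m) ℝ, IsUnit C.det ∧ A = Cᵀ * C := by
  obtain ⟨C, hC⟩ : ∃ C : Matrix (Fin m) (Fin m) ℝ, A = Cᴴ * C := by
    open scoped MatrixOrder in
    exact CStarAlgebra.nonneg_iff_eq_star_mul_self.mp hA.posSemidef.nonneg
  rw [Matrix.conjTranspose_eq_transpose_of_trivial] at hC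
  refine ⟨C, ?_, hC⟩
  have hU := posDef_isUnit_det hA
  rw [hC, Matrix.det_mul] at hU
  exact isUnit_of_mul_isUnit_right hU

end FormComparison

end FLR

namespace FLR

open Matrix

/-! ### Operator monotonicity of the square root -/

section PositiveOperators

variable {H : Type*} [NormedAddCommGroup H] [InnerProductSpace ℝ H]

/-- The Cauchy-Schwarz inequality for the form of a positive operator. -/
theorem inner_sq_le_of_isPositive {T : H →L[ℝ] H} (hT : T.IsPositive) (f g : H) :
    ⟪T f, g⟫ ^ 2 ≤ ⟪T f, f⟫ * ⟪T g, g⟫ := by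
  have hs : ⟪T g, f⟫ = ⟪T f, g⟫ := by
    rw [hT.inner_left_eq_inner_right g f, real_inner_comm]
  have h : ∀ s : ℝ, 0 ≤ ⟪T g, g⟫ * (s * s) + (2 * ⟪T f, g⟫) * s + ⟪T f, f⟫ := by
    intro s
    have h0 : 0 ≤ ⟪T (f + s • g), f + s • g⟫ := hT.inner_nonneg_left _
    have : ⟪T (f + s • g), f + s • g⟫ =
        ⟪T g, g⟫ * (s * s) + (2 * ⟪T f, g⟫) * s + ⟪T f, f⟫ := by
      simp only [map_add, map_smul, inner_add_left, inner_add_right, real_inner_smul_left,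
        real_inner_smul_right, hs]
      ring
    rwa [this] at h0
  have := discrim_le_zero h
  rw [discrim] at this
  nlinarith

/-- Cauchy-Schwarz for the form, tested against T f. A vector that nearly annihilates the form is
therefore nearly annihilated by the operator. -/
theorem norm_sq_le_of_isPositive {T : H →L[ℝ] H} (hT : T.IsPositive) (f : H) :
    ‖T f‖ ^ 2 ≤ ‖T‖ * ⟪T f, f⟫ := by
  have h1 := inner_sq_le_of_isPositive hT f (T f)
  rw [real_inner_self_eq_norm_sq] at h1
  have h2 : ⟪T (T f), T f⟫ ≤ ‖T‖ * ‖T f‖ ^ 2 := by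
    calc _ ≤ ‖T (T f)‖ * ‖T f‖ := real_inner_le_norm _ _
      _ ≤ (‖T‖ * ‖T f‖) * ‖T f‖ := by gcongr; exact T.le_opNorm _
      _ = _ := by ring
  have h3 : 0 ≤ ⟪T f, f⟫ := hT.inner_nonneg_left _
  rcases (sq_nonneg ‖T f‖).eq_or_lt with h0 | h0
  · rw [← h0]; positivity
  · have : ‖T f‖ ^ 2 * ‖T f‖ ^ 2 ≤ (‖T‖ * ⟪T f, f⟫) * ‖T f‖ ^ 2 := by
      nlinarith [mul_le_mul_of_nonneg_left h2 h3]
    exact le_of_mul_le_mul_right this h0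

/-- Operator monotonicity of the square root: `B² ≤ A²` implies `B ≤ A`. -/
theorem inner_le_inner_of_norm_le {A B : H →L[ℝ] H} (hA : A.IsPositive) (hB : B.IsPositive)
    (h : ∀ f, ‖B f‖ ≤ ‖A f‖) (f : H) : ⟪B f, f⟫ ≤ ⟪A f, f⟫ := by
  by_contra! hlt
  have hf : f ≠ 0 := by rintro rfl; simp at hlt
  -- If B ≤ A fails, the numerical range of B - A has a supremum μ > 0. It need not be attained, so
  -- the proof runs an eigenvector argument on an approximate maximiser v, for which P = A - B + μ
  -- is nearly zero.
  set S : Set ℝ := (fun g : H => ⟪B g, g⟫ - ⟪A g, g⟫) '' Metric.sphere 0 1 with hS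
  have hbdd : BddAbove S := by
    refine ⟨‖B‖, ?_⟩
    rintro _ ⟨g, hg, rfl⟩
    have hg1 : ‖g‖ = 1 := by simpa using hg
    have h1 : ⟪B g, g⟫ ≤ ‖B‖ := by
      calc _ ≤ ‖B g‖ * ‖g‖ := real_inner_le_norm _ _
        _ ≤ (‖B‖ * ‖g‖) * ‖g‖ := by gcongr; exact B.le_opNorm _
        _ = _ := by rw [hg1]; ring
    have h2 : 0 ≤ ⟪A g, g⟫ := hA.inner_nonneg_left _
    simp only; linarith
  have hunit : ∀ g : H, g ≠ 0 → ‖(‖g‖⁻¹ • g)‖ = 1 := fun g hg => by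
    rw [norm_smul, norm_inv, norm_norm, inv_mul_cancel₀ (norm_ne_zero_iff.2 hg)]
  have hmem : ∀ g : H, g ≠ 0 → (‖g‖⁻¹) ^ 2 * (⟪B g, g⟫ - ⟪A g, g⟫) ∈ S := fun g hg => by
    refine ⟨‖g‖⁻¹ • g, by simpa using hunit g hg, ?_⟩
    simp only [map_smul, real_inner_smul_left, real_inner_smul_right]
    ring
  set μ := sSup S with hμ
  have hμ0 : 0 < μ := by
    have h1 := le_csSup hbdd (hmem f hf)
    have : 0 < (‖f‖⁻¹) ^ 2 := by positivity
    exact (mul_pos this (by linarith)).trans_le h1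
  have hCB : ∀ g : H, ⟪B g, g⟫ - ⟪A g, g⟫ ≤ μ * ‖g‖ ^ 2 := by
    intro g
    by_cases hg : g = 0
    · simp [hg]
    · have h1 := le_csSup hbdd (hmem g hg)
      have h2 : 0 < ‖g‖ ^ 2 := by positivity
      rw [inv_pow, inv_mul_le_iff₀ h2] at h1
      linarith
  set P : H →L[ℝ] H := A - B + μ • ContinuousLinearMap.id ℝ H with hP
  have hPapp : ∀ g, P g = A g - B g + μ • g := fun g => by simp [hP]
  have hPform : ∀ g, ⟪P g, g⟫ = ⟪A g, g⟫ - ⟪B g, g⟫ + μ * ‖g‖ ^ 2 := fun g => by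
    rw [hPapp, inner_add_left, inner_sub_left, real_inner_smul_left, real_inner_self_eq_norm_sq]
  have hPpos : P.IsPositive := by
    refine (ContinuousLinearMap.isPositive_iff P).2 ⟨fun x y => ?_, fun x => ?_⟩
    · have h1 := hA.inner_left_eq_inner_right x y
      have h2 := hB.inner_left_eq_inner_right x y
      show ⟪P x, y⟫ = ⟪x, P y⟫
      rw [hPapp, hPapp, inner_add_left, inner_sub_left, inner_add_right, inner_sub_right, h1, h2,
        real_inner_smul_left, real_inner_smul_right]
    · rw [hPform]; linarith [hCB x]
  -- This is the amount by which e must be small for (‖Av‖ + e)² < ‖Av‖² + μ².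
  obtain ⟨e, he0, he⟩ : ∃ e : ℝ, 0 < e ∧ 2 * ‖A‖ * e + e ^ 2 < μ ^ 2 := by
    refine ⟨min 1 (μ ^ 2 / (2 * (2 * ‖A‖ + 1))), by positivity, ?_⟩
    set e := min 1 (μ ^ 2 / (2 * (2 * ‖A‖ + 1)))
    have h1 : e ≤ 1 := min_le_left _ _
    have h2 : e ≤ μ ^ 2 / (2 * (2 * ‖A‖ + 1)) := min_le_right _ _
    have h0 : 0 < e := by positivity
    have h3 : e * (2 * (2 * ‖A‖ + 1)) ≤ μ ^ 2 := (le_div_iff₀ (by positivity)).1 h2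
    have hA0 := norm_nonneg A
    nlinarith
  obtain ⟨_, ⟨v, hv, rfl⟩, hv2⟩ := exists_lt_of_lt_csSup ((Set.nonempty_of_mem (hmem f hf)))
    (show μ - e ^ 2 / (‖P‖ + 1) < μ by
      have : 0 < e ^ 2 / (‖P‖ + 1) := by positivity
      linarith)
  have hv1 : ‖v‖ = 1 := by simpa using hv
  have hPv : ⟪P v, v⟫ < e ^ 2 / (‖P‖ + 1) := by
    rw [hPform, hv1]; simp only at hv2; linarith
  have hPv0 : 0 ≤ ⟪P v, v⟫ := hPpos.inner_nonneg_left _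
  have hPn : ‖P v‖ ≤ e := by
    have h1 := norm_sq_le_of_isPositive hPpos v
    have h2 : ‖P‖ * ⟪P v, v⟫ ≤ (‖P‖ + 1) * (e ^ 2 / (‖P‖ + 1)) := by gcongr; linarith
    rw [mul_div_cancel₀ _ (by positivity)] at h2
    exact (sq_le_sq₀ (norm_nonneg _) he0.le).1 (h1.trans h2)
  -- Here Av + μv = Bv + Pv and ‖Bv‖ ≤ ‖Av‖. Positivity of A makes Av and μv form an acute angle, so
  -- the left side is too long.
  have h1 : ‖A v + μ • v‖ ≤ ‖A v‖ + e := by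
    have : A v + μ • v = B v + P v := by rw [hPapp]; abel
    rw [this]
    exact (norm_add_le _ _).trans (add_le_add (h v) hPn)
  have h2 : ‖A v‖ ^ 2 + μ ^ 2 ≤ ‖A v + μ • v‖ ^ 2 := by
    rw [norm_add_sq_real, norm_smul, hv1, real_inner_smul_right, Real.norm_eq_abs, mul_one, sq_abs]
    have : 0 ≤ ⟪A v, v⟫ := hA.inner_nonneg_left _
    nlinarith
  have h3 : ‖A v‖ ≤ ‖A‖ := by simpa [hv1] using A.le_opNorm v
  have h4 : ‖A v + μ • v‖ ^ 2 ≤ (‖A v‖ + e) ^ 2 := pow_le_pow_left₀ (norm_nonneg _) h1 2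
  nlinarith

end PositiveOperators

/-! ### From the condition on ‖T f‖ to bounds for the form of T -/

section DiagonalOperators

variable {H : Type*} [NormedAddCommGroup H] [InnerProductSpace ℝ H] (ψ : HilbertBasis ℕ ℝ H)

theorem hasSum_inner_sq (f : H) : HasSum (fun j => ⟪ψ j, f⟫ ^ 2) (‖f‖ ^ 2) := by
  have := ψ.hasSum_inner_mul_inner f f
  rw [real_inner_self_eq_norm_sq] at this
  refine this.congr_fun (g := fun j => ⟪ψ j, f⟫ ^ 2) fun j => ?_
  rw [real_inner_comm (ψ j) f, sq]

variable {γ : ℕ → ℝ}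

theorem summable_mul_inner_sq {c : ℝ} (h0 : ∀ j, 0 ≤ γ j) (hc : ∀ j, γ j ≤ c) (f : H) :
    Summable fun j => γ j * ⟪ψ j, f⟫ ^ 2 :=
  Summable.of_nonneg_of_le (fun j => mul_nonneg (h0 j) (sq_nonneg _))
    (fun j => mul_le_mul_of_nonneg_right (hc j) (sq_nonneg _))
    ((hasSum_inner_sq ψ f).summable.mul_left c)

theorem wNormSq_eq_ofReal_tsum {w : ℕ → ℝ} (hw : ∀ j, 0 ≤ w j) {f : H}
    (hs : Summable fun j => w j * ⟪ψ j, f⟫ ^ 2) :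
    wNormSq ψ w f = ENNReal.ofReal (∑' j, w j * ⟪ψ j, f⟫ ^ 2) :=
  (ENNReal.ofReal_tsum_of_nonneg (fun j => mul_nonneg (hw j) (sq_nonneg _)) hs).symm

/-- Realises ‖f‖_{γ²} as ‖D f‖ for a positive D, so that the defining condition of the operator
class compares norms of images under two positive operators. Summability of γ makes the rank-one
series converge in norm. -/
theorem exists_diagonal_operator [CompleteSpace H] (h0 : ∀ j, 0 ≤ γ j) (hs : Summable γ) :
    ∃ D : H →L[ℝ] H, D.IsPositive ∧ (∀ f, ⟪D f, f⟫ = ∑' j, γ j * ⟪ψ j, f⟫ ^ 2) ∧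
      ∀ f, ‖D f‖ ^ 2 = ∑' j, γ j ^ 2 * ⟪ψ j, f⟫ ^ 2 := by
  have hsum : Summable fun j => γ j • InnerProductSpace.rankOne ℝ (ψ j) (ψ j) := by
    refine Summable.of_norm (hs.congr fun j => ?_)
    rw [norm_smul, InnerProductSpace.norm_rankOne, ψ.orthonormal.norm_eq_one, Real.norm_eq_abs,
      abs_of_nonneg (h0 j)]
    ring
  set D : H →L[ℝ] H := ∑' j, γ j • InnerProductSpace.rankOne ℝ (ψ j) (ψ j) with hD
  have happ : ∀ f, HasSum (fun j => (γ j * ⟪ψ j, f⟫) • ψ j) (D f) := by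
    intro f
    have := hsum.hasSum.mapL (ContinuousLinearMap.apply ℝ H f)
    simpa [smul_smul] using this
  have hin : ∀ f g, HasSum (fun j => γ j * (⟪ψ j, f⟫ * ⟪ψ j, g⟫)) ⟪D f, g⟫ := by
    intro f g
    have := (happ f).mapL (innerSL ℝ g)
    simp only [innerSL_apply_apply, real_inner_smul_right] at this
    rw [real_inner_comm]
    refine this.congr_fun (g := fun j => γ j * (⟪ψ j, f⟫ * ⟪ψ j, g⟫)) fun j => ?_
    rw [real_inner_comm (ψ j) g]
    ring
  refine ⟨D, (ContinuousLinearMap.isPositive_iff D).2 ⟨fun f g => ?_, fun f => ?_⟩, fun f => ?_,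
    fun f => ?_⟩
  · show ⟪D f, g⟫ = ⟪f, D g⟫
    rw [real_inner_comm (D g) f, ← (hin f g).tsum_eq, ← (hin g f).tsum_eq]
    exact tsum_congr fun j => by ring
  · rw [← (hin f f).tsum_eq]
    exact tsum_nonneg fun j => mul_nonneg (h0 j) (mul_self_nonneg _)
  · rw [← (hin f f).tsum_eq]
    exact tsum_congr fun j => by ring
  · rw [← (hasSum_inner_sq ψ (D f)).tsum_eq]
    refine tsum_congr fun j => ?_
    have h1 := hin f (ψ j)
    have h2 : HasSum (fun l => γ l * (⟪ψ l, f⟫ * ⟪ψ l, ψ j⟫)) (γ j * ⟪ψ j, f⟫) := by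
      convert hasSum_single j fun l hl => ?_ using 1
      · rw [real_inner_self_eq_norm_sq, ψ.orthonormal.norm_eq_one]; ring
      · rw [ψ.orthonormal.inner_eq_zero hl]; ring
    rw [real_inner_comm, h1.unique h2]
    ring

/-- The form bounds for the operators in `opClass`. -/
theorem opClass_form_bounds [CompleteSpace H] (h0 : ∀ j, 0 < γ j) (hs : Summable γ)
    (hγ1 : ∀ j, γ j ≤ 1) {d : ℝ} (hd : 1 ≤ d) {T : H →L[ℝ] H} (hT : T ∈ opClass ψ γ d) (f : H) :
    d⁻¹ * ∑' j, γ j * ⟪ψ j, f⟫ ^ 2 ≤ ⟪T f, f⟫ ∧ ⟪T f, f⟫ ≤ d * ∑' j, γ j * ⟪ψ j, f⟫ ^ 2 := by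
  obtain ⟨hT1, -, -, hT4⟩ := hT
  obtain ⟨D, hD1, hD2, hD3⟩ := exists_diagonal_operator ψ (fun j => (h0 j).le) hs
  have hd0 : 0 < d := by linarith
  have hw : ∀ f, wNormSq ψ (fun j => γ j ^ 2) f = ENNReal.ofReal (‖D f‖ ^ 2) := fun f => by
    rw [hD3]
    exact wNormSq_eq_ofReal_tsum ψ (fun j => sq_nonneg _)
      (summable_mul_inner_sq ψ (c := 1) (fun j => sq_nonneg _)
        (fun j => pow_le_one₀ (h0 j).le (hγ1 j)) f)
  have hn : ∀ (c : ℝ), 0 ≤ c → ∀ f, ‖(c • D) f‖ ^ 2 = c ^ 2 * ‖D f‖ ^ 2 := fun c hc f => by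
    rw [_root_.smul_apply, norm_smul, Real.norm_eq_abs, mul_pow, sq_abs]
  have hpos : ∀ c : ℝ, 0 ≤ c → (c • D).IsPositive := fun c hc => hD1.smul_of_nonneg hc
  constructor
  -- Squared norms carry d², and the square root leaves the factor d in the form bounds.
  · have h1 := inner_le_inner_of_norm_le hT1 (hpos d⁻¹ (by positivity)) (fun f => by
      refine (sq_le_sq₀ (norm_nonneg _) (norm_nonneg _)).1 ?_
      rw [hn _ (by positivity)]
      have := (hT4 f).1
      rw [hw, ← ENNReal.ofReal_mul (by positivity),
        ENNReal.ofReal_le_ofReal_iff (sq_nonneg _)] at this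
      rwa [inv_pow]) f
    rwa [_root_.smul_apply, real_inner_smul_left, hD2] at h1
  · have h1 := inner_le_inner_of_norm_le (hpos d hd0.le) hT1 (fun f => by
      refine (sq_le_sq₀ (norm_nonneg _) (norm_nonneg _)).1 ?_
      rw [hn _ hd0.le]
      have := (hT4 f).2
      rwa [hw, ← ENNReal.ofReal_mul (by positivity),
        ENNReal.ofReal_le_ofReal_iff (by positivity)] at this) f
    rwa [_root_.smul_apply, real_inner_smul_left, hD2] at h1

end DiagonalOperators

/-! ### The span of the first basis vectors -/

section FiniteCombinations

variable {H : Type*} [NormedAddCommGroup H] [InnerProductSpace ℝ H] (ψ : HilbertBasis ℕ ℝ H)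
  {m : ℕ}

/-- The element of the span of the first `m` basis vectors with coefficients `v`. -/
noncomputable def lincomb (v : Fin m → ℝ) : H := ∑ j : Fin m, v j • ψ j

theorem inner_lincomb (v : Fin m → ℝ) (l : ℕ) :
    ⟪ψ l, lincomb ψ v⟫ = if h : l < m then v ⟨l, h⟩ else 0 := by
  rw [lincomb, inner_sum]
  simp only [real_inner_smul_right]
  split_ifs with h
  · rw [Finset.sum_eq_single (⟨l, h⟩ : Fin m)]
    · rw [real_inner_self_eq_norm_sq, ψ.orthonormal.norm_eq_one]; ring
    · intro b _ hb
      rw [ψ.orthonormal.inner_eq_zero, mul_zero]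
      rintro rfl
      exact hb rfl
    · simp
  · refine Finset.sum_eq_zero fun b _ => ?_
    rw [ψ.orthonormal.inner_eq_zero, mul_zero]
    rintro rfl
    exact h b.2

theorem inner_lincomb_fin (v : Fin m → ℝ) (l : Fin m) : ⟪ψ l, lincomb ψ v⟫ = v l := by
  rw [inner_lincomb]; simp

theorem lincomb_sub (v u : Fin m → ℝ) : lincomb ψ (v - u) = lincomb ψ v - lincomb ψ u := by
  simp [lincomb, sub_smul, Finset.sum_sub_distrib]

theorem tsum_mul_inner_lincomb_sq (w : ℕ → ℝ) (v : Fin m → ℝ) :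
    ∑' j, w j * ⟪ψ j, lincomb ψ v⟫ ^ 2 = ∑ j : Fin m, w j * v j ^ 2 := by
  rw [tsum_eq_sum (s := Finset.range m)]
  · rw [Finset.sum_range]
    exact Finset.sum_congr rfl fun j _ => by rw [inner_lincomb_fin]
  · intro j hj
    rw [inner_lincomb, dif_neg (by simpa using hj)]
    ring

theorem summable_mul_inner_lincomb_sq (w : ℕ → ℝ) (v : Fin m → ℝ) :
    Summable fun j => w j * ⟪ψ j, lincomb ψ v⟫ ^ 2 := by
  refine summable_of_ne_finset_zero (s := Finset.range m) fun j hj => ?_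
  rw [inner_lincomb, dif_neg (by simpa using hj)]
  ring

theorem wNormSq_lincomb {w : ℕ → ℝ} (hw : ∀ j, 0 ≤ w j) (v : Fin m → ℝ) :
    wNormSq ψ w (lincomb ψ v) = ENNReal.ofReal (∑ j : Fin m, w j * v j ^ 2) := by
  rw [wNormSq_eq_ofReal_tsum ψ hw (summable_mul_inner_lincomb_sq ψ w v),
    tsum_mul_inner_lincomb_sq]

theorem galerkin_eq_lincomb (K : MatSeq) (g : ℕ → ℝ) (m : ℕ) :
    galerkin ψ K g m = lincomb ψ ((K m)⁻¹ *ᵥ headVec g m) := rfl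

theorem form_opMat (T : H →L[ℝ] H) (v u : Fin m → ℝ) :
    v ⬝ᵥ opMat ψ T m *ᵥ u = ⟪lincomb ψ v, T (lincomb ψ u)⟫ := by
  simp only [lincomb, map_sum, map_smul, sum_inner, real_inner_smul_left, dotProduct]
  refine Finset.sum_congr rfl fun i _ => ?_
  simp only [inner_sum, real_inner_smul_right, Matrix.mulVec, opMat, Matrix.of_apply, dotProduct,
    Finset.mul_sum]
  exact Finset.sum_congr rfl fun j _ => by ring

theorem lincomb_eq_zero_iff (v : Fin m → ℝ) : lincomb ψ v = 0 ↔ v = 0 := by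
  constructor
  · intro h
    ext l
    rw [← inner_lincomb_fin ψ v l, h]; simp
  · rintro rfl; simp [lincomb]

theorem posDef_opMat {T : H →L[ℝ] H} (hT : T.IsPositive) (hpos : ∀ f : H, f ≠ 0 → 0 < ⟪T f, f⟫)
    (m : ℕ) : (opMat ψ T m).PosDef := by
  refine Matrix.PosDef.of_dotProduct_mulVec_pos ?_ fun {x} hx => ?_
  · ext i j
    simp only [opMat, Matrix.conjTranspose_apply, Matrix.of_apply, star_trivial]
    rw [real_inner_comm, hT.inner_left_eq_inner_right]
  · simp only [star_trivial]
    rw [form_opMat, real_inner_comm]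
    exact hpos _ (by rwa [Ne, lincomb_eq_zero_iff])

end FiniteCombinations

end FLR

namespace FLR

open Matrix

/-! ### Weighted norms and monotone weights -/

section WeightedNorm

variable {H : Type*} [NormedAddCommGroup H] [InnerProductSpace ℝ H] (ψ : HilbertBasis ℕ ℝ H)
  {w b γ : ℕ → ℝ}

theorem wNormSq_sub_le (hw : ∀ j, 0 ≤ w j) (f g : H) :
    wNormSq ψ w (f - g) ≤ 2 * wNormSq ψ w f + 2 * wNormSq ψ w g := by
  rw [wNormSq, wNormSq, wNormSq, ← ENNReal.tsum_mul_left, ← ENNReal.tsum_mul_left,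
    ← ENNReal.tsum_add]
  refine ENNReal.tsum_le_tsum fun j => ?_
  have h2 : (2 : ℝ≥0∞) = ENNReal.ofReal 2 := by simp
  rw [h2, ← ENNReal.ofReal_mul (by norm_num), ← ENNReal.ofReal_mul (by norm_num),
    ← ENNReal.ofReal_add (by have := hw j; positivity) (by have := hw j; positivity),
    inner_sub_right]
  refine ENNReal.ofReal_le_ofReal ?_
  nlinarith [mul_nonneg (hw j) (sq_nonneg (⟪ψ j, f⟫ + ⟪ψ j, g⟫))]

namespace RegularWeights

theorem one_le_b (hR : RegularWeights w b γ) (j : ℕ) : 1 ≤ b j := by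
  have h := hR.b_inv_anti (Nat.zero_le j)
  simp only [hR.b_one, inv_one] at h
  exact (inv_le_one₀ (hR.b_pos j)).1 h

theorem b_mono (hR : RegularWeights w b γ) : Monotone b := fun i j hij =>
  (inv_le_inv₀ (hR.b_pos j) (hR.b_pos i)).1 (hR.b_inv_anti hij)

theorem w_le_b (hR : RegularWeights w b γ) (j : ℕ) : w j ≤ b j := by
  have h := hR.w_b_anti (Nat.zero_le j)
  simp only [hR.b_one, hR.w_one, inv_one, mul_one] at h
  rwa [← div_eq_mul_inv, div_le_one (hR.b_pos j)] at h

theorem γ_le_one (hR : RegularWeights w b γ) (j : ℕ) : γ j ≤ 1 :=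
  (hR.γ_anti (Nat.zero_le j)).trans hR.γ_one.le

end RegularWeights

theorem ellipsoid_summable (hb : ∀ j, 0 ≤ b j) {r : ℝ} (hr : 0 ≤ r) {φ : H}
    (hφ : φ ∈ ellipsoid ψ b r) :
    (Summable fun j => b j * ⟪ψ j, φ⟫ ^ 2) ∧ ∑' j, b j * ⟪ψ j, φ⟫ ^ 2 ≤ r := by
  have h1 : wNormSq ψ b φ ≤ ENNReal.ofReal r := hφ
  have h2 : Summable fun j => b j * ⟪ψ j, φ⟫ ^ 2 := by
    have h3 : ∑' j, ENNReal.ofReal (b j * ⟪ψ j, φ⟫ ^ 2) ≠ ∞ :=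
      (h1.trans_lt ENNReal.ofReal_lt_top).ne
    have := ENNReal.summable_toReal h3
    refine this.congr fun j => ?_
    rw [ENNReal.toReal_ofReal (mul_nonneg (hb j) (sq_nonneg _))]
  rw [wNormSq_eq_ofReal_tsum ψ hb h2, ENNReal.ofReal_le_ofReal_iff hr] at h1
  exact ⟨h2, h1⟩

theorem wNormSq_le_of_mem_ellipsoid (hR : RegularWeights w b γ) {r : ℝ} {φ : H}
    (hφ : φ ∈ ellipsoid ψ b r) : wNormSq ψ w φ ≤ ENNReal.ofReal r := by
  refine le_trans (ENNReal.tsum_le_tsum fun j => ?_) hφ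
  exact ENNReal.ofReal_le_ofReal (mul_le_mul_of_nonneg_right (hR.w_le_b j) (sq_nonneg _))

end WeightedNorm

/-! ### Galerkin solutions: orthogonality and bias -/

section Galerkin

variable {H : Type*} [NormedAddCommGroup H] [InnerProductSpace ℝ H] (ψ : HilbertBasis ℕ ℝ H)
  {w b γ : ℕ → ℝ} {T : H →L[ℝ] H} {φ : H} {g : ℕ → ℝ}

/-- Galerkin orthogonality. In the model it says that Y - ⟨φ^m, X⟩ is uncorrelated with the first m
coordinates of X. -/
theorem inner_galerkin_residual (hT : T.IsPositive) (hpos : ∀ f : H, f ≠ 0 → 0 < ⟪T f, f⟫)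
    (hg : ∀ j, g j = ⟪ψ j, T φ⟫) (m : ℕ) (v : Fin m → ℝ) :
    ⟪lincomb ψ v, T (φ - galerkin ψ (opMat ψ T) g m)⟫ = 0 := by
  rw [map_sub, inner_sub_right, galerkin_eq_lincomb, ← form_opMat,
    PosDef.mul_inv_mulVec (posDef_isUnit_det (posDef_opMat ψ hT hpos m))]
  simp only [lincomb, sum_inner, real_inner_smul_left, dotProduct, headVec, hg]
  ring

/-- Pythagoras: the Galerkin solution is the orthogonal projection for the inner product given by
the form of T. -/
theorem form_sub_lincomb (hT : T.IsPositive) (hpos : ∀ f : H, f ≠ 0 → 0 < ⟪T f, f⟫)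
    (hg : ∀ j, g j = ⟪ψ j, T φ⟫) (m : ℕ) (v : Fin m → ℝ) :
    ⟪T (φ - lincomb ψ v), φ - lincomb ψ v⟫ =
      ⟪T (φ - galerkin ψ (opMat ψ T) g m), φ - galerkin ψ (opMat ψ T) g m⟫ +
      ⟪T (galerkin ψ (opMat ψ T) g m - lincomb ψ v),
        galerkin ψ (opMat ψ T) g m - lincomb ψ v⟫ := by
  set p := galerkin ψ (opMat ψ T) g m with hp
  have h0 : ⟪p - lincomb ψ v, T (φ - p)⟫ = 0 := by
    rw [hp, galerkin_eq_lincomb, ← lincomb_sub, ← galerkin_eq_lincomb]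
    exact inner_galerkin_residual ψ hT hpos hg m _
  have h1 : φ - lincomb ψ v = (φ - p) + (p - lincomb ψ v) := by abel
  have h2 : ⟪T (p - lincomb ψ v), φ - p⟫ = 0 := by
    rw [hT.inner_left_eq_inner_right, h0]
  have h3 : ⟪T (φ - p), p - lincomb ψ v⟫ = 0 := by rw [real_inner_comm, h0]
  rw [h1, map_add, inner_add_left, inner_add_right, inner_add_right, h2, h3]
  ring

/-- Pythagoras at the zero vector: the variance of ⟨φ, X⟩ splits into a residual part and the part
explained by the first m coordinates. -/
theorem form_eq_add_galerkin (hT : T.IsPositive) (hpos : ∀ f : H, f ≠ 0 → 0 < ⟪T f, f⟫)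
    (hg : ∀ j, g j = ⟪ψ j, T φ⟫) (m : ℕ) :
    ⟪T φ, φ⟫ =
      ⟪T (φ - galerkin ψ (opMat ψ T) g m), φ - galerkin ψ (opMat ψ T) g m⟫ +
      headVec g m ⬝ᵥ (opMat ψ T m)⁻¹ *ᵥ headVec g m := by
  have h := form_sub_lincomb ψ hT hpos hg m 0
  have h0 : lincomb ψ (0 : Fin m → ℝ) = 0 := (lincomb_eq_zero_iff ψ _).2 rfl
  simp only [h0, sub_zero] at h
  rw [h]
  congr 1
  rw [galerkin_eq_lincomb, real_inner_comm, ← form_opMat,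
    PosDef.mul_inv_mulVec (posDef_isUnit_det (posDef_opMat ψ hT hpos m)), dotProduct_comm]

variable [CompleteSpace H] {d r : ℝ}

theorem form_le_of_mem_ellipsoid (hR : RegularWeights w b γ) (hd : 1 ≤ d) (hr : 0 ≤ r)
    (hT : T ∈ opClass ψ γ d) (hφ : φ ∈ ellipsoid ψ b r) : ⟪T φ, φ⟫ ≤ d * r := by
  refine (opClass_form_bounds ψ hR.γ_pos hR.γ_summable hR.γ_le_one hd hT φ).2.trans ?_
  obtain ⟨h1, h2⟩ := ellipsoid_summable ψ (fun j => (hR.b_pos j).le) hr hφ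
  gcongr
  refine (Summable.tsum_le_tsum (fun j => ?_)
    (summable_mul_inner_sq ψ (fun j => (hR.γ_pos j).le) hR.γ_le_one φ) h1).trans h2
  exact mul_le_mul_of_nonneg_right ((hR.γ_le_one j).trans (hR.one_le_b j)) (sq_nonneg _)

/-- The Galerkin solution stays in a multiple of the ellipsoid, in the weighted norm. -/
theorem wNormSq_galerkin_le (hR : RegularWeights w b γ) (hd : 1 ≤ d) (hr : 0 ≤ r)
    (hT : T ∈ opClass ψ γ d) (hφ : φ ∈ ellipsoid ψ b r) (hg : ∀ j, g j = ⟪ψ j, T φ⟫) (m : ℕ) :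
    wNormSq ψ w (galerkin ψ (opMat ψ T) g m) ≤ ENNReal.ofReal (4 * d ^ 2 * r) := by
  obtain ⟨h1, h2⟩ := ellipsoid_summable ψ (fun j => (hR.b_pos j).le) hr hφ
  have hTc := hT
  obtain ⟨hT1, hT2, -, -⟩ := hTc
  have hbounds := opClass_form_bounds ψ hR.γ_pos hR.γ_summable hR.γ_le_one hd hT
  have hd0 : 0 < d := by linarith
  set a : Fin m → ℝ := (opMat ψ T m)⁻¹ *ᵥ headVec g m with ha
  set p : Fin m → ℝ := fun j => ⟪ψ j, φ⟫ with hp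
  have hform := form_sub_lincomb ψ hT1 hT2 hg m p
  rw [galerkin_eq_lincomb, ← ha, ← lincomb_sub] at hform
  have hA0 : 0 ≤ ⟪T (φ - lincomb ψ a), φ - lincomb ψ a⟫ := hT1.inner_nonneg_left _
  -- the tail of `φ`
  have htail : ∑' j, γ j * ⟪ψ j, φ - lincomb ψ p⟫ ^ 2 ≤ γ m / b m * r := by
    refine (Summable.tsum_le_tsum (fun j => ?_)
      (summable_mul_inner_sq ψ (fun j => (hR.γ_pos j).le) hR.γ_le_one _)
      (h1.mul_left (γ m / b m))).trans ?_
    · rw [inner_sub_right, inner_lincomb]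
      have hb := hR.b_pos m
      have hg := hR.γ_pos m
      by_cases hj : j < m
      · rw [dif_pos hj]
        simp only [hp, sub_self]
        have := hR.b_pos j
        rw [zero_pow two_ne_zero, mul_zero]
        positivity
      · rw [dif_neg hj, sub_zero, ← mul_assoc]
        gcongr
        rw [div_mul_eq_mul_div, le_div_iff₀ hb]
        have hmj : m ≤ j := not_lt.1 hj
        exact mul_le_mul (hR.γ_anti hmj) (hR.b_mono hmj) hb.le hg.le
    · rw [tsum_mul_left]
      have hb := hR.b_pos m
      have hg := hR.γ_pos m
      gcongr
  -- The Galerkin solution is at least as close to φ as the truncation p in the form of T; each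
  -- passage between this form and the γ-norm costs a factor d.
  have hdiff : ∑ j : Fin m, γ j * (a - p) j ^ 2 ≤ d ^ 2 * (γ m / b m * r) := by
    have h3 := (hbounds (lincomb ψ (a - p))).1
    rw [tsum_mul_inner_lincomb_sq, inv_mul_le_iff₀ hd0] at h3
    have h4 := (hbounds (φ - lincomb ψ p)).2
    calc _ ≤ _ := h3
      _ ≤ d * (d * (γ m / b m * r)) := by
        gcongr
        calc _ ≤ ⟪T (φ - lincomb ψ p), φ - lincomb ψ p⟫ := by rw [hform]; linarith
          _ ≤ _ := h4
          _ ≤ _ := by gcongr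
      _ = _ := by ring
  -- Inverse inequality on the first m coordinates: w_j ≤ b_m and γ_j ≥ γ_m. The ratio b_m / γ_m
  -- cancels the ratio gained from the tail of φ.
  have hdw : ∑ j : Fin m, w j * (a - p) j ^ 2 ≤ d ^ 2 * r := by
    have hb := hR.b_pos m
    have hg := hR.γ_pos m
    calc _ ≤ ∑ j : Fin m, (b m / γ m) * (γ j * (a - p) j ^ 2) := by
          refine Finset.sum_le_sum fun j _ => ?_
          rw [← mul_assoc]
          gcongr
          rw [div_mul_eq_mul_div, le_div_iff₀ hg]
          exact mul_le_mul ((hR.w_le_b j).trans (hR.b_mono j.2.le)) (hR.γ_anti j.2.le) hg.le hb.le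
      _ = (b m / γ m) * ∑ j : Fin m, γ j * (a - p) j ^ 2 := by rw [Finset.mul_sum]
      _ ≤ (b m / γ m) * (d ^ 2 * (γ m / b m * r)) := by gcongr
      _ = _ := by field_simp
  have hpw : ∑ j : Fin m, w j * p j ^ 2 ≤ r := by
    have h5 := h1.sum_le_tsum (Finset.range m)
      (fun j _ => mul_nonneg (hR.b_pos j).le (sq_nonneg _))
    rw [Finset.sum_range] at h5
    refine le_trans (Finset.sum_le_sum fun j _ => ?_) (h5.trans h2)
    exact mul_le_mul_of_nonneg_right (hR.w_le_b j) (sq_nonneg _)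
  rw [galerkin_eq_lincomb, ← ha, wNormSq_lincomb ψ fun j => (hR.w_pos j).le]
  refine ENNReal.ofReal_le_ofReal ?_
  calc _ ≤ ∑ j : Fin m, (2 * (w j * (a - p) j ^ 2) + 2 * (w j * p j ^ 2)) := by
        refine Finset.sum_le_sum fun j _ => ?_
        have := mul_nonneg (hR.w_pos j).le (sq_nonneg (a j - 2 * p j))
        simp only [Pi.sub_apply]
        nlinarith
    _ ≤ 2 * (d ^ 2 * r) + 2 * r := by
        rw [Finset.sum_add_distrib, ← Finset.mul_sum, ← Finset.mul_sum]
        gcongr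
    _ ≤ 4 * d ^ 2 * r := by nlinarith [mul_le_mul_of_nonneg_right (one_le_pow₀ hd (n := 2)) hr]

theorem wNormSq_galerkin_sub_le (hR : RegularWeights w b γ) (hd : 1 ≤ d) (hr : 0 ≤ r)
    (hT : T ∈ opClass ψ γ d) (hφ : φ ∈ ellipsoid ψ b r) (hg : ∀ j, g j = ⟪ψ j, T φ⟫) (m : ℕ) :
    wNormSq ψ w (galerkin ψ (opMat ψ T) g m - φ) ≤ ENNReal.ofReal (10 * d ^ 2 * r) := by
  refine (wNormSq_sub_le ψ (fun j => (hR.w_pos j).le) _ _).trans ?_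
  have h2 : (2 : ℝ≥0∞) = ENNReal.ofReal 2 := by simp
  calc _ ≤ 2 * ENNReal.ofReal (4 * d ^ 2 * r) + 2 * ENNReal.ofReal r := by
        gcongr
        · exact wNormSq_galerkin_le ψ hR hd hr hT hφ hg m
        · exact wNormSq_le_of_mem_ellipsoid ψ hR hφ
    _ = ENNReal.ofReal (2 * (4 * d ^ 2 * r) + 2 * r) := by
        rw [h2, ← ENNReal.ofReal_mul (by norm_num), ← ENNReal.ofReal_mul (by norm_num),
          ENNReal.ofReal_add (by positivity) (by positivity)]
    _ ≤ _ := ENNReal.ofReal_le_ofReal (by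
        nlinarith [mul_le_mul_of_nonneg_right (one_le_pow₀ hd (n := 2)) hr])

end Galerkin

end FLR

namespace FLR

open scoped NNReal

/-! ### Exponential moments of squares of normal variables -/

section GaussianSquares

theorem lintegral_exp_mul_sq_gaussianReal {v : ℝ≥0} {c : ℝ} (hc : 2 * c * v < 1) :
    ∫⁻ x, ENNReal.ofReal (Real.exp (c * x ^ 2)) ∂(gaussianReal 0 v) =
      ENNReal.ofReal (√(1 - 2 * c * v))⁻¹ := by
  by_cases hv : v = 0
  · subst hv
    rw [gaussianReal_zero_var, lintegral_dirac' _ (by fun_prop)]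
    simp
  have hv0 : (0 : ℝ) < v := by positivity
  rw [gaussianReal_of_var_ne_zero _ hv,
    lintegral_withDensity_eq_lintegral_mul _ (measurable_gaussianPDF _ _) (by fun_prop)]
  set b : ℝ := 1 / (2 * v) - c with hb
  have hb0 : 0 < b := by
    rw [hb, sub_pos, lt_div_iff₀ (by positivity)]; linarith
  have h1 : ∀ x : ℝ, (gaussianPDF 0 v * fun x => ENNReal.ofReal (Real.exp (c * x ^ 2))) x =
      ENNReal.ofReal ((√(2 * Real.pi * v))⁻¹ * Real.exp (-b * x ^ 2)) := by
    intro x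
    rw [Pi.mul_apply, gaussianPDF, ← ENNReal.ofReal_mul (gaussianPDFReal_nonneg _ _ _),
      gaussianPDFReal, mul_assoc, ← Real.exp_add]
    congr 3
    rw [hb]; field_simp; ring
  rw [lintegral_congr h1, ← ofReal_integral_eq_lintegral_ofReal
    ((integrable_exp_neg_mul_sq hb0).const_mul _)
    (Filter.Eventually.of_forall fun x => by positivity), integral_const_mul, integral_gaussian]
  congr 1
  rw [← Real.sqrt_inv, ← Real.sqrt_mul (by positivity), ← Real.sqrt_inv]
  congr 1
  rw [hb]
  have : 1 - 2 * c * v ≠ 0 := by linarith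
  have h3 : 1 / (2 * (v : ℝ)) - c = (1 - 2 * c * v) / (2 * v) := by field_simp
  rw [h3]
  have := Real.pi_ne_zero
  field_simp

variable {Ω : Type*} [MeasurableSpace Ω] {P : Measure Ω}

theorem lintegral_prod_comp_of_iIndepFun {ι : Type*} [Fintype ι] {N : ι → Ω → ℝ}
    (hN : iIndepFun N P) (hm : ∀ i, AEMeasurable (N i) P) {ν : Measure ℝ}
    (hl : ∀ i, P.map (N i) = ν) {f : ℝ → ℝ≥0∞} (hf : Measurable f) :
    ∫⁻ ω, ∏ i, f (N i ω) ∂P = (∫⁻ x, f x ∂ν) ^ Fintype.card ι := by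
  have := hN.isProbabilityMeasure
  rcases isEmpty_or_nonempty ι with hι | ⟨⟨i₀⟩⟩
  · simp
  have hν : IsProbabilityMeasure ν := hl i₀ ▸ Measure.isProbabilityMeasure_map (hm i₀)
  have h1 : P.map (fun ω i => N i ω) = Measure.pi fun _ : ι => ν := by
    rw [hN.map_fun_eq_pi_map hm]
    simp_rw [hl]
  have h2 : ∫⁻ ω, ∏ i, f (N i ω) ∂P = ∫⁻ x : ι → ℝ, ∏ i, f (x i) ∂(Measure.pi fun _ : ι => ν) := by
    have hfm : Measurable fun x : ι → ℝ => ∏ i, f (x i) :=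
      Finset.univ.measurable_fun_prod fun i _ => hf.comp (measurable_pi_apply i)
    rw [← h1, lintegral_map' hfm.aemeasurable (by fun_prop)]
  rw [h2]
  have h3 : iIndepFun (fun i (x : ι → ℝ) => f (x i)) (Measure.pi fun _ : ι => ν) :=
    iIndepFun_pi (Ω := fun _ => ℝ) (μ := fun _ => ν) (X := fun _ => f)
      (fun i => hf.aemeasurable)
  rw [lintegral_prod_eq_prod_lintegral_of_indepFun Finset.univ _ h3 (by fun_prop)]
  rw [← Finset.card_univ, ← Finset.prod_const]
  refine Finset.prod_congr rfl fun i _ => ?_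
  have := (measurePreserving_eval (fun _ : ι => ν) i).lintegral_comp hf
  simpa using this

theorem lintegral_exp_mul_sum_sq {ι : Type*} [Fintype ι] {N : ι → Ω → ℝ}
    (hN : iIndepFun N P) (hm : ∀ i, AEMeasurable (N i) P) {v : ℝ≥0}
    (hl : ∀ i, P.map (N i) = gaussianReal 0 v) {c : ℝ} (hc : 2 * c * v < 1) :
    ∫⁻ ω, ENNReal.ofReal (Real.exp (c * ∑ i, N i ω ^ 2)) ∂P =
      ENNReal.ofReal (√(1 - 2 * c * v))⁻¹ ^ Fintype.card ι := by
  rw [← lintegral_exp_mul_sq_gaussianReal hc,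
    ← lintegral_prod_comp_of_iIndepFun hN hm hl (by fun_prop)]
  refine lintegral_congr fun ω => ?_
  rw [Finset.mul_sum, Real.exp_sum, ENNReal.ofReal_prod_of_nonneg fun i _ => (Real.exp_pos _).le]

end GaussianSquares

/-! ### Chernoff bounds for χ² variables, in integrated form -/

section ChiSquareTails

/-- A sum of two exponentials that is at least one as soon as `|s / (n v) - 1| ≥ τ`. -/
noncomputable def chiExcess (τ v : ℝ) (n : ℕ) (s : ℝ) : ℝ :=
  Real.exp (τ / 8 * (s / v - n * (1 + τ))) + Real.exp (τ / 8 * (n * (1 - τ) - s / v))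

theorem chiExcess_nonneg (τ v : ℝ) (n : ℕ) (s : ℝ) : 0 ≤ chiExcess τ v n s := by
  unfold chiExcess; positivity

theorem measurable_chiExcess (τ v : ℝ) (n : ℕ) : Measurable (chiExcess τ v n) := by
  unfold chiExcess; fun_prop

/-- Replaces the indicator of a deviation event by a smooth majorant, so that excesses can be added
up and integrated without passing through probabilities. -/
theorem abs_sub_le_or_one_le_chiExcess {τ v : ℝ} (hτ : 0 ≤ τ) (hv : 0 < v) {n : ℕ} (hn : 0 < n)
    (s : ℝ) : |(n : ℝ)⁻¹ * s - v| ≤ τ * v ∨ 1 ≤ chiExcess τ v n s := by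
  by_contra! h
  obtain ⟨h1, h2⟩ := h
  have hn0 : (0 : ℝ) < n := by exact_mod_cast hn
  unfold chiExcess at h2
  have e1 : s / v - n * (1 + τ) = n / v * ((n : ℝ)⁻¹ * s - v - τ * v) := by field_simp; ring
  have e2 : n * (1 - τ) - s / v = n / v * (-((n : ℝ)⁻¹ * s - v) - τ * v) := by field_simp; ring
  rcases lt_abs.1 h1 with h | h
  · have : 0 ≤ τ / 8 * (s / v - n * (1 + τ)) := by
      rw [e1]
      have : 0 ≤ (n : ℝ)⁻¹ * s - v - τ * v := by linarith
      positivity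
    have := Real.one_le_exp this
    linarith [Real.exp_pos (τ / 8 * (n * (1 - τ) - s / v))]
  · have : 0 ≤ τ / 8 * (n * (1 - τ) - s / v) := by
      rw [e2]
      have : 0 ≤ -((n : ℝ)⁻¹ * s - v) - τ * v := by linarith
      positivity
    have := Real.one_le_exp this
    linarith [Real.exp_pos (τ / 8 * (s / v - n * (1 + τ)))]

theorem inv_sqrt_one_sub_le_exp {x : ℝ} (hx : x ≤ 1 / 2) :
    (√(1 - x))⁻¹ ≤ Real.exp ((x + 2 * x ^ 2) / 2) := by
  have h0 : 0 < 1 - x := by linarith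
  have h1 : (1 - x)⁻¹ ≤ Real.exp (x + 2 * x ^ 2) := by
    have h2 := Real.add_one_le_exp (x + 2 * x ^ 2)
    refine le_trans ?_ h2
    rw [inv_le_iff_one_le_mul₀ h0]
    -- (1 - x)(1 + x + 2x²) = 1 + x²(1 - 2x).
    nlinarith [mul_nonneg (sq_nonneg x) (by linarith : 0 ≤ 1 - 2 * x)]
  rw [← Real.sqrt_inv, Real.exp_half]
  exact Real.sqrt_le_sqrt h1

variable {Ω : Type*} [MeasurableSpace Ω] {P : Measure Ω}

/-- The Chernoff bound at the parameters ±τ / (8v), with the moment generating function of the χ²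
distribution. -/
theorem lintegral_chiExcess_le {n : ℕ} {N : Fin n → Ω → ℝ}
    (hN : iIndepFun N P) (hm : ∀ i, AEMeasurable (N i) P) {v : ℝ≥0} (hv : v ≠ 0)
    (hl : ∀ i, P.map (N i) = gaussianReal 0 v) {τ : ℝ} (hτ0 : 0 ≤ τ) (hτ : τ ≤ 1) :
    ∫⁻ ω, ENNReal.ofReal (chiExcess τ v n (∑ i, N i ω ^ 2)) ∂P ≤
      ENNReal.ofReal (2 * Real.exp (-(n * τ ^ 2 / 16))) := by
  have hv0 : (0 : ℝ) < v := by positivity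
  have key : ∀ x : ℝ, x ≤ 1 / 2 → ∀ a : ℝ, n * ((x + 2 * x ^ 2) / 2) + a ≤ -(n * τ ^ 2 / 16) →
      ∫⁻ ω, ENNReal.ofReal (Real.exp (x / (2 * v) * ∑ i, N i ω ^ 2 + a)) ∂P ≤
        ENNReal.ofReal (Real.exp (-(n * τ ^ 2 / 16))) := by
    intro x hx a ha
    have hc : 2 * (x / (2 * v)) * v = x := by field_simp
    have h1 : ∀ ω, ENNReal.ofReal (Real.exp (x / (2 * v) * ∑ i, N i ω ^ 2 + a)) =
        ENNReal.ofReal (Real.exp a) *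
          ENNReal.ofReal (Real.exp (x / (2 * v) * ∑ i, N i ω ^ 2)) := fun ω => by
      rw [← ENNReal.ofReal_mul (Real.exp_pos _).le, ← Real.exp_add, add_comm]
    rw [lintegral_congr h1, lintegral_const_mul' _ _ ENNReal.ofReal_ne_top,
      lintegral_exp_mul_sum_sq hN hm hl (by rw [hc]; linarith), hc, Fintype.card_fin,
      ← ENNReal.ofReal_pow (by positivity), ← ENNReal.ofReal_mul (by positivity)]
    refine ENNReal.ofReal_le_ofReal ?_
    calc _ ≤ Real.exp a * Real.exp ((x + 2 * x ^ 2) / 2) ^ n := by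
          gcongr; exact inv_sqrt_one_sub_le_exp hx
      _ = Real.exp (n * ((x + 2 * x ^ 2) / 2) + a) := by
          rw [← Real.exp_nat_mul, ← Real.exp_add, add_comm]
      _ ≤ _ := Real.exp_le_exp.2 ha
  have h2 : ∀ ω, ENNReal.ofReal (chiExcess τ v n (∑ i, N i ω ^ 2)) =
      ENNReal.ofReal (Real.exp ((τ / 4) / (2 * v) * ∑ i, N i ω ^ 2 + -(τ / 8 * (n * (1 + τ))))) +
      ENNReal.ofReal (Real.exp ((-(τ / 4)) / (2 * v) * ∑ i, N i ω ^ 2 + τ / 8 * (n * (1 - τ)))) := by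
    intro ω
    rw [chiExcess, ENNReal.ofReal_add (Real.exp_pos _).le (Real.exp_pos _).le]
    congr 3
    · field_simp; ring
    · field_simp; ring
  rw [lintegral_congr h2, lintegral_add_left' (by fun_prop), two_mul (Real.exp _),
    ENNReal.ofReal_add (by positivity) (by positivity)]
  -- For x = ±τ/4 the exponent n (x + 2x²) / 2 + a equals -n τ² / 16 exactly.
  refine add_le_add (key _ (by linarith) _ (le_of_eq ?_)) (key _ (by linarith) _ (le_of_eq ?_))
  · ring
  · ring

/-- The eighth power of a Gaussian variable. -/
theorem lintegral_pow_eight_le {N : Ω → ℝ} (hm : AEMeasurable N P) {v : ℝ≥0}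
    (hl : P.map N = gaussianReal 0 v) {s : ℝ} (hs : 0 < s) (hvs : v ≤ s) :
    ∫⁻ ω, ENNReal.ofReal ((N ω ^ 2 / s) ^ 4) ∂P ≤ ENNReal.ofReal 12288 := by
  have h1 : ∀ ω, ENNReal.ofReal ((N ω ^ 2 / s) ^ 4) ≤
      ENNReal.ofReal 6144 * ENNReal.ofReal (Real.exp (1 / (4 * s) * N ω ^ 2)) := by
    intro ω
    rw [← ENNReal.ofReal_mul (by norm_num)]
    refine ENNReal.ofReal_le_ofReal ?_
    -- u⁴ / 4! ≤ exp u at u = N² / (4s) gives the constant 4⁴ · 4! = 6144; the exponential moment is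
    -- at most 2 because the variance is at most s.
    have h2 := Real.pow_div_factorial_le_exp (x := 1 / (4 * s) * N ω ^ 2) (by positivity) 4
    have h3 : (1 / (4 * s) * N ω ^ 2) ^ 4 / (Nat.factorial 4 : ℝ) = (N ω ^ 2 / s) ^ 4 / 6144 := by
      simp [Nat.factorial]; field_simp; ring
    rw [h3] at h2
    linarith
  have hc : 2 * (1 / (4 * s)) * v ≤ 1 / 2 := by
    rw [mul_one_div, div_mul_eq_mul_div, div_le_iff₀ (by positivity)]
    linarith
  have h4 : ∫⁻ ω, ENNReal.ofReal (Real.exp (1 / (4 * s) * N ω ^ 2)) ∂P =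
      ENNReal.ofReal (√(1 - 2 * (1 / (4 * s)) * v))⁻¹ := by
    rw [← lintegral_exp_mul_sq_gaussianReal (by linarith), ← hl, lintegral_map' (by fun_prop) hm]
  refine (lintegral_mono h1).trans ?_
  rw [lintegral_const_mul' _ _ ENNReal.ofReal_ne_top, h4, ← ENNReal.ofReal_mul (by norm_num)]
  refine ENNReal.ofReal_le_ofReal ?_
  have h5 : (√(1 - 2 * (1 / (4 * s)) * v))⁻¹ ≤ 2 := by
    rw [inv_le_comm₀ (Real.sqrt_pos.2 (by linarith)) (by norm_num)]
    refine Real.le_sqrt_of_sq_le ?_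
    linarith
  linarith

end ChiSquareTails

/-! ### A χ² variable with an independent random scale -/

section ConditionalGaussian

variable {Ω : Type*} [MeasurableSpace Ω] {P : Measure Ω}

/-- The exponential moment of `∑_j (∑_i U_i Z_{ij})²` where the standard normal array `Z` is
independent of `U`, on the event that `∑_i U_i² ≤ t`. -/
theorem lintegral_exp_sum_sq_mix_le {n k : ℕ} {U : Fin n → Ω → ℝ} {Z : Fin n × Fin k → Ω → ℝ}
    (hind : IndepFun (fun ω i => U i ω) (fun ω p => Z p ω) P) (hU : ∀ i, AEMeasurable (U i) P)
    (hZ : HasGaussianLaw (fun ω p => Z p ω) P) (hmean : ∀ p, ∫ ω, Z p ω ∂P = 0)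
    (hcov : ∀ p q, cov[Z p, Z q; P] = if p = q then 1 else 0)
    {c t : ℝ} (hc : 0 ≤ c) (hct : 2 * c * t ≤ 1 / 2) :
    ∫⁻ ω, (if ∑ i, U i ω ^ 2 ≤ t then
        ENNReal.ofReal (Real.exp (c * ∑ j, (∑ i, U i ω * Z (i, j) ω) ^ 2)) else 0) ∂P ≤
      ENNReal.ofReal (√2 ^ k) := by
  have := hZ.isProbabilityMeasure
  have hZm : ∀ p, AEMeasurable (Z p) P := fun p => (hZ.eval p).aemeasurable
  have hUm : AEMeasurable (fun ω i => U i ω) P := by fun_prop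
  have hZm' : AEMeasurable (fun ω p => Z p ω) P := by fun_prop
  set F : (Fin n → ℝ) × (Fin n × Fin k → ℝ) → ℝ≥0∞ := fun q =>
    if ∑ i, q.1 i ^ 2 ≤ t then
      ENNReal.ofReal (Real.exp (c * ∑ j, (∑ i, q.1 i * q.2 (i, j)) ^ 2)) else 0 with hF
  have hFm : Measurable F := by
    refine Measurable.ite ?_ (by fun_prop) measurable_const
    exact measurableSet_le (by fun_prop) measurable_const
  have h1 : ∫⁻ ω, (if ∑ i, U i ω ^ 2 ≤ t then
        ENNReal.ofReal (Real.exp (c * ∑ j, (∑ i, U i ω * Z (i, j) ω) ^ 2)) else 0) ∂P =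
      ∫⁻ q, F q ∂((P.map fun ω i => U i ω).prod (P.map fun ω p => Z p ω)) := by
    rw [← hind.map_prod_eq_prod_map_map hUm hZm',
      lintegral_map' hFm.aemeasurable (hUm.prodMk hZm')]
  have hpU : IsProbabilityMeasure (P.map fun ω i => U i ω) := Measure.isProbabilityMeasure_map hUm
  have hpZ : IsProbabilityMeasure (P.map fun ω p => Z p ω) := Measure.isProbabilityMeasure_map hZm'
  rw [h1, lintegral_prod _ hFm.aemeasurable]
  have h2 : ∀ a : Fin n → ℝ, ∫⁻ z, F (a, z) ∂(P.map fun ω p => Z p ω) ≤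
      ENNReal.ofReal (√2 ^ k) := by
    intro a
    by_cases ha : ∑ i, a i ^ 2 ≤ t
    swap
    · simp [hF, ha]
    simp only [hF, ha, if_true]
    have hm : Measurable fun z : Fin n × Fin k → ℝ =>
        ENNReal.ofReal (Real.exp (c * ∑ j, (∑ i, a i * z (i, j)) ^ 2)) := by fun_prop
    rw [lintegral_map' hm.aemeasurable hZm']
    -- With U frozen at a, the sums G_j are independent centred normal variables with variance |a|²
    -- ≤ t. Each contributes (1 - 2c|a|²)^{-1/2} ≤ √2.
    set G : Fin k → Ω → ℝ := fun j ω => ∑ i, a i * Z (i, j) ω with hG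
    set L : (Fin n × Fin k → ℝ) →L[ℝ] (Fin k → ℝ) := ContinuousLinearMap.pi fun j =>
      ∑ i, a i • ContinuousLinearMap.proj (i, j) with hL
    have hGl : HasGaussianLaw (fun ω j => G j ω) P := by
      have := hZ.map_fun L
      refine this.congr (Filter.Eventually.of_forall fun ω => ?_)
      ext j
      simp [hL, hG]
    have hGcov : ∀ j l, cov[G j, G l; P] = if j = l then ∑ i, a i ^ 2 else 0 := by
      intro j l
      rw [hG]
      rw [covariance_fun_sum_fun_sum (fun i => (hZ.eval (i, j)).memLp_two.const_mul _)
        (fun i => (hZ.eval (i, l)).memLp_two.const_mul _)]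
      simp only [covariance_const_mul_left, covariance_const_mul_right, hcov, Prod.mk.injEq]
      split_ifs with h
      · subst h
        refine Finset.sum_congr rfl fun i _ => ?_
        simp [sq]
      · simp [h]
    have hGind : iIndepFun G P := hGl.iIndepFun_of_covariance_eq_zero fun i j hij => by
      rw [hGcov, if_neg hij]
    have hGm : ∀ j, AEMeasurable (G j) P := fun j => (hGl.eval j).aemeasurable
    have hGmap : ∀ j, P.map (G j) = gaussianReal 0 (∑ i, a i ^ 2).toNNReal := by
      intro j
      rw [(hGl.eval j).map_eq_gaussianReal, ← covariance_self (hGm j), hGcov, if_pos rfl]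
      congr 1
      rw [hG, integral_finsetSum _ fun i _ => ((hZ.eval (i, j)).integrable).const_mul _]
      simp [integral_const_mul, hmean]
    have hs0 : 0 ≤ ∑ i, a i ^ 2 := Finset.sum_nonneg fun i _ => sq_nonneg _
    have hct' : 2 * c * ((∑ i, a i ^ 2).toNNReal : ℝ) ≤ 1 / 2 := by
      rw [Real.coe_toNNReal _ hs0]
      refine le_trans ?_ hct
      gcongr
    rw [lintegral_exp_mul_sum_sq hGind hGm hGmap (by linarith), Fintype.card_fin,
      ← ENNReal.ofReal_pow (by positivity)]
    refine ENNReal.ofReal_le_ofReal ?_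
    gcongr
    rw [← Real.sqrt_inv]
    refine Real.sqrt_le_sqrt ?_
    rw [inv_le_comm₀ (by linarith) (by norm_num)]
    linarith
  refine (lintegral_mono h2).trans ?_
  simp

end ConditionalGaussian

end FLR

namespace FLR

open scoped NNReal

/-! ### Second moments of linear forms of the model -/

section Population

variable {H : Type*} [NormedAddCommGroup H] [InnerProductSpace ℝ H] [CompleteSpace H]
  [SecondCountableTopology H] [MeasurableSpace H] [BorelSpace H]
  {Ω₀ : Type*} [MeasurableSpace Ω₀] {P₀ : Measure Ω₀} [IsProbabilityMeasure P₀]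
  {X : Ω₀ → H} {ε : Ω₀ → ℝ}

/-- The linear form `(y, x) ↦ a y + ⟨h, x⟩`. -/
noncomputable def pairForm (a : ℝ) (h : H) : ℝ × H →L[ℝ] ℝ :=
  a • ContinuousLinearMap.fst ℝ ℝ H + (innerSL ℝ h).comp (ContinuousLinearMap.snd ℝ ℝ H)

theorem pairForm_apply (a : ℝ) (h : H) (q : ℝ × H) : pairForm a h q = a * q.1 + ⟪h, q.2⟫ := by
  simp [pairForm]

/-- The cross terms vanish because X is centred and independent of ε, and ε has unit variance. -/
theorem GaussianDesign.integral_mul (hG : GaussianDesign P₀ X ε) (f f' : H) (s s' : ℝ) :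
    ∫ ω, (⟪f, X ω⟫ + s * ε ω) * (⟪f', X ω⟫ + s' * ε ω) ∂P₀ =
      ⟪covarianceOperator (P₀.map X) f, f'⟫ + s * s' := by
  have hX : HasGaussianLaw X P₀ := hG.joint.fst
  have hε : HasGaussianLaw ε P₀ := hG.joint.snd
  have hXf : ∀ f : H, MemLp (fun ω => ⟪f, X ω⟫) 2 P₀ := fun f =>
    (hX.map_fun (innerSL ℝ f)).memLp_two
  have hε2 : MemLp ε 2 P₀ := hε.memLp_two
  have i1 : Integrable (fun ω => ⟪f, X ω⟫ * ⟪f', X ω⟫) P₀ := (hXf f).integrable_mul (hXf f')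
  have i2 : ∀ f, Integrable (fun ω => ⟪f, X ω⟫ * ε ω) P₀ := fun f => (hXf f).integrable_mul hε2
  have i3 : Integrable (fun ω => ε ω * ε ω) P₀ := hε2.integrable_mul hε2
  have e1 : ∫ ω, ⟪f, X ω⟫ * ⟪f', X ω⟫ ∂P₀ = ⟪covarianceOperator (P₀.map X) f, f'⟫ := by
    have hm : MemLp id 2 (P₀.map X) :=
      (memLp_map_measure_iff (by fun_prop) hX.aemeasurable).2 hX.memLp_two
    rw [covarianceOperator_inner hm, integral_map hX.aemeasurable (by fun_prop)]
  have e2 : ∀ f : H, ∫ ω, ⟪f, X ω⟫ * ε ω ∂P₀ = 0 := by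
    intro f
    have hi : IndepFun (fun ω => ⟪f, X ω⟫) ε P₀ :=
      hG.indep.comp (φ := fun x => ⟪f, x⟫) (ψ := id) (by fun_prop) measurable_id
    have h0 : ∫ ω, ⟪f, X ω⟫ ∂P₀ = 0 := by
      rw [← hG.centred f]
      exact integral_congr_ae (Filter.Eventually.of_forall fun ω => real_inner_comm _ _)
    rw [hi.integral_fun_mul_eq_mul_integral (hXf f).aestronglyMeasurable hε2.aestronglyMeasurable,
      h0, zero_mul]
  have e3 : ∫ ω, ε ω * ε ω ∂P₀ = 1 := by
    have h1 : ∫ ω, ε ω * ε ω ∂P₀ = ∫ x, x * x ∂(gaussianReal 0 1) := by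
      rw [← hG.error, integral_map hε.aemeasurable (by fun_prop)]
    have h2 := variance_fun_id_gaussianReal (μ := 0) (v := 1)
    rw [variance_of_integral_eq_zero (by fun_prop) (by simp)] at h2
    rw [h1]
    simpa [sq] using h2
  have hexp : ∀ ω, (⟪f, X ω⟫ + s * ε ω) * (⟪f', X ω⟫ + s' * ε ω) =
      ⟪f, X ω⟫ * ⟪f', X ω⟫ + s' * (⟪f, X ω⟫ * ε ω) + s * (⟪f', X ω⟫ * ε ω) +
        (s * s') * (ε ω * ε ω) := fun ω => by ring
  have j1 := i1.add ((i2 f).const_mul s')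
  have j2 := j1.add ((i2 f').const_mul s)
  simp_rw [hexp]
  have k1 := integral_add j2 (i3.const_mul (s * s'))
  have k2 := integral_add j1 ((i2 f').const_mul s)
  have k3 := integral_add i1 ((i2 f).const_mul s')
  simp only [Pi.add_apply] at k1 k2 k3
  rw [k1, k2, k3, integral_const_mul, integral_const_mul, integral_const_mul, e1, e2, e2, e3]
  ring

theorem GaussianDesign.pair_hasGaussianLaw (hG : GaussianDesign P₀ X ε) (φ : H) (σ : ℝ) :
    HasGaussianLaw (fun ω => (response φ σ X ε ω, X ω)) P₀ := by
  have := hG.joint.map_fun (F := ℝ × H)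
    (((innerSL ℝ φ).comp (ContinuousLinearMap.fst ℝ H ℝ) +
      σ • ContinuousLinearMap.snd ℝ H ℝ).prod (ContinuousLinearMap.fst ℝ H ℝ))
  refine this.congr (Filter.Eventually.of_forall fun ω => ?_)
  simp [response]

theorem pairForm_response (φ h : H) (σ a : ℝ) (ω : Ω₀) :
    pairForm a h (response φ σ X ε ω, X ω) = ⟪a • φ + h, X ω⟫ + (a * σ) * ε ω := by
  rw [pairForm_apply, response, inner_add_left, real_inner_smul_left]
  ring

end Population

/-! ### Linear forms of the sample -/

section Sample

variable {H : Type*} [NormedAddCommGroup H] [InnerProductSpace ℝ H] [CompleteSpace H]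
  [SecondCountableTopology H] [MeasurableSpace H] [BorelSpace H]
  {Ω₀ : Type*} [MeasurableSpace Ω₀] {P₀ : Measure Ω₀} [IsProbabilityMeasure P₀]
  {X : Ω₀ → H} {ε : Ω₀ → ℝ} {φ : H} {σ : ℝ}
  {Ω : Type*} [MeasurableSpace Ω] {P : Measure Ω} [IsProbabilityMeasure P]
  {n : ℕ} {Ys : Fin n → Ω → ℝ} {Xs : Fin n → Ω → H}

theorem sample_hasGaussianLaw (hG : GaussianDesign P₀ X ε)
    (hS : IsSample P₀ (response φ σ X ε) X P Ys Xs) (i : Fin n) :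
    HasGaussianLaw (fun ω => (Ys i ω, Xs i ω)) P := by
  constructor
  rw [(hS.copies i).map_eq]
  exact (hG.pair_hasGaussianLaw φ σ).isGaussian_map

theorem sample_integral_pairForm_mul (hG : GaussianDesign P₀ X ε)
    (hS : IsSample P₀ (response φ σ X ε) X P Ys Xs) (i : Fin n) (a a' : ℝ) (h h' : H) :
    ∫ ω, pairForm a h (Ys i ω, Xs i ω) * pairForm a' h' (Ys i ω, Xs i ω) ∂P =
      ⟪covarianceOperator (P₀.map X) (a • φ + h), a' • φ + h'⟫ + (a * σ) * (a' * σ) := by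
  rw [← hG.integral_mul]
  have hc := (hS.copies i).comp (u := fun q => pairForm a h q * pairForm a' h' q) (by fun_prop)
  have := hc.integral_eq
  simp only [Function.comp_def] at this
  rw [this]
  simp_rw [pairForm_response]

theorem sample_integral_pairForm (hG : GaussianDesign P₀ X ε)
    (hS : IsSample P₀ (response φ σ X ε) X P Ys Xs) (i : Fin n) (a : ℝ) (h : H) :
    ∫ ω, pairForm a h (Ys i ω, Xs i ω) ∂P = 0 := by
  have hc := (hS.copies i).comp (u := fun q => pairForm a h q) (by fun_prop)
  have := hc.integral_eq
  simp only [Function.comp_def] at this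
  rw [this]
  simp_rw [pairForm_response]
  have hX : HasGaussianLaw X P₀ := hG.joint.fst
  have hε : HasGaussianLaw ε P₀ := hG.joint.snd
  have e0 : ∫ ω, ε ω ∂P₀ = 0 := by
    have h1 : ∫ ω, ε ω ∂P₀ = ∫ x, x ∂(gaussianReal 0 1) := by
      rw [← hG.error, integral_map hε.aemeasurable (by fun_prop)]
    rw [h1, integral_id_gaussianReal]
  have e1 : ∫ ω, ⟪a • φ + h, X ω⟫ ∂P₀ = 0 := by
    rw [← hG.centred (a • φ + h)]
    exact integral_congr_ae (Filter.Eventually.of_forall fun ω => real_inner_comm _ _)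
  have k1 := integral_add (hX.map_fun (innerSL ℝ (a • φ + h))).integrable
    (hε.integrable.const_mul (a * σ))
  simp only [innerSL_apply_apply] at k1
  rw [k1, integral_const_mul, e0, e1]
  ring

/-- Joint normality of the whole sample: independence of families of linear forms can be read off
from covariances. -/
theorem sample_pairForm_hasGaussianLaw (hG : GaussianDesign P₀ X ε)
    (hS : IsSample P₀ (response φ σ X ε) X P Ys Xs) {F : Type*} [NormedAddCommGroup F]
    [NormedSpace ℝ F] [MeasurableSpace F] [BorelSpace F] (L : (Fin n → ℝ × H) →L[ℝ] F) :
    HasGaussianLaw (fun ω => L fun i => (Ys i ω, Xs i ω)) P :=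
  (hS.indep.hasGaussianLaw (sample_hasGaussianLaw hG hS)).map_fun L

theorem sample_covariance_pairForm (hG : GaussianDesign P₀ X ε)
    (hS : IsSample P₀ (response φ σ X ε) X P Ys Xs) (i l : Fin n) (a a' : ℝ) (h h' : H) :
    cov[fun ω => pairForm a h (Ys i ω, Xs i ω), fun ω => pairForm a' h' (Ys l ω, Xs l ω); P] =
      if i = l then
        ⟪covarianceOperator (P₀.map X) (a • φ + h), a' • φ + h'⟫ + (a * σ) * (a' * σ) else 0 := by
  have hm : ∀ i a h, MemLp (fun ω => pairForm a h (Ys i ω, Xs i ω)) 2 P := fun i a h =>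
    ((sample_hasGaussianLaw hG hS i).map_fun (pairForm a h)).memLp_two
  split_ifs with hil
  · subst hil
    rw [covariance_eq_sub (hm i a h) (hm i a' h'), sample_integral_pairForm hG hS,
      ← sample_integral_pairForm_mul hG hS i]
    simp [Pi.mul_apply]
  · refine IndepFun.covariance_eq_zero ?_ (hm i a h) (hm l a' h')
    exact (hS.indep.indepFun hil).comp (φ := fun q => pairForm a h q)
      (ψ := fun q => pairForm a' h' q) (by fun_prop) (by fun_prop)

theorem sample_aemeasurable_pairForm
    (hS : IsSample P₀ (response φ σ X ε) X P Ys Xs) (i : Fin n) (a : ℝ) (h : H) :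
    AEMeasurable (fun ω => pairForm a h (Ys i ω, Xs i ω)) P :=
  (pairForm a h).continuous.measurable.comp_aemeasurable (hS.copies i).aemeasurable_fst

theorem sample_iIndepFun_pairForm
    (hS : IsSample P₀ (response φ σ X ε) X P Ys Xs) (a : ℝ) (h : H) :
    iIndepFun (fun i ω => pairForm a h (Ys i ω, Xs i ω)) P :=
  hS.indep.comp (fun _ q => pairForm a h q) fun _ => by fun_prop

theorem sample_map_pairForm (hG : GaussianDesign P₀ X ε)
    (hS : IsSample P₀ (response φ σ X ε) X P Ys Xs) (i : Fin n) (a : ℝ) (h : H) :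
    P.map (fun ω => pairForm a h (Ys i ω, Xs i ω)) = gaussianReal 0
      (⟪covarianceOperator (P₀.map X) (a • φ + h), a • φ + h⟫ + (a * σ) ^ 2).toNNReal := by
  rw [((sample_hasGaussianLaw hG hS i).map_fun (pairForm a h)).map_eq_gaussianReal,
    sample_integral_pairForm hG hS, ← covariance_self (sample_aemeasurable_pairForm hS i a h),
    sample_covariance_pairForm hG hS, if_pos rfl, sq]

end Sample

end FLR

namespace FLR

open Matrix

/-! ### Whitened coordinates -/

section Whitening

variable {H : Type*} [NormedAddCommGroup H] [InnerProductSpace ℝ H] (ψ : HilbertBasis ℕ ℝ H)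
  {m : ℕ}

/-- The vectors whose coefficients are the columns of `C⁻¹`; they are orthonormal for the form
of `T` if `[T]_m = Cᵀ C`. -/
noncomputable def whiteVec (C : Matrix (Fin m) (Fin m) ℝ) (j : Fin m) : H :=
  lincomb ψ fun l => C⁻¹ l j

variable {C : Matrix (Fin m) (Fin m) ℝ}

theorem lincomb_eq_sum_whiteVec (hC : IsUnit C.det) (v : Fin m → ℝ) :
    lincomb ψ v = ∑ j, (C *ᵥ v) j • whiteVec ψ C j := by
  have h : ∀ l, v l = ∑ j, (C *ᵥ v) j * C⁻¹ l j := by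
    intro l
    conv_lhs => rw [← Matrix.one_mulVec v, ← Matrix.nonsing_inv_mul _ hC, ← Matrix.mulVec_mulVec]
    generalize C *ᵥ v = u
    simp only [Matrix.mulVec, dotProduct]
    exact Finset.sum_congr rfl fun j _ => mul_comm _ _
  simp only [whiteVec, lincomb, Finset.smul_sum, smul_smul]
  rw [Finset.sum_comm]
  refine Finset.sum_congr rfl fun l _ => ?_
  rw [← Finset.sum_smul, ← h]

/-- For T the covariance operator, the inner products of X with these vectors are uncorrelated with
unit variance, hence independent standard normal in the Gaussian model. -/
theorem form_whiteVec {T : H →L[ℝ] H} (hC : IsUnit C.det) (hA : opMat ψ T m = Cᵀ * C)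
    (j l : Fin m) : ⟪T (whiteVec ψ C j), whiteVec ψ C l⟫ = if j = l then 1 else 0 := by
  rw [real_inner_comm, whiteVec, whiteVec, ← form_opMat, hA, ← Matrix.mulVec_mulVec,
    Matrix.dotProduct_mulVec, Matrix.vecMul_transpose]
  have h : ∀ j, (C *ᵥ fun l => C⁻¹ l j) = fun l => (1 : Matrix (Fin m) (Fin m) ℝ) l j := by
    intro j
    ext l
    rw [← Matrix.mul_nonsing_inv _ hC, Matrix.mul_apply]
    rfl
  rw [h, h]
  simp only [dotProduct, Matrix.one_apply]
  simp

theorem form_eq_whitened (A : Matrix (Fin m) (Fin m) ℝ) (hA : A = Cᵀ * C) (v : Fin m → ℝ) :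
    v ⬝ᵥ A *ᵥ v = (C *ᵥ v) ⬝ᵥ (C *ᵥ v) := by
  rw [hA, ← Matrix.mulVec_mulVec, Matrix.dotProduct_mulVec, Matrix.vecMul_transpose]

theorem inv_form_eq_whitened (A : Matrix (Fin m) (Fin m) ℝ) (hA : A = Cᵀ * C) (v : Fin m → ℝ) :
    v ⬝ᵥ A⁻¹ *ᵥ v = ((C⁻¹)ᵀ *ᵥ v) ⬝ᵥ ((C⁻¹)ᵀ *ᵥ v) := by
  rw [hA, Matrix.mul_inv_rev, ← Matrix.transpose_nonsing_inv, ← Matrix.mulVec_mulVec,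
    Matrix.dotProduct_mulVec, ← Matrix.mulVec_transpose]

end Whitening

/-! ### Empirical matrices and error bounds for fixed data -/

section EmpiricalForms

variable {H : Type*} [NormedAddCommGroup H] [InnerProductSpace ℝ H] (ψ : HilbertBasis ℕ ℝ H)
  {n m : ℕ} (y : Fin n → ℝ) (x : Fin n → H)

theorem form_empMat (v : Fin m → ℝ) :
    v ⬝ᵥ empMat ψ x m *ᵥ v = (n : ℝ)⁻¹ * ∑ i, ⟪lincomb ψ v, x i⟫ ^ 2 := by
  have h : ∀ i, ⟪lincomb ψ v, x i⟫ ^ 2 =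
      ∑ j : Fin m, ∑ l : Fin m, v j * (⟪x i, ψ j⟫ * ⟪x i, ψ l⟫) * v l := by
    intro i
    rw [sq, lincomb, sum_inner, Finset.sum_mul_sum]
    refine Finset.sum_congr rfl fun j _ => Finset.sum_congr rfl fun l _ => ?_
    rw [real_inner_smul_left, real_inner_smul_left, real_inner_comm (x i), real_inner_comm (x i)]
    ring
  simp_rw [h]
  rw [Finset.sum_comm, Finset.mul_sum]
  simp only [dotProduct, Matrix.mulVec, empMat, Matrix.of_apply, Finset.mul_sum]
  refine Finset.sum_congr rfl fun j _ => ?_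
  rw [Finset.sum_comm]
  refine Finset.sum_congr rfl fun l _ => ?_
  rw [Finset.sum_mul, Finset.mul_sum]
  refine Finset.sum_congr rfl fun i _ => ?_
  ring

theorem empMat_isHermitian : (empMat ψ x m).IsHermitian := by
  ext i j
  simp only [empMat, Matrix.conjTranspose_apply, Matrix.of_apply, star_trivial]
  congr 1
  exact Finset.sum_congr rfl fun _ _ => mul_comm _ _

/-- If the whitened empirical covariance matrix is entrywise within `η / m` of the identity,
then the empirical and the theoretical forms are comparable. -/
theorem abs_form_empMat_sub_le {A C : Matrix (Fin m) (Fin m) ℝ} (hC : IsUnit C.det)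
    (hA : A = Cᵀ * C) {η : ℝ} (hη : 0 ≤ η)
    (h : ∀ j l : Fin m, |(n : ℝ)⁻¹ * ∑ i, ⟪whiteVec ψ C j, x i⟫ * ⟪whiteVec ψ C l, x i⟫ -
      (if j = l then 1 else 0)| ≤ η / m) (v : Fin m → ℝ) :
    |v ⬝ᵥ empMat ψ x m *ᵥ v - v ⬝ᵥ A *ᵥ v| ≤ η * (v ⬝ᵥ A *ᵥ v) := by
  set u := C *ᵥ v with hu
  rw [form_eq_whitened A hA, form_empMat, ← hu]
  have h1 : ∀ i, ⟪lincomb ψ v, x i⟫ ^ 2 = ∑ j : Fin m, ∑ l : Fin m,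
      u j * u l * (⟪whiteVec ψ C j, x i⟫ * ⟪whiteVec ψ C l, x i⟫) := by
    intro i
    rw [lincomb_eq_sum_whiteVec ψ hC, sq, sum_inner, Finset.sum_mul_sum]
    refine Finset.sum_congr rfl fun j _ => Finset.sum_congr rfl fun l _ => ?_
    rw [real_inner_smul_left, real_inner_smul_left, ← hu]
    ring
  have h2 : (n : ℝ)⁻¹ * ∑ i, ⟪lincomb ψ v, x i⟫ ^ 2 - u ⬝ᵥ u = ∑ j : Fin m, ∑ l : Fin m,
      u j * u l * ((n : ℝ)⁻¹ * ∑ i, ⟪whiteVec ψ C j, x i⟫ * ⟪whiteVec ψ C l, x i⟫ -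
        (if j = l then 1 else 0)) := by
    simp_rw [h1, mul_sub, Finset.sum_sub_distrib]
    congr 1
    · rw [Finset.sum_comm, Finset.mul_sum]
      refine Finset.sum_congr rfl fun j _ => ?_
      rw [Finset.sum_comm, Finset.mul_sum]
      refine Finset.sum_congr rfl fun l _ => ?_
      rw [← Finset.mul_sum]
      ring
    · simp [dotProduct]
  rw [h2]
  calc _ ≤ ∑ j : Fin m, ∑ l : Fin m, |u j| * |u l| * (η / m) := by
        refine (Finset.abs_sum_le_sum_abs _ _).trans (Finset.sum_le_sum fun j _ => ?_)
        refine (Finset.abs_sum_le_sum_abs _ _).trans (Finset.sum_le_sum fun l _ => ?_)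
        rw [abs_mul, abs_mul]
        exact mul_le_mul_of_nonneg_left (h j l) (by positivity)
    _ = (η / m) * (∑ j, |u j|) ^ 2 := by
        rw [sq, Finset.sum_mul_sum, Finset.mul_sum]
        refine Finset.sum_congr rfl fun j _ => ?_
        rw [Finset.mul_sum]
        exact Finset.sum_congr rfl fun l _ => mul_comm _ _
    -- Passing from the ℓ¹ to the ℓ² norm costs the factor m, which the entrywise tolerance η / m
    -- pays for.
    _ ≤ (η / m) * (m * (u ⬝ᵥ u)) := by
        have := sq_sum_le_card_mul_sum_sq (s := Finset.univ) (f := fun j => |u j|)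
        simp only [sq_abs, Finset.card_univ, Fintype.card_fin] at this
        have h3 : u ⬝ᵥ u = ∑ j, u j ^ 2 := by simp [dotProduct, sq]
        rw [h3]
        gcongr
    _ ≤ _ := by
        rcases Nat.eq_zero_or_pos m with rfl | hm
        · simp [dotProduct]
        · have : (m : ℝ) ≠ 0 := by positivity
          apply le_of_eq
          field_simp

/-- Polarisation: the off-diagonal products come from the sums of squares at p ± q. The two
theoretical values add up to 4, which cancels the factor 1/4. -/
theorem abs_whitened_entry_sub_le {T : H →L[ℝ] H} {C : Matrix (Fin m) (Fin m) ℝ}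
    (hC : IsUnit C.det) (hA : opMat ψ T m = Cᵀ * C) {τ : ℝ} (j l : Fin m)
    (h : ∀ s : ℝ, (s = 1 ∨ s = -1) →
      |(n : ℝ)⁻¹ * ∑ i, ⟪whiteVec ψ C j + s • whiteVec ψ C l, x i⟫ ^ 2 -
        ⟪T (whiteVec ψ C j + s • whiteVec ψ C l), whiteVec ψ C j + s • whiteVec ψ C l⟫| ≤
      τ * ⟪T (whiteVec ψ C j + s • whiteVec ψ C l), whiteVec ψ C j + s • whiteVec ψ C l⟫) :
    |(n : ℝ)⁻¹ * ∑ i, ⟪whiteVec ψ C j, x i⟫ * ⟪whiteVec ψ C l, x i⟫ -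
      (if j = l then 1 else 0)| ≤ τ := by
  have hjj := form_whiteVec ψ hC hA j j
  have hll := form_whiteVec ψ hC hA l l
  have hjl := form_whiteVec ψ hC hA j l
  have hlj := form_whiteVec ψ hC hA l j
  set p := whiteVec ψ C j
  set q := whiteVec ψ C l
  have hT' : ∀ s : ℝ, ⟪T (p + s • q), p + s • q⟫ = 1 + 2 * s * (if j = l then 1 else 0) + s ^ 2 := by
    intro s
    simp only [map_add, map_smul, inner_add_left, inner_add_right, real_inner_smul_left,
      real_inner_smul_right, hjj, hll, hjl, hlj, eq_comm (a := l) (b := j)]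
    simp only [if_true]
    ring
  have hS : ∀ s : ℝ, (n : ℝ)⁻¹ * ∑ i, ⟪p + s • q, x i⟫ ^ 2 =
      (n : ℝ)⁻¹ * ∑ i, ⟪p, x i⟫ ^ 2 + 2 * s * ((n : ℝ)⁻¹ * ∑ i, ⟪p, x i⟫ * ⟪q, x i⟫) +
        s ^ 2 * ((n : ℝ)⁻¹ * ∑ i, ⟪q, x i⟫ ^ 2) := by
    intro s
    have : ∀ i, ⟪p + s • q, x i⟫ ^ 2 =
        ⟪p, x i⟫ ^ 2 + (2 * s) * (⟪p, x i⟫ * ⟪q, x i⟫) + s ^ 2 * ⟪q, x i⟫ ^ 2 := fun i => by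
      rw [inner_add_left, real_inner_smul_left]; ring
    simp_rw [this, Finset.sum_add_distrib, ← Finset.mul_sum]
    ring
  have h1 := h 1 (Or.inl rfl)
  have h2 := h (-1) (Or.inr rfl)
  rw [hT', hS] at h1 h2
  rw [abs_le] at h1 h2 ⊢
  constructor <;> nlinarith [h1.1, h1.2, h2.1, h2.2]

/-- The vector `[ĝ]_m - [Γ̂]_m c`. -/
noncomputable def residualVec (c : Fin m → ℝ) : Fin m → ℝ :=
  headVec (empG ψ y x) m - empMat ψ x m *ᵥ c

theorem residualVec_apply (c : Fin m → ℝ) (j : Fin m) :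
    residualVec ψ y x c j = (n : ℝ)⁻¹ * ∑ i, (y i - ⟪lincomb ψ c, x i⟫) * ⟪x i, ψ j⟫ := by
  have h : (empMat ψ x m *ᵥ c) j = (n : ℝ)⁻¹ * ∑ i, ⟪lincomb ψ c, x i⟫ * ⟪x i, ψ j⟫ := by
    have h1 : ∀ i, ⟪lincomb ψ c, x i⟫ * ⟪x i, ψ j⟫ =
        ∑ l : Fin m, ⟪x i, ψ j⟫ * ⟪x i, ψ l⟫ * c l := fun i => by
      rw [lincomb, sum_inner, Finset.sum_mul]
      refine Finset.sum_congr rfl fun l _ => ?_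
      rw [real_inner_smul_left, real_inner_comm (x i)]; ring
    simp_rw [h1]
    rw [Finset.sum_comm, Finset.mul_sum]
    simp only [Matrix.mulVec, empMat, Matrix.of_apply, dotProduct]
    refine Finset.sum_congr rfl fun l _ => ?_
    rw [← Finset.sum_mul]; ring
  rw [residualVec, Pi.sub_apply, h, headVec, empG]
  simp_rw [sub_mul]
  rw [Finset.sum_sub_distrib]
  ring

/-- The squared norm of the whitened residual vector. -/
noncomputable def residualSq (C : Matrix (Fin m) (Fin m) ℝ) (c : Fin m → ℝ) : ℝ :=
  ∑ j, ((n : ℝ)⁻¹ * ∑ i, (y i - ⟪lincomb ψ c, x i⟫) * ⟪whiteVec ψ C j, x i⟫) ^ 2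

/-- A⁻¹ = C⁻¹(C⁻¹)ᵀ, and (C⁻¹)ᵀ applied to the residual vector lists its coordinates along the white
vectors. -/
theorem inv_form_residualVec (A : Matrix (Fin m) (Fin m) ℝ) {C : Matrix (Fin m) (Fin m) ℝ}
    (hA : A = Cᵀ * C) (c : Fin m → ℝ) :
    residualVec ψ y x c ⬝ᵥ A⁻¹ *ᵥ residualVec ψ y x c = residualSq ψ y x C c := by
  rw [inv_form_eq_whitened A hA, residualSq]
  have h : ∀ j, ((C⁻¹)ᵀ *ᵥ residualVec ψ y x c) j =
      (n : ℝ)⁻¹ * ∑ i, (y i - ⟪lincomb ψ c, x i⟫) * ⟪whiteVec ψ C j, x i⟫ := by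
    intro j
    have h1 : ∀ i, (y i - ⟪lincomb ψ c, x i⟫) * ⟪whiteVec ψ C j, x i⟫ =
        ∑ l : Fin m, C⁻¹ l j * ((y i - ⟪lincomb ψ c, x i⟫) * ⟪x i, ψ l⟫) := fun i => by
      generalize y i - ⟪lincomb ψ c, x i⟫ = u
      rw [whiteVec, lincomb, sum_inner, Finset.mul_sum]
      refine Finset.sum_congr rfl fun l _ => ?_
      rw [real_inner_smul_left, real_inner_comm (x i)]; ring
    simp_rw [h1]
    rw [Finset.sum_comm, Finset.mul_sum]
    simp only [Matrix.mulVec, dotProduct, Matrix.transpose_apply]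
    refine Finset.sum_congr rfl fun l _ => ?_
    rw [residualVec_apply, ← Finset.mul_sum]; ring
  simp only [dotProduct, h, sq]

/-- Plain Cauchy-Schwarz over the sample, without independence: this is the version that survives on
bad data. -/
theorem residualSq_le (C : Matrix (Fin m) (Fin m) ℝ) (c : Fin m → ℝ) :
    residualSq ψ y x C c ≤ ((n : ℝ)⁻¹ * ∑ i, (y i - ⟪lincomb ψ c, x i⟫) ^ 2) *
      ((n : ℝ)⁻¹ * ∑ i, ∑ j, ⟪whiteVec ψ C j, x i⟫ ^ 2) := by
  have hc : ∑ i, ∑ j, ⟪whiteVec ψ C j, x i⟫ ^ 2 = ∑ j, ∑ i, ⟪whiteVec ψ C j, x i⟫ ^ 2 :=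
    Finset.sum_comm
  rw [hc, ← mul_assoc, Finset.mul_sum, residualSq]
  refine Finset.sum_le_sum fun j _ => ?_
  have := Finset.sum_mul_sq_le_sq_mul_sq Finset.univ
    (fun i => y i - ⟪lincomb ψ c, x i⟫) (fun i => ⟪whiteVec ψ C j, x i⟫)
  rw [mul_pow]
  calc _ ≤ ((n : ℝ)⁻¹) ^ 2 * _ := mul_le_mul_of_nonneg_left this (sq_nonneg _)
    _ = _ := by ring

/-- The estimation error solves the empirical system with the residual vector as right-hand side,
which is the form in which perturbation bounds apply. -/
theorem inv_mulVec_headVec_sub (hU : IsUnit (empMat ψ x m).det) (c : Fin m → ℝ) :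
    (empMat ψ x m)⁻¹ *ᵥ headVec (empG ψ y x) m - c =
      (empMat ψ x m)⁻¹ *ᵥ residualVec ψ y x c := by
  rw [residualVec, Matrix.mulVec_sub, Matrix.mulVec_mulVec, Matrix.nonsing_inv_mul _ hU,
    Matrix.one_mulVec]

/-- The empirical projection inequality. -/
theorem empG_form_le (hU : IsUnit (empMat ψ x m).det) :
    headVec (empG ψ y x) m ⬝ᵥ (empMat ψ x m)⁻¹ *ᵥ headVec (empG ψ y x) m ≤ empY2 y := by
  set a := (empMat ψ x m)⁻¹ *ᵥ headVec (empG ψ y x) m with ha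
  have h1 : headVec (empG ψ y x) m ⬝ᵥ a = (n : ℝ)⁻¹ * ∑ i, y i * ⟪lincomb ψ a, x i⟫ := by
    have h2 : ∀ i, y i * ⟪lincomb ψ a, x i⟫ = ∑ j : Fin m, y i * ⟪x i, ψ j⟫ * a j := fun i => by
      rw [lincomb, sum_inner, Finset.mul_sum]
      refine Finset.sum_congr rfl fun l _ => ?_
      rw [real_inner_smul_left, real_inner_comm (x i)]; ring
    simp_rw [h2]
    rw [Finset.sum_comm, Finset.mul_sum]
    simp only [dotProduct, headVec, empG]
    refine Finset.sum_congr rfl fun l _ => ?_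
    rw [← Finset.sum_mul]; ring
  have h3 : headVec (empG ψ y x) m ⬝ᵥ a = (n : ℝ)⁻¹ * ∑ i, ⟪lincomb ψ a, x i⟫ ^ 2 := by
    rw [← form_empMat, ha, PosDef.mul_inv_mulVec hU, dotProduct_comm]
  -- By the normal equations, this residual sum of squares is the empirical second moment minus the
  -- fitted form.
  have h4 : 0 ≤ (n : ℝ)⁻¹ * ∑ i, (y i - ⟪lincomb ψ a, x i⟫) ^ 2 := by positivity
  have h5 : (n : ℝ)⁻¹ * ∑ i, (y i - ⟪lincomb ψ a, x i⟫) ^ 2 =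
      empY2 y - 2 * ((n : ℝ)⁻¹ * ∑ i, y i * ⟪lincomb ψ a, x i⟫) +
        (n : ℝ)⁻¹ * ∑ i, ⟪lincomb ψ a, x i⟫ ^ 2 := by
    have : ∀ i, (y i - ⟪lincomb ψ a, x i⟫) ^ 2 =
        y i ^ 2 - 2 * (y i * ⟪lincomb ψ a, x i⟫) + ⟪lincomb ψ a, x i⟫ ^ 2 := fun i => by ring
    simp_rw [this]
    rw [Finset.sum_add_distrib, Finset.sum_sub_distrib, ← Finset.mul_sum, empY2]
    ring
  rw [h5, ← h1, ← h3] at h4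
  linarith

variable {w : ℕ → ℝ}

theorem wNormSq_toReal_lincomb (hw : ∀ j, 0 ≤ w j) (v : Fin m → ℝ) :
    (wNormSq ψ w (lincomb ψ v)).toReal = ∑ j : Fin m, w j * v j ^ 2 := by
  rw [wNormSq_lincomb ψ hw]
  exact ENNReal.toReal_ofReal (Finset.sum_nonneg fun j _ => mul_nonneg (hw j) (sq_nonneg _))

theorem wNormSq_estimator_sub (hw : ∀ j, 0 ≤ w j) (c : Fin m → ℝ)
    (h : IsUnit (empMat ψ x m).det ∧ specNorm (empMat ψ x m)⁻¹ ≤ n) :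
    (wNormSq ψ w (estimator ψ y x m - lincomb ψ c)).toReal =
      ∑ j : Fin m, w j * ((empMat ψ x m)⁻¹ *ᵥ residualVec ψ y x c) j ^ 2 := by
  rw [estimator, if_pos h, galerkin_eq_lincomb, ← lincomb_sub, wNormSq_toReal_lincomb ψ hw,
    inv_mulVec_headVec_sub ψ y x h.1]

theorem wNormSq_estimator_sub_of_not (hw : ∀ j, 0 ≤ w j) (c : Fin m → ℝ)
    (h : ¬ (IsUnit (empMat ψ x m).det ∧ specNorm (empMat ψ x m)⁻¹ ≤ n)) :
    (wNormSq ψ w (estimator ψ y x m - lincomb ψ c)).toReal = ∑ j : Fin m, w j * c j ^ 2 := by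
  have h0 : (0 : H) = lincomb ψ (0 : Fin m → ℝ) := ((lincomb_eq_zero_iff ψ _).2 rfl).symm
  rw [estimator, if_neg h, h0, ← lincomb_sub, wNormSq_toReal_lincomb ψ hw]
  simp

theorem wNormSq_estimator_sub_ne_top (hw : ∀ j, 0 ≤ w j) (c : Fin m → ℝ) :
    wNormSq ψ w (estimator ψ y x m - lincomb ψ c) ≠ ∞ := by
  have h0 : (0 : H) = lincomb ψ (0 : Fin m → ℝ) := ((lincomb_eq_zero_iff ψ _).2 rfl).symm
  rw [estimator]
  split_ifs
  · rw [galerkin_eq_lincomb, ← lincomb_sub, wNormSq_lincomb ψ hw]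
    exact ENNReal.ofReal_ne_top
  · rw [h0, ← lincomb_sub, wNormSq_lincomb ψ hw]
    exact ENNReal.ofReal_ne_top

/-- The error bound when the empirical form dominates `7 / 8` of the theoretical one. -/
theorem wNormSq_estimator_sub_le (hw : ∀ j, 0 ≤ w j) {A C : Matrix (Fin m) (Fin m) ℝ}
    (hpd : A.PosDef) (hA : A = Cᵀ * C) (c : Fin m → ℝ)
    (hform : ∀ v : Fin m → ℝ, 7 / 8 * (v ⬝ᵥ A *ᵥ v) ≤ v ⬝ᵥ empMat ψ x m *ᵥ v)
    (h : IsUnit (empMat ψ x m).det ∧ specNorm (empMat ψ x m)⁻¹ ≤ n) :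
    (wNormSq ψ w (estimator ψ y x m - lincomb ψ c)).toReal ≤
      64 / 49 * specNorm (diagMat (fun j => √(w j)) m * A⁻¹ * diagMat (fun j => √(w j)) m) *
        residualSq ψ y x C c := by
  rw [wNormSq_estimator_sub ψ y x hw c h]
  set t := specNorm (diagMat (fun j => √(w j)) m * A⁻¹ * diagMat (fun j => √(w j)) m)
  have ht : 0 ≤ t := specNorm_nonneg _
  have h1 := (specNorm_weighted_inv_le_iff hw hpd ht).1 le_rfl
    ((empMat ψ x m)⁻¹ *ᵥ residualVec ψ y x c)
  have h2 := form_solution_le hpd (by norm_num : (0 : ℝ) < 7 / 8) hform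
    (PosDef.mul_inv_mulVec h.1 (residualVec ψ y x c))
  rw [inv_form_residualVec ψ y x A hA] at h2
  refine h1.trans ?_
  calc _ ≤ t * (64 / 49 * residualSq ψ y x C c) := by gcongr; linarith
    _ = _ := by ring

/-- The error bound that uses only the truncation of the estimator. -/
theorem wNormSq_estimator_sub_le_crude (hw : ∀ j, 0 ≤ w j) {wm : ℝ} (hwm : ∀ j : Fin m, w j ≤ wm)
    {A C : Matrix (Fin m) (Fin m) ℝ} (hpd : A.PosDef) (hA : A = Cᵀ * C) (c : Fin m → ℝ) {d : ℝ}
    (hd : ∀ v : Fin m → ℝ, v ⬝ᵥ A *ᵥ v ≤ d * (v ⬝ᵥ v)) (hd0 : 0 ≤ d) (hwm0 : 0 ≤ wm) :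
    (wNormSq ψ w (estimator ψ y x m - lincomb ψ c)).toReal ≤
      wm * n ^ 2 * d * residualSq ψ y x C c + ∑ j : Fin m, w j * c j ^ 2 := by
  have hr0 : 0 ≤ residualSq ψ y x C c := Finset.sum_nonneg fun _ _ => sq_nonneg _
  have hc0 : 0 ≤ ∑ j : Fin m, w j * c j ^ 2 :=
    Finset.sum_nonneg fun j _ => mul_nonneg (hw j) (sq_nonneg _)
  by_cases h : IsUnit (empMat ψ x m).det ∧ specNorm (empMat ψ x m)⁻¹ ≤ n
  swap
  · rw [wNormSq_estimator_sub_of_not ψ y x hw c h]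
    have : 0 ≤ wm * n ^ 2 * d * residualSq ψ y x C c := by positivity
    linarith
  rw [wNormSq_estimator_sub ψ y x hw c h]
  set V := residualVec ψ y x c with hV
  -- A ≤ d means |V|² ≤ d (V, A⁻¹V), by Cauchy-Schwarz for the form of A between V and A⁻¹V.
  have h1 : V ⬝ᵥ V ≤ d * residualSq ψ y x C c := by
    rw [← inv_form_residualVec ψ y x A hA, ← hV]
    set z := A⁻¹ *ᵥ V with hz
    have hAz : A *ᵥ z = V := PosDef.mul_inv_mulVec (posDef_isUnit_det hpd) _
    have h2 := form_sq_le hpd.posSemidef V z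
    rw [hAz, dotProduct_comm z V] at h2
    have h3 := hd V
    have h4 : 0 ≤ V ⬝ᵥ z := by
      rw [dotProduct_comm, ← hAz]; exact posSemidef_form_nonneg hpd.posSemidef z
    have h5 := dotProduct_self_nonneg' V
    rcases h5.eq_or_lt with h0 | h0
    · rw [← h0]; exact mul_nonneg hd0 h4
    · have : (V ⬝ᵥ V) * (V ⬝ᵥ V) ≤ (d * (V ⬝ᵥ z)) * (V ⬝ᵥ V) := by
        nlinarith [mul_le_mul_of_nonneg_right h3 h4]
      exact le_of_mul_le_mul_right this h0
  have h2 := mulVec_dotProduct_self_le (empMat ψ x m)⁻¹ V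
  set a := (empMat ψ x m)⁻¹ *ᵥ V with ha
  have h3 : ∑ j : Fin m, w j * a j ^ 2 ≤ wm * (a ⬝ᵥ a) := by
    simp only [dotProduct, Finset.mul_sum]
    refine Finset.sum_le_sum fun j _ => ?_
    rw [← sq]
    exact mul_le_mul_of_nonneg_right (hwm j) (sq_nonneg _)
  have h4 : specNorm (empMat ψ x m)⁻¹ ^ 2 ≤ (n : ℝ) ^ 2 :=
    pow_le_pow_left₀ (specNorm_nonneg _) h.2 2
  calc _ ≤ wm * (a ⬝ᵥ a) := h3
    _ ≤ wm * ((n : ℝ) ^ 2 * (d * residualSq ψ y x C c)) := by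
        refine mul_le_mul_of_nonneg_left (h2.trans ?_) hwm0
        exact mul_le_mul h4 h1 (dotProduct_self_nonneg' V) (sq_nonneg _)
    _ ≤ _ := by linarith

end EmpiricalForms

end FLR

namespace FLR

open Matrix

/-! ### Stability of Δ and δ under comparison of forms -/

section BigDelta

variable {w : ℕ → ℝ} {K K' : MatSeq} {m : ℕ}

theorem le_bigDelta (w : ℕ → ℝ) (K : MatSeq) {k : ℕ} (hk : k ∈ Finset.Icc 1 m) :
    specNorm (diagMat (fun j => √(w j)) k * (K k)⁻¹ * diagMat (fun j => √(w j)) k) ≤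
      bigDelta w K m :=
  le_ciSup (f := fun k : Finset.Icc 1 m =>
    specNorm (diagMat (fun j => √(w j)) k * (K k)⁻¹ * diagMat (fun j => √(w j)) k))
    (Set.finite_range _).bddAbove ⟨k, hk⟩

theorem bigDelta_nonneg (w : ℕ → ℝ) (K : MatSeq) (m : ℕ) : 0 ≤ bigDelta w K m :=
  Real.iSup_nonneg fun _ => specNorm_nonneg _

theorem bigDelta_le_mul (hw : ∀ j, 0 ≤ w j) {c : ℝ} (hc : 0 ≤ c)
    (hK : ∀ k ∈ Finset.Icc 1 m, (K k).PosDef) (hK' : ∀ k ∈ Finset.Icc 1 m, (K' k).PosDef)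
    (h : ∀ k ∈ Finset.Icc 1 m, ∀ v : Fin k → ℝ, v ⬝ᵥ K k *ᵥ v ≤ c * (v ⬝ᵥ K' k *ᵥ v)) :
    bigDelta w K' m ≤ c * bigDelta w K m := by
  refine Real.iSup_le (fun k => ?_) (mul_nonneg hc (bigDelta_nonneg _ _ _))
  refine (specNorm_weighted_inv_le_mul hw (hK k k.2) (hK' k k.2) hc (h k k.2)).trans ?_
  exact mul_le_mul_of_nonneg_left (le_bigDelta w K k.2) hc

/-- The ratio of logarithms in the definition of `smallDelta`. -/
noncomputable def logRatio (D : ℝ) (m : ℕ) : ℝ := Real.log (max D (m + 2)) / Real.log (m + 2)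

theorem one_le_log_add_two {m : ℕ} (hm : 1 ≤ m) : 1 ≤ Real.log ((m : ℝ) + 2) := by
  have h1 : (1 : ℝ) ≤ m := by exact_mod_cast hm
  rw [Real.le_log_iff_exp_le (by positivity)]
  linarith [Real.exp_one_lt_d9]

theorem one_le_logRatio (D : ℝ) {m : ℕ} (hm : 1 ≤ m) : 1 ≤ logRatio D m := by
  have h1 := one_le_log_add_two hm
  rw [logRatio, one_le_div (by linarith)]
  exact Real.log_le_log (by positivity) (le_max_right _ _)

/-- The logarithm turns the factor c into a summand log c, absorbed because log (m + 2) ≥ 1. -/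
theorem logRatio_le_mul {D D' c : ℝ} (hc : 1 ≤ c) (h : D' ≤ c * D) {m : ℕ} (hm : 1 ≤ m) :
    logRatio D' m ≤ (1 + Real.log c) * logRatio D m := by
  have h1 := one_le_log_add_two hm
  have h2 : Real.log ((m : ℝ) + 2) ≤ Real.log (max D (m + 2)) :=
    Real.log_le_log (by positivity) (le_max_right _ _)
  have h3 : Real.log (max D' (m + 2)) ≤ Real.log c + Real.log (max D (m + 2)) := by
    rw [← Real.log_mul (by positivity) (by positivity)]
    refine Real.log_le_log (by positivity) (max_le ?_ ?_)
    · exact h.trans (by gcongr; exact le_max_left _ _)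
    · calc (m : ℝ) + 2 ≤ c * (m + 2) := by nlinarith [(Nat.cast_nonneg m : (0:ℝ) ≤ m)]
        _ ≤ _ := by gcongr; exact le_max_right _ _
  have h4 : 0 ≤ Real.log c := Real.log_nonneg hc
  rw [logRatio, logRatio, ← mul_div_assoc]
  gcongr
  nlinarith

theorem smallDelta_eq (w : ℕ → ℝ) (K : MatSeq) (m : ℕ) :
    smallDelta w K m = m * bigDelta w K m * logRatio (bigDelta w K m) m := rfl

theorem smallDelta_nonneg (w : ℕ → ℝ) (K : MatSeq) {m : ℕ} (hm : 1 ≤ m) :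
    0 ≤ smallDelta w K m := by
  rw [smallDelta_eq]
  have := one_le_logRatio (bigDelta w K m) hm
  have := bigDelta_nonneg w K m
  positivity

/-- One factor c comes from Δ, the other from the logarithm through 1 + log c ≤ c. -/
theorem smallDelta_le_mul {c : ℝ} (hc : 1 ≤ c) (hm : 1 ≤ m)
    (h : bigDelta w K' m ≤ c * bigDelta w K m) :
    smallDelta w K' m ≤ c ^ 2 * smallDelta w K m := by
  rw [smallDelta_eq, smallDelta_eq]
  have h1 := logRatio_le_mul hc h hm
  have h2 := one_le_logRatio (bigDelta w K m) hm
  have h2' := one_le_logRatio (bigDelta w K' m) hm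
  have h3 := bigDelta_nonneg w K m
  have h4 : 1 + Real.log c ≤ c := by
    have := Real.log_le_sub_one_of_pos (by linarith : 0 < c)
    linarith
  have h5 := bigDelta_nonneg w K' m
  generalize logRatio (bigDelta w K m) m = l at *
  generalize logRatio (bigDelta w K' m) m = l' at *
  generalize bigDelta w K m = D at *
  generalize bigDelta w K' m = D' at *
  have h6 : l' ≤ c * l := h1.trans (mul_le_mul_of_nonneg_right h4 (by linarith))
  calc m * D' * l' ≤ m * (c * D) * (c * l) := by gcongr
    _ = _ := by ring

end BigDelta

/-! ### Closeness of empirical and theoretical forms -/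

section FormClose

variable {m : ℕ}

/-- The quadratic forms of two matrices differ by at most the fraction `η`. -/
def FormClose (η : ℝ) (A B : Matrix (Fin m) (Fin m) ℝ) : Prop :=
  ∀ v : Fin m → ℝ, |v ⬝ᵥ B *ᵥ v - v ⬝ᵥ A *ᵥ v| ≤ η * (v ⬝ᵥ A *ᵥ v)

variable {A B : Matrix (Fin m) (Fin m) ℝ}

theorem FormClose.ge (h : FormClose (1 / 8) A B) (v : Fin m → ℝ) :
    7 / 8 * (v ⬝ᵥ A *ᵥ v) ≤ v ⬝ᵥ B *ᵥ v := by
  have := (abs_le.1 (h v)).1; linarith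

theorem FormClose.le (h : FormClose (1 / 8) A B) (v : Fin m → ℝ) :
    v ⬝ᵥ B *ᵥ v ≤ 9 / 8 * (v ⬝ᵥ A *ᵥ v) := by
  have := (abs_le.1 (h v)).2; linarith

theorem FormClose.posDef (h : FormClose (1 / 8) A B) (hA : A.PosDef) (hB : B.IsHermitian) :
    B.PosDef :=
  posDef_of_form_ge hA hB (by norm_num) h.ge

theorem smallDelta_formClose {w : ℕ → ℝ} (hw : ∀ j, 0 ≤ w j) {K K' : MatSeq} {m : ℕ} (hm : 1 ≤ m)
    (hK : ∀ k ∈ Finset.Icc 1 m, (K k).PosDef)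
    (hK' : ∀ k, (K' k).IsHermitian) (h : ∀ k ∈ Finset.Icc 1 m, FormClose (1 / 8) (K k) (K' k)) :
    smallDelta w K m ≤ (9 / 8) ^ 2 * smallDelta w K' m ∧
      smallDelta w K' m ≤ (8 / 7) ^ 2 * smallDelta w K m := by
  have hpd : ∀ k ∈ Finset.Icc 1 m, (K' k).PosDef := fun k hk => (h k hk).posDef (hK k hk) (hK' k)
  constructor
  · refine smallDelta_le_mul (by norm_num) hm (bigDelta_le_mul hw (by norm_num) hpd hK ?_)
    exact fun k hk v => (h k hk).le v
  · refine smallDelta_le_mul (by norm_num) hm (bigDelta_le_mul hw (by norm_num) hK hpd ?_)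
    intro k hk v
    have := (h k hk).ge v
    linarith

end FormClose

/-! ### Dimension bounds -/

section Dimensions

variable {w : ℕ → ℝ} {n : ℕ}

/-- Dimension one is always admissible because w_1 = 1 ≤ n, so the supremum is attained. -/
theorem dimBound_spec (hw1 : w 0 = 1) (hn : 1 ≤ n) :
    1 ≤ dimBound w n ∧ dimBound w n ^ 4 ≤ n ∧ wMax w (dimBound w n) ≤ n := by
  have hn' : (1 : ℝ) ≤ n := by exact_mod_cast hn
  have hmem : dimBound w n ∈ {m : ℕ | 1 ≤ m ∧ m ≤ ⌊(n : ℝ) ^ (1 / 4 : ℝ)⌋₊ ∧ wMax w m ≤ n} := by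
    refine Nat.sSup_mem ⟨1, le_rfl, ?_, ?_⟩ ⟨_, fun m hm => hm.2.1⟩
    · exact Nat.le_floor (by simpa using Real.one_le_rpow hn' (by norm_num))
    · have : wMax w 1 = 1 := by simp [wMax, hw1]
      rwa [this]
  refine ⟨hmem.1, ?_, hmem.2.2⟩
  have h1 : (dimBound w n : ℝ) ≤ (n : ℝ) ^ (1 / 4 : ℝ) :=
    (Nat.cast_le.2 hmem.2.1).trans (Nat.floor_le (by positivity))
  have h2 : (dimBound w n : ℝ) ^ 4 ≤ n := by
    calc _ ≤ ((n : ℝ) ^ (1 / 4 : ℝ)) ^ 4 := by gcongr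
      _ = n := by
        rw [← Real.rpow_natCast, ← Real.rpow_mul (by positivity)]; norm_num
  exact_mod_cast h2

theorem le_wMax (w : ℕ → ℝ) {m j : ℕ} (hj : j < m) : w j ≤ wMax w m :=
  le_ciSup (f := fun k : Fin m => w k) (Set.finite_range _).bddAbove ⟨j, hj⟩

theorem dimCut_le_dimBound (w : ℕ → ℝ) (n : ℕ) (a : ℕ → ℝ) : dimCut w n a ≤ dimBound w n := by
  rw [dimCut]
  split_ifs with h
  · have := Nat.sInf_mem h
    exact (Nat.sub_le _ _).trans this.2.1
  · exact le_rfl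

theorem one_le_dimCut (hw1 : w 0 = 1) (hn : 1 ≤ n) (a : ℕ → ℝ) : 1 ≤ dimCut w n a := by
  rw [dimCut]
  split_ifs with h
  · have := (Nat.sInf_mem h).1
    omega
  · exact (dimBound_spec hw1 hn).1

/-- Larger a enlarges the set of forbidden dimensions, so its minimum comes earlier. -/
theorem dimCut_anti (hw : ∀ j, 0 ≤ w j) {a a' : ℕ → ℝ}
    (h : ∀ m, 2 ≤ m → m ≤ dimBound w n → a m ≤ a' m) : dimCut w n a' ≤ dimCut w n a := by
  have hsub : cutSet w n a ⊆ cutSet w n a' := by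
    rintro m ⟨h1, h2, h3⟩
    refine ⟨h1, h2, h3.trans_le ?_⟩
    have : 0 ≤ wMax w m := Real.iSup_nonneg fun _ => hw _
    gcongr
    exact h m h1 h2
  by_cases hne : (cutSet w n a).Nonempty
  · rw [dimCut, dimCut, if_pos hne, if_pos (hne.mono hsub)]
    exact Nat.sub_le_sub_right (Nat.sInf_le (hsub (Nat.sInf_mem hne))) 1
  · rw [dimCut.eq_def w n a, if_neg hne]
    exact dimCut_le_dimBound w n a'

/-- A cut stops one short of the first violation. Dimension one is never tested, whence the
restriction to m ≥ 2. -/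
theorem le_of_le_dimCut {a : ℕ → ℝ} {m : ℕ} (h2 : 2 ≤ m) (hm : m ≤ dimCut w n a) :
    m * wMax w m * a m ≤ n / (1 + Real.log n) := by
  by_contra! hlt
  have hmem : m ∈ cutSet w n a := ⟨h2, hm.trans (dimCut_le_dimBound w n a), hlt⟩
  have hne : (cutSet w n a).Nonempty := ⟨m, hmem⟩
  rw [dimCut, if_pos hne] at hm
  have := Nat.sInf_le hmem
  omega

theorem argminUpTo_mem {M : ℕ} (hM : 1 ≤ M) (f : ℕ → ℝ) : argminUpTo M f ∈ Finset.Icc 1 M := by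
  have hne : {m : ℕ | m ∈ Finset.Icc 1 M ∧ ∀ m' ∈ Finset.Icc 1 M, f m ≤ f m'}.Nonempty := by
    obtain ⟨m, hm, hmin⟩ := Finset.exists_min_image (Finset.Icc 1 M) f
      ⟨1, Finset.mem_Icc.2 ⟨le_rfl, hM⟩⟩
    exact ⟨m, hm, hmin⟩
  exact (Nat.sInf_mem hne).1

end Dimensions

/-! ### Matrix consequences of membership in the operator class -/

section ClassBounds

variable {H : Type*} [NormedAddCommGroup H] [InnerProductSpace ℝ H] [CompleteSpace H]
  (ψ : HilbertBasis ℕ ℝ H) {w b γ : ℕ → ℝ} {T : H →L[ℝ] H} {d : ℝ}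

theorem form_diagMat (m : ℕ) (v : Fin m → ℝ) :
    v ⬝ᵥ diagMat γ m *ᵥ v = ∑ j : Fin m, γ j * v j ^ 2 := by
  rw [diagMat_mulVec]
  exact Finset.sum_congr rfl fun j _ => by ring

theorem posDef_diagMat (h : ∀ j, 0 < γ j) (m : ℕ) : (diagMat γ m).PosDef :=
  Matrix.PosDef.diagonal fun j => h j

theorem opMat_form_bounds (hR : RegularWeights w b γ) (hd : 1 ≤ d) (hT : T ∈ opClass ψ γ d)
    {m : ℕ} (v : Fin m → ℝ) :
    v ⬝ᵥ diagMat γ m *ᵥ v ≤ d * (v ⬝ᵥ opMat ψ T m *ᵥ v) ∧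
      v ⬝ᵥ opMat ψ T m *ᵥ v ≤ d * (v ⬝ᵥ diagMat γ m *ᵥ v) := by
  have h := opClass_form_bounds ψ hR.γ_pos hR.γ_summable hR.γ_le_one hd hT (lincomb ψ v)
  rw [tsum_mul_inner_lincomb_sq, ← form_diagMat, inv_mul_le_iff₀ (by linarith)] at h
  rw [form_opMat, real_inner_comm]
  exact h

theorem opMat_form_le (hR : RegularWeights w b γ) (hd : 1 ≤ d) (hT : T ∈ opClass ψ γ d)
    {m : ℕ} (v : Fin m → ℝ) : v ⬝ᵥ opMat ψ T m *ᵥ v ≤ d * (v ⬝ᵥ v) := by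
  refine (opMat_form_bounds ψ hR hd hT v).2.trans ?_
  rw [form_diagMat]
  refine mul_le_mul_of_nonneg_left (Finset.sum_le_sum fun j _ => ?_) (by linarith)
  rw [← sq]
  exact mul_le_of_le_one_left (sq_nonneg _) (hR.γ_le_one j)

theorem bigDelta_opMat_le (hR : RegularWeights w b γ) (hd : 1 ≤ d) (hT : T ∈ opClass ψ γ d)
    (m : ℕ) : bigDelta w (opMat ψ T) m ≤ d * bigDelta w (diagMat γ) m ∧
      bigDelta w (diagMat γ) m ≤ d * bigDelta w (opMat ψ T) m := by
  have hpd := posDef_opMat ψ hT.1 hT.2.1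
  exact ⟨bigDelta_le_mul (fun j => (hR.w_pos j).le) (by linarith)
      (fun k _ => posDef_diagMat hR.γ_pos k) (fun k _ => hpd k)
      fun k _ v => (opMat_form_bounds ψ hR hd hT v).1,
    bigDelta_le_mul (fun j => (hR.w_pos j).le) (by linarith) (fun k _ => hpd k)
      (fun k _ => posDef_diagMat hR.γ_pos k) fun k _ v => (opMat_form_bounds ψ hR hd hT v).2⟩

theorem specNorm_inv_le_of_formClose (hR : RegularWeights w b γ) (hd : 1 ≤ d)
    (hT : T ∈ opClass ψ γ d) {m : ℕ} (hm : 1 ≤ m) {B : Matrix (Fin m) (Fin m) ℝ}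
    (hB : B.IsHermitian) (h : FormClose (1 / 8) (opMat ψ T m) B) :
    specNorm B⁻¹ ≤ 8 / 7 * d * (γ (m - 1))⁻¹ := by
  have hpd := posDef_opMat ψ hT.1 hT.2.1 m
  have hγ := hR.γ_pos (m - 1)
  refine (specNorm_inv_le_iff (h.posDef hpd hB) (by positivity)).2 fun v => ?_
  have h1 := h.ge v
  have h2 := (opMat_form_bounds ψ hR hd hT v).1
  have h3 : γ (m - 1) * (v ⬝ᵥ v) ≤ v ⬝ᵥ diagMat γ m *ᵥ v := by
    rw [form_diagMat]
    simp only [dotProduct, Finset.mul_sum]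
    refine Finset.sum_le_sum fun j _ => ?_
    rw [← sq]
    exact mul_le_mul_of_nonneg_right (hR.γ_anti (by omega)) (sq_nonneg _)
  have h4 : γ (m - 1) * (v ⬝ᵥ v) ≤ 8 / 7 * d * (v ⬝ᵥ B *ᵥ v) := by
    calc _ ≤ d * (v ⬝ᵥ opMat ψ T m *ᵥ v) := h3.trans h2
      _ ≤ d * (8 / 7 * (v ⬝ᵥ B *ᵥ v)) := by gcongr; linarith
      _ = _ := by ring
  calc v ⬝ᵥ v = (γ (m - 1))⁻¹ * (γ (m - 1) * (v ⬝ᵥ v)) := by field_simp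
    _ ≤ (γ (m - 1))⁻¹ * (8 / 7 * d * (v ⬝ᵥ B *ᵥ v)) := by gcongr
    _ = _ := by ring

theorem le_specNorm_inv_of_formClose (hR : RegularWeights w b γ) (hd : 1 ≤ d)
    (hT : T ∈ opClass ψ γ d) {m : ℕ} (hm : 1 ≤ m) {B : Matrix (Fin m) (Fin m) ℝ}
    (hB : B.IsHermitian) (h : FormClose (1 / 8) (opMat ψ T m) B) :
    (4 * d * γ (m - 1))⁻¹ ≤ specNorm B⁻¹ := by
  have hpd := posDef_opMat ψ hT.1 hT.2.1 m
  have hγ := hR.γ_pos (m - 1)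
  -- The last basis vector sees the smallest weight, γ_m.
  set v : Fin m → ℝ := Pi.single ⟨m - 1, by omega⟩ 1 with hv
  have h1 := (specNorm_inv_le_iff (h.posDef hpd hB) (specNorm_nonneg _)).1 le_rfl v
  have h2 := (opMat_form_bounds ψ hR hd hT v).2
  have h3 : v ⬝ᵥ diagMat γ m *ᵥ v = γ (m - 1) := by
    rw [diagMat_mulVec, hv]; simp
  have h4 : v ⬝ᵥ v = 1 := by rw [hv]; simp
  have h5 := h.le v
  rw [h3] at h2
  rw [h4] at h1
  have hs : 0 ≤ specNorm B⁻¹ := specNorm_nonneg _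
  rw [inv_le_iff_one_le_mul₀ (by positivity)]
  calc 1 ≤ specNorm B⁻¹ * (v ⬝ᵥ B *ᵥ v) := h1
    _ ≤ specNorm B⁻¹ * (4 * (d * γ (m - 1))) := by
        gcongr
        have : 0 < d * γ (m - 1) := by positivity
        linarith
    _ = _ := by ring

end ClassBounds

/-! ### Random penalties and dimensions on good data -/

section GoodEvent

variable {H : Type*} [NormedAddCommGroup H] [InnerProductSpace ℝ H] [CompleteSpace H]
  (ψ : HilbertBasis ℕ ℝ H) {w b γ : ℕ → ℝ} {T : H →L[ℝ] H} {d : ℝ} {n : ℕ}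
  {y : Fin n → ℝ} {x : Fin n → H}

theorem dimMinus_le_hDim (hR : RegularWeights w b γ) (hd : 1 ≤ d) (hT : T ∈ opClass ψ γ d)
    (h : ∀ k ∈ Finset.Icc 1 (dimBound w n), FormClose (1 / 8) (opMat ψ T k) (empMat ψ x k)) :
    dimMinus w γ d n ≤ hDim ψ x w := by
  refine dimCut_anti (fun j => (hR.w_pos j).le) fun m h2 hm => ?_
  have hm1 : 1 ≤ m := by omega
  refine (specNorm_inv_le_of_formClose ψ hR hd hT hm1 (empMat_isHermitian ψ x)
    (h m (Finset.mem_Icc.2 ⟨hm1, hm⟩))).trans ?_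
  have hγ := hR.γ_pos (m - 1)
  gcongr
  · norm_num
  · exact le_self_pow₀ hd (by norm_num)

theorem hDim_le_dimPlus (hR : RegularWeights w b γ) (hd : 1 ≤ d) (hT : T ∈ opClass ψ γ d)
    (h : ∀ k ∈ Finset.Icc 1 (dimBound w n), FormClose (1 / 8) (opMat ψ T k) (empMat ψ x k)) :
    hDim ψ x w ≤ dimPlus w γ d n := by
  refine dimCut_anti (fun j => (hR.w_pos j).le) fun m h2 hm => ?_
  have hm1 : 1 ≤ m := by omega
  exact le_specNorm_inv_of_formClose ψ hR hd hT hm1 (empMat_isHermitian ψ x)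
    (h m (Finset.mem_Icc.2 ⟨hm1, hm⟩))

/-- Passing between [Γ] and [Γ̂] changes δ by at most (9/8)² and (8/7)². Each explained part lies
between 0 and its second moment, so the population variance factor is between E Y² and 2 E Y² and
the empirical one between E Y² / 2 and 3 E Y². The constants 14 and 72 suffice since 2 (9/8)² ≤ 14 /
2 and 14 · 3 (8/7)² ≤ 72. -/
theorem pen_le_hpen_le (hw : ∀ j, 0 ≤ w j) (hT : T.IsPositive)
    (hpos : ∀ f : H, f ≠ 0 → 0 < ⟪T f, f⟫) {m : ℕ} (hm : 1 ≤ m)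
    (h : ∀ k ∈ Finset.Icc 1 m, FormClose (1 / 8) (opMat ψ T k) (empMat ψ x k))
    {y2 : ℝ} (hY : |empY2 y - y2| ≤ 1 / 2 * y2) {g : ℕ → ℝ}
    (hg0 : 0 ≤ headVec g m ⬝ᵥ (opMat ψ T m)⁻¹ *ᵥ headVec g m)
    (hg1 : headVec g m ⬝ᵥ (opMat ψ T m)⁻¹ *ᵥ headVec g m ≤ y2) :
    penalty 96 w y2 (opMat ψ T) g n m ≤ hpen ψ y x 96 w m ∧
      hpen ψ y x 96 w m ≤ 72 * penalty 96 w y2 (opMat ψ T) g n m := by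
  have hpd := posDef_opMat ψ hT hpos
  have hmm : m ∈ Finset.Icc 1 m := Finset.mem_Icc.2 ⟨hm, le_rfl⟩
  have hpd' : (empMat ψ x m).PosDef := (h m hmm).posDef (hpd m) (empMat_isHermitian ψ x)
  obtain ⟨h1, h2⟩ := smallDelta_formClose hw hm (fun k _ => hpd k)
    (fun k => empMat_isHermitian ψ x) h
  have h3 := empG_form_le ψ y x (posDef_isUnit_det hpd')
  have h4 := posSemidef_form_nonneg hpd'.inv.posSemidef (headVec (empG ψ y x) m)
  obtain ⟨h5, h6⟩ := abs_le.1 hY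
  have hy0 : 0 ≤ y2 := hg0.trans hg1
  have hs0 := smallDelta_nonneg w (opMat ψ T) hm
  have hs0' := smallDelta_nonneg w (empMat ψ x) hm
  simp only [hpen, penalty, sigmaSq]
  generalize headVec g m ⬝ᵥ (opMat ψ T m)⁻¹ *ᵥ headVec g m = p at *
  generalize headVec (empG ψ y x) m ⬝ᵥ (empMat ψ x m)⁻¹ *ᵥ headVec (empG ψ y x) m = q at *
  generalize smallDelta w (opMat ψ T) m = s at *
  generalize smallDelta w (empMat ψ x) m = s' at *
  constructor
  · gcongr ?_ / _
    have e1 : (y2 + p) * s ≤ (2 * y2) * ((9 / 8) ^ 2 * s') := by gcongr; linarith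
    have e2 : y2 / 2 * s' ≤ (empY2 y + q) * s' := by gcongr; linarith
    nlinarith [mul_nonneg hy0 hs0']
  · rw [← mul_div_assoc]
    gcongr ?_ / _
    have e1 : (empY2 y + q) * s' ≤ (3 * y2) * ((8 / 7) ^ 2 * s) := by gcongr; linarith
    have e2 : y2 * s ≤ (y2 + p) * s := by gcongr; linarith
    nlinarith [mul_nonneg hy0 hs0]

end GoodEvent

end FLR

namespace FLR

open Matrix
open scoped NNReal

/-! ### Functions that dominate the bad event -/

section Excess

variable {H : Type*} [NormedAddCommGroup H] [InnerProductSpace ℝ H] (ψ : HilbertBasis ℕ ℝ H)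
  {n m : ℕ}

open Classical in
/-- The excess of the empirical second moment of `⟨f, x_i⟩` over `⟨T f, f⟩`. -/
noncomputable def formExcess (T : H →L[ℝ] H) (τ : ℝ) (f : H) (x : Fin n → H) : ℝ :=
  if f = 0 then 0 else chiExcess τ ⟪T f, f⟫ n (∑ i, ⟪f, x i⟫ ^ 2)

theorem formExcess_nonneg (T : H →L[ℝ] H) (τ : ℝ) (f : H) (x : Fin n → H) :
    0 ≤ formExcess T τ f x := by
  rw [formExcess]
  split_ifs
  · exact le_rfl
  · exact chiExcess_nonneg _ _ _ _

/-- The vector f = 0 occurs, as the difference of a white vector and itself; there the deviation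
vanishes and the excess must be set to zero by hand. -/
theorem abs_form_sub_le_or_one_le {T : H →L[ℝ] H} (hpos : ∀ f : H, f ≠ 0 → 0 < ⟪T f, f⟫)
    {τ : ℝ} (hτ : 0 ≤ τ) (hn : 0 < n) (f : H) (x : Fin n → H) :
    |(n : ℝ)⁻¹ * ∑ i, ⟪f, x i⟫ ^ 2 - ⟪T f, f⟫| ≤ τ * ⟪T f, f⟫ ∨ 1 ≤ formExcess T τ f x := by
  rw [formExcess]
  split_ifs with h
  · left; simp [h]
  · exact abs_sub_le_or_one_le_chiExcess hτ (hpos f h) hn _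

/-- The sum of the excesses that control the empirical quantities of dimension `m`. -/
noncomputable def dimExcess (T : H →L[ℝ] H) (C : Matrix (Fin m) (Fin m) ℝ) (c : Fin m → ℝ)
    (v : ℝ) (y : Fin n → ℝ) (x : Fin n → H) : ℝ :=
  (∑ j : Fin m, ∑ l : Fin m,
    (formExcess T (1 / 8 / m) (whiteVec ψ C j + (1 : ℝ) • whiteVec ψ C l) x +
      formExcess T (1 / 8 / m) (whiteVec ψ C j + (-1 : ℝ) • whiteVec ψ C l) x)) +
  chiExcess 1 v n (∑ i, (y i - ⟪lincomb ψ c, x i⟫) ^ 2)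

theorem dimExcess_nonneg (T : H →L[ℝ] H) (C : Matrix (Fin m) (Fin m) ℝ) (c : Fin m → ℝ)
    (v : ℝ) (y : Fin n → ℝ) (x : Fin n → H) : 0 ≤ dimExcess ψ T C c v y x :=
  add_nonneg (Finset.sum_nonneg fun _ _ => Finset.sum_nonneg fun _ _ =>
    add_nonneg (formExcess_nonneg _ _ _ _) (formExcess_nonneg _ _ _ _)) (chiExcess_nonneg _ _ _ _)

/-- A sum of nonnegative excesses below 1 has every term below 1. Polarisation then gives entries
within 1 / (8m), and tolerance 1 for the residuals gives the factor 2. -/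
theorem formClose_of_dimExcess_lt {T : H →L[ℝ] H} (hpos : ∀ f : H, f ≠ 0 → 0 < ⟪T f, f⟫)
    {C : Matrix (Fin m) (Fin m) ℝ} (hC : IsUnit C.det) (hA : opMat ψ T m = Cᵀ * C)
    {c : Fin m → ℝ} {v : ℝ} (hv : 0 < v) (hn : 0 < n) {y : Fin n → ℝ} {x : Fin n → H}
    (h : dimExcess ψ T C c v y x < 1) :
    FormClose (1 / 8) (opMat ψ T m) (empMat ψ x m) ∧
      (n : ℝ)⁻¹ * ∑ i, (y i - ⟪lincomb ψ c, x i⟫) ^ 2 ≤ 2 * v := by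
  have h0 : ∀ j l : Fin m, 0 ≤
      formExcess T (1 / 8 / m) (whiteVec ψ C j + (1 : ℝ) • whiteVec ψ C l) x +
        formExcess T (1 / 8 / m) (whiteVec ψ C j + (-1 : ℝ) • whiteVec ψ C l) x := fun j l =>
    add_nonneg (formExcess_nonneg _ _ _ _) (formExcess_nonneg _ _ _ _)
  have h1 := chiExcess_nonneg 1 v n (∑ i, (y i - ⟪lincomb ψ c, x i⟫) ^ 2)
  constructor
  · refine abs_form_empMat_sub_le ψ x hC hA (by norm_num) fun j l => ?_
    refine abs_whitened_entry_sub_le ψ x hC hA j l fun s hs => ?_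
    refine (abs_form_sub_le_or_one_le hpos (by positivity) hn _ x).resolve_right fun h2 => ?_
    have h3 : formExcess T (1 / 8 / m) (whiteVec ψ C j + (1 : ℝ) • whiteVec ψ C l) x +
        formExcess T (1 / 8 / m) (whiteVec ψ C j + (-1 : ℝ) • whiteVec ψ C l) x ≤
        ∑ j : Fin m, ∑ l : Fin m,
          (formExcess T (1 / 8 / m) (whiteVec ψ C j + (1 : ℝ) • whiteVec ψ C l) x +
          formExcess T (1 / 8 / m) (whiteVec ψ C j + (-1 : ℝ) • whiteVec ψ C l) x) :=
      (Finset.single_le_sum (fun l _ => h0 j l) (Finset.mem_univ l)).trans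
        (Finset.single_le_sum (f := fun j => ∑ l : Fin m,
          (formExcess T (1 / 8 / m) (whiteVec ψ C j + (1 : ℝ) • whiteVec ψ C l) x +
          formExcess T (1 / 8 / m) (whiteVec ψ C j + (-1 : ℝ) • whiteVec ψ C l) x))
          (fun j _ => Finset.sum_nonneg fun l _ => h0 j l) (Finset.mem_univ j))
    have h4 := formExcess_nonneg T (1 / 8 / m) (whiteVec ψ C j + (1 : ℝ) • whiteVec ψ C l) x
    have h5 := formExcess_nonneg T (1 / 8 / m) (whiteVec ψ C j + (-1 : ℝ) • whiteVec ψ C l) x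
    rw [dimExcess] at h
    rcases hs with rfl | rfl <;> linarith
  · have h2 := (abs_sub_le_or_one_le_chiExcess zero_le_one hv hn
      (∑ i, (y i - ⟪lincomb ψ c, x i⟫) ^ 2)).resolve_right fun h2 => by
        have := Finset.sum_nonneg fun (j : Fin m) (_ : j ∈ Finset.univ) =>
          Finset.sum_nonneg fun (l : Fin m) (_ : l ∈ Finset.univ) => h0 j l
        rw [dimExcess] at h
        linarith
    have := (abs_le.1 h2).2
    linarith

/-- A bound for eighth moments that controls the squared norm of the whitened residual. -/
noncomputable def momentSum (C : Matrix (Fin m) (Fin m) ℝ) (c : Fin m → ℝ) (v : ℝ)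
    (y : Fin n → ℝ) (x : Fin n → H) : ℝ :=
  (n : ℝ)⁻¹ * ∑ i, ((y i - ⟪lincomb ψ c, x i⟫) ^ 2 / v) ^ 4 +
    (m : ℝ) ^ 3 * ((n : ℝ)⁻¹ * ∑ i, ∑ j, (⟪whiteVec ψ C j, x i⟫ ^ 2 / 1) ^ 4)

theorem sum_pow_four_le {ι : Type*} [Fintype ι] {a : ι → ℝ} (ha : ∀ i, 0 ≤ a i) :
    (∑ i, a i) ^ 4 ≤ (Fintype.card ι : ℝ) ^ 3 * ∑ i, a i ^ 4 := by
  have h := pow_sum_div_card_le_sum_pow (s := Finset.univ) (f := a) (fun i _ => ha i) 3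
  rw [Finset.card_univ] at h
  rcases isEmpty_or_nonempty ι with hι | hι
  · simp
  · have hc : (0 : ℝ) < (Fintype.card ι : ℝ) ^ 3 := by
      have := Fintype.card_pos (α := ι)
      positivity
    rwa [div_le_iff₀' hc] at h

theorem inv_mul_sum_pow_four_le (hn : 0 < n) {a : Fin n → ℝ} (ha : ∀ i, 0 ≤ a i) :
    ((n : ℝ)⁻¹ * ∑ i, a i) ^ 4 ≤ (n : ℝ)⁻¹ * ∑ i, a i ^ 4 := by
  have hn0 : (0 : ℝ) < n := by exact_mod_cast hn
  have h := sum_pow_four_le ha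
  rw [Fintype.card_fin] at h
  calc _ = ((n : ℝ)⁻¹) ^ 4 * (∑ i, a i) ^ 4 := mul_pow _ _ _
    _ ≤ ((n : ℝ)⁻¹) ^ 4 * ((n : ℝ) ^ 3 * ∑ i, a i ^ 4) := by gcongr
    _ = _ := by field_simp

/-- UZ ≤ (U² + Z²) / 2 and U² ≤ U⁴ / N + N / 4. The free parameter N trades a small multiple of the
random moments against a deterministic term, which will be multiplied by the excess; no Hölder
inequality is needed. -/
theorem residualSq_le_momentSum (C : Matrix (Fin m) (Fin m) ℝ) (c : Fin m → ℝ) {v : ℝ}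
    (hv : 0 < v) (hn : 0 < n) (y : Fin n → ℝ) (x : Fin n → H) {N : ℝ} (hN : 0 < N) :
    residualSq ψ y x C c ≤ v * (momentSum ψ C c v y x / N + N) := by
  set U := (n : ℝ)⁻¹ * ∑ i, (y i - ⟪lincomb ψ c, x i⟫) ^ 2 / v with hU
  set Z := (n : ℝ)⁻¹ * ∑ i, ∑ j, ⟪whiteVec ψ C j, x i⟫ ^ 2 / 1 with hZ
  have h1 : residualSq ψ y x C c ≤ v * (U * Z) := by
    refine (residualSq_le ψ y x C c).trans (le_of_eq ?_)
    rw [hU, hZ, ← Finset.sum_div]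
    simp only [div_one]
    field_simp
  have hU4 : U ^ 4 ≤ (n : ℝ)⁻¹ * ∑ i, ((y i - ⟪lincomb ψ c, x i⟫) ^ 2 / v) ^ 4 :=
    inv_mul_sum_pow_four_le hn fun i => by positivity
  have hZ4 : Z ^ 4 ≤
      (m : ℝ) ^ 3 * ((n : ℝ)⁻¹ * ∑ i, ∑ j, (⟪whiteVec ψ C j, x i⟫ ^ 2 / 1) ^ 4) := by
    refine (inv_mul_sum_pow_four_le hn fun i => Finset.sum_nonneg fun j _ => by positivity).trans ?_
    rw [mul_left_comm, Finset.mul_sum (a := (m : ℝ) ^ 3)]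
    refine mul_le_mul_of_nonneg_left (Finset.sum_le_sum fun i _ => ?_) (by positivity)
    simpa only [Fintype.card_fin] using
      sum_pow_four_le (a := fun j => ⟪whiteVec ψ C j, x i⟫ ^ 2 / 1) fun j => by positivity
  have h2 : U * Z ≤ momentSum ψ C c v y x / N + N := by
    rw [momentSum, ← sub_nonneg]
    have h3 : U ^ 2 ≤ U ^ 4 / N + N / 4 := by
      rw [div_add_div _ _ hN.ne' (by norm_num), le_div_iff₀ (by positivity)]
      nlinarith [sq_nonneg (2 * U ^ 2 - N)]
    have h4 : Z ^ 2 ≤ Z ^ 4 / N + N / 4 := by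
      rw [div_add_div _ _ hN.ne' (by norm_num), le_div_iff₀ (by positivity)]
      nlinarith [sq_nonneg (2 * Z ^ 2 - N)]
    have h5 : (U ^ 4 + Z ^ 4) / N ≤ ((n : ℝ)⁻¹ * ∑ i, ((y i - ⟪lincomb ψ c, x i⟫) ^ 2 / v) ^ 4 +
      (m : ℝ) ^ 3 * ((n : ℝ)⁻¹ * ∑ i, ∑ j, (⟪whiteVec ψ C j, x i⟫ ^ 2 / 1) ^ 4)) / N := by
      gcongr
    rw [add_div] at h5
    have h6 : 0 ≤ U ^ 4 / N := by positivity
    have h7 : 0 ≤ Z ^ 4 / N := by positivity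
    nlinarith [sq_nonneg (U - Z)]
  exact h1.trans (mul_le_mul_of_nonneg_left h2 hv.le)

end Excess

/-! ### Expectations for a single dimension -/

section Expectations

variable {H : Type*} [NormedAddCommGroup H] [InnerProductSpace ℝ H] [CompleteSpace H]
  [SecondCountableTopology H] [MeasurableSpace H] [BorelSpace H] (ψ : HilbertBasis ℕ ℝ H)
  {Ω₀ : Type*} [MeasurableSpace Ω₀] {P₀ : Measure Ω₀} [IsProbabilityMeasure P₀]
  {X : Ω₀ → H} {ε : Ω₀ → ℝ} {φ : H} {σ : ℝ}
  {Ω : Type*} [MeasurableSpace Ω] {P : Measure Ω} [IsProbabilityMeasure P]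
  {n : ℕ} {Ys : Fin n → Ω → ℝ} {Xs : Fin n → Ω → H} {T : H →L[ℝ] H}

theorem lintegral_chiExcess_pairForm_le (hG : GaussianDesign P₀ X ε)
    (hS : IsSample P₀ (response φ σ X ε) X P Ys Xs) (hΓ : covarianceOperator (P₀.map X) = T)
    (a : ℝ) (h : H) {v : ℝ} (hv : v = ⟪T (a • φ + h), a • φ + h⟫ + (a * σ) ^ 2) (hv0 : 0 < v)
    {τ : ℝ} (hτ0 : 0 ≤ τ) (hτ : τ ≤ 1) :
    ∫⁻ ω, ENNReal.ofReal (chiExcess τ v n (∑ i, pairForm a h (Ys i ω, Xs i ω) ^ 2)) ∂P ≤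
      ENNReal.ofReal (2 * Real.exp (-(n * τ ^ 2 / 16))) := by
  have h1 : ((v.toNNReal : ℝ≥0) : ℝ) = v := Real.coe_toNNReal _ hv0.le
  have := lintegral_chiExcess_le (sample_iIndepFun_pairForm hS a h)
    (fun i => sample_aemeasurable_pairForm hS i a h) (v := v.toNNReal) (by simpa using hv0)
    (fun i => by rw [sample_map_pairForm hG hS, hΓ, hv]) hτ0 hτ
  rwa [h1] at this

theorem lintegral_pow_pairForm_le (hG : GaussianDesign P₀ X ε)
    (hS : IsSample P₀ (response φ σ X ε) X P Ys Xs) (hΓ : covarianceOperator (P₀.map X) = T)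
    (i : Fin n) (a : ℝ) (h : H) {s : ℝ} (hs : 0 < s)
    (hvs : ⟪T (a • φ + h), a • φ + h⟫ + (a * σ) ^ 2 ≤ s) :
    ∫⁻ ω, ENNReal.ofReal ((pairForm a h (Ys i ω, Xs i ω) ^ 2 / s) ^ 4) ∂P ≤
      ENNReal.ofReal 12288 := by
  refine lintegral_pow_eight_le (sample_aemeasurable_pairForm hS i a h)
    (sample_map_pairForm hG hS i a h) hs ?_
  rw [hΓ, Real.coe_toNNReal']
  exact max_le hvs hs.le

theorem pairForm_zero_apply (f : H) (q : ℝ × H) : pairForm 0 f q = ⟪f, q.2⟫ := by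
  rw [pairForm_apply]; ring

theorem pairForm_one_neg_apply (p : H) (q : ℝ × H) : pairForm 1 (-p) q = q.1 - ⟪p, q.2⟫ := by
  rw [pairForm_apply, inner_neg_left]; ring

theorem aemeasurable_inner_sample (hS : IsSample P₀ (response φ σ X ε) X P Ys Xs) (i : Fin n)
    (f : H) : AEMeasurable (fun ω => ⟪f, Xs i ω⟫) P := by
  simpa [pairForm_zero_apply] using sample_aemeasurable_pairForm hS i 0 f

theorem aemeasurable_residual_sample (hS : IsSample P₀ (response φ σ X ε) X P Ys Xs) (i : Fin n)
    (p : H) : AEMeasurable (fun ω => Ys i ω - ⟪p, Xs i ω⟫) P := by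
  simpa [pairForm_one_neg_apply] using sample_aemeasurable_pairForm hS i 1 (-p)

theorem aemeasurable_formExcess (hS : IsSample P₀ (response φ σ X ε) X P Ys Xs) (τ : ℝ) (f : H) :
    AEMeasurable (fun ω => formExcess T τ f fun i => Xs i ω) P := by
  unfold formExcess
  split_ifs
  · exact aemeasurable_const
  · have := aemeasurable_inner_sample hS (f := f)
    exact (measurable_chiExcess _ _ _).comp_aemeasurable (by fun_prop)

theorem aemeasurable_dimExcess (hS : IsSample P₀ (response φ σ X ε) X P Ys Xs) {m : ℕ}
    (C : Matrix (Fin m) (Fin m) ℝ) (c : Fin m → ℝ) (v : ℝ) :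
    AEMeasurable (fun ω => dimExcess ψ T C c v (fun i => Ys i ω) fun i => Xs i ω) P := by
  unfold dimExcess
  refine AEMeasurable.add ?_ ?_
  · exact Finset.univ.aemeasurable_fun_sum fun j _ => Finset.univ.aemeasurable_fun_sum fun l _ =>
      (aemeasurable_formExcess hS _ _).add (aemeasurable_formExcess hS _ _)
  · have := fun i => aemeasurable_residual_sample hS i (lincomb ψ c)
    exact (measurable_chiExcess _ _ _).comp_aemeasurable (by fun_prop)

theorem lintegral_formExcess_le (hG : GaussianDesign P₀ X ε)
    (hS : IsSample P₀ (response φ σ X ε) X P Ys Xs) (hΓ : covarianceOperator (P₀.map X) = T)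
    (hpos : ∀ f : H, f ≠ 0 → 0 < ⟪T f, f⟫) {τ : ℝ} (hτ0 : 0 ≤ τ) (hτ : τ ≤ 1) (f : H) :
    ∫⁻ ω, ENNReal.ofReal (formExcess T τ f fun i => Xs i ω) ∂P ≤
      ENNReal.ofReal (2 * Real.exp (-(n * τ ^ 2 / 16))) := by
  unfold formExcess
  split_ifs with hf
  · simp
  · have := lintegral_chiExcess_pairForm_le (n := n) hG hS hΓ 0 f (v := ⟪T f, f⟫)
      (by simp) (hpos f hf) hτ0 hτ
    simpa only [pairForm_zero_apply] using this

theorem lintegral_dimExcess_le (hG : GaussianDesign P₀ X ε)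
    (hS : IsSample P₀ (response φ σ X ε) X P Ys Xs) (hΓ : covarianceOperator (P₀.map X) = T)
    (hpos : ∀ f : H, f ≠ 0 → 0 < ⟪T f, f⟫) {m : ℕ} (hm : 1 ≤ m)
    (C : Matrix (Fin m) (Fin m) ℝ) (c : Fin m → ℝ) {v : ℝ}
    (hv : v = ⟪T (φ - lincomb ψ c), φ - lincomb ψ c⟫ + σ ^ 2) (hv0 : 0 < v) :
    ∫⁻ ω, ENNReal.ofReal (dimExcess ψ T C c v (fun i => Ys i ω) fun i => Xs i ω) ∂P ≤
      ENNReal.ofReal ((2 * m ^ 2 + 1) * (2 * Real.exp (-(n / (1024 * m ^ 2))))) := by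
  have hm' : (1 : ℝ) ≤ m := by exact_mod_cast hm
  set E := 2 * Real.exp (-((n : ℝ) / (1024 * m ^ 2))) with hE
  have hE0 : 0 ≤ E := by positivity
  have h1 : ∀ f : H, ∫⁻ ω, ENNReal.ofReal (formExcess T (1 / 8 / m) f fun i => Xs i ω) ∂P ≤
      ENNReal.ofReal E := by
    intro f
    have hτ : (1 : ℝ) / 8 / m ≤ 1 := by
      rw [div_div, div_le_one (by positivity)]; linarith
    -- τ = 1 / (8m) gives τ² / 16 = 1 / (1024 m²).
    refine (lintegral_formExcess_le hG hS hΓ hpos (by positivity) hτ f).trans (le_of_eq ?_)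
    rw [hE]
    congr 4
    field_simp
    ring
  have h2 : ∫⁻ ω, ENNReal.ofReal
      (chiExcess 1 v n (∑ i, (Ys i ω - ⟪lincomb ψ c, Xs i ω⟫) ^ 2)) ∂P ≤ ENNReal.ofReal E := by
    have h3 := lintegral_chiExcess_pairForm_le (n := n) hG hS hΓ 1 (-lincomb ψ c) (v := v)
      (by rw [hv, one_smul, ← sub_eq_add_neg, one_mul]) hv0 zero_le_one le_rfl
    simp only [pairForm_one_neg_apply] at h3
    refine h3.trans (ENNReal.ofReal_le_ofReal ?_)
    rw [hE]
    refine mul_le_mul_of_nonneg_left (Real.exp_le_exp.2 (neg_le_neg ?_)) zero_le_two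
    rw [one_pow, mul_one]
    exact div_le_div_of_nonneg_left (Nat.cast_nonneg n) (by norm_num) (by nlinarith)
  have hm1 : ∀ f : H, AEMeasurable
      (fun ω => ENNReal.ofReal (formExcess T (1 / 8 / m) f fun i => Xs i ω)) P := fun f =>
    (aemeasurable_formExcess hS _ f).ennreal_ofReal
  have h3 : ∀ ω, ENNReal.ofReal (dimExcess ψ T C c v (fun i => Ys i ω) fun i => Xs i ω) =
      (∑ j : Fin m, ∑ l : Fin m,
        (ENNReal.ofReal (formExcess T (1 / 8 / m) (whiteVec ψ C j + (1 : ℝ) • whiteVec ψ C l)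
          fun i => Xs i ω) +
        ENNReal.ofReal (formExcess T (1 / 8 / m) (whiteVec ψ C j + (-1 : ℝ) • whiteVec ψ C l)
          fun i => Xs i ω))) +
      ENNReal.ofReal (chiExcess 1 v n (∑ i, (Ys i ω - ⟪lincomb ψ c, Xs i ω⟫) ^ 2)) := by
    intro ω
    have h0 := fun f => formExcess_nonneg (n := n) T (1 / 8 / m) f fun i => Xs i ω
    rw [dimExcess, ENNReal.ofReal_add (Finset.sum_nonneg fun _ _ => Finset.sum_nonneg fun _ _ =>
      add_nonneg (h0 _) (h0 _)) (chiExcess_nonneg _ _ _ _), ENNReal.ofReal_sum_of_nonneg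
      fun _ _ => Finset.sum_nonneg fun _ _ => add_nonneg (h0 _) (h0 _)]
    congr 1
    refine Finset.sum_congr rfl fun j _ => ?_
    rw [ENNReal.ofReal_sum_of_nonneg fun _ _ => add_nonneg (h0 _) (h0 _)]
    exact Finset.sum_congr rfl fun l _ => ENNReal.ofReal_add (h0 _) (h0 _)
  have hm2 : ∀ j l : Fin m, AEMeasurable (fun ω =>
      ENNReal.ofReal (formExcess T (1 / 8 / m) (whiteVec ψ C j + (1 : ℝ) • whiteVec ψ C l)
          fun i => Xs i ω) +
        ENNReal.ofReal (formExcess T (1 / 8 / m) (whiteVec ψ C j + (-1 : ℝ) • whiteVec ψ C l)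
          fun i => Xs i ω)) P := fun j l => (hm1 _).add (hm1 _)
  have hm3 := fun j => Finset.univ.aemeasurable_fun_sum fun l _ => hm2 j l
  rw [lintegral_congr h3, lintegral_add_left' (Finset.univ.aemeasurable_fun_sum fun j _ => hm3 j),
    lintegral_finsetSum' _ fun j _ => hm3 j]
  have h4 : ∀ j : Fin m, ∫⁻ ω, ∑ l : Fin m,
        (ENNReal.ofReal (formExcess T (1 / 8 / m) (whiteVec ψ C j + (1 : ℝ) • whiteVec ψ C l)
          fun i => Xs i ω) +
        ENNReal.ofReal (formExcess T (1 / 8 / m) (whiteVec ψ C j + (-1 : ℝ) • whiteVec ψ C l)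
          fun i => Xs i ω)) ∂P ≤ ENNReal.ofReal (m * (2 * E)) := by
    intro j
    rw [lintegral_finsetSum' _ fun l _ => hm2 j l]
    calc _ ≤ ∑ l : Fin m, ENNReal.ofReal (2 * E) := by
          refine Finset.sum_le_sum fun l _ => ?_
          rw [lintegral_add_left' (hm1 _), two_mul, ENNReal.ofReal_add hE0 hE0]
          exact add_le_add (h1 _) (h1 _)
      _ = _ := by
          rw [Finset.sum_const, Finset.card_univ, Fintype.card_fin, nsmul_eq_mul,
            ← ENNReal.ofReal_natCast, ← ENNReal.ofReal_mul (by positivity)]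
  calc _ ≤ ∑ j : Fin m, ENNReal.ofReal (m * (2 * E)) + ENNReal.ofReal E :=
        add_le_add (Finset.sum_le_sum fun j _ => h4 j) h2
    _ = _ := by
        rw [Finset.sum_const, Finset.card_univ, Fintype.card_fin, nsmul_eq_mul,
          ← ENNReal.ofReal_natCast, ← ENNReal.ofReal_mul (by positivity),
          ← ENNReal.ofReal_add (by positivity) hE0]
        congr 1
        ring

theorem aemeasurable_momentSum (hS : IsSample P₀ (response φ σ X ε) X P Ys Xs) {m : ℕ}
    (C : Matrix (Fin m) (Fin m) ℝ) (c : Fin m → ℝ) (v : ℝ) :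
    AEMeasurable (fun ω => momentSum ψ C c v (fun i => Ys i ω) fun i => Xs i ω) P := by
  unfold momentSum
  have h1 := fun i => aemeasurable_residual_sample hS i (lincomb ψ c)
  have h2 := fun i j => aemeasurable_inner_sample hS i (whiteVec ψ C j)
  fun_prop

theorem lintegral_momentSum_le (hG : GaussianDesign P₀ X ε)
    (hS : IsSample P₀ (response φ σ X ε) X P Ys Xs) (hΓ : covarianceOperator (P₀.map X) = T)
    (hn : 0 < n) {m : ℕ}
    {C : Matrix (Fin m) (Fin m) ℝ} (hC : IsUnit C.det) (hA : opMat ψ T m = Cᵀ * C)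
    (c : Fin m → ℝ) {v : ℝ} (hv0 : 0 < v)
    (hv : ⟪T (φ - lincomb ψ c), φ - lincomb ψ c⟫ + σ ^ 2 ≤ v) :
    ∫⁻ ω, ENNReal.ofReal (momentSum ψ C c v (fun i => Ys i ω) fun i => Xs i ω) ∂P ≤
      ENNReal.ofReal (12288 * (1 + m ^ 4)) := by
  have hn0 : (0 : ℝ) < n := by exact_mod_cast hn
  have m1 := fun i => aemeasurable_residual_sample hS i (lincomb ψ c)
  have m2 := fun i j => aemeasurable_inner_sample hS i (whiteVec ψ C j)
  have h1 : ∀ i, ∫⁻ ω, ENNReal.ofReal (((Ys i ω - ⟪lincomb ψ c, Xs i ω⟫) ^ 2 / v) ^ 4) ∂P ≤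
      ENNReal.ofReal 12288 := by
    intro i
    have := lintegral_pow_pairForm_le hG hS hΓ i 1 (-lincomb ψ c) hv0
      (by rwa [one_smul, ← sub_eq_add_neg, one_mul])
    simpa only [pairForm_one_neg_apply] using this
  have h2 : ∀ i j, ∫⁻ ω, ENNReal.ofReal ((⟪whiteVec ψ C j, Xs i ω⟫ ^ 2 / 1) ^ 4) ∂P ≤
      ENNReal.ofReal 12288 := by
    intro i j
    have := lintegral_pow_pairForm_le hG hS hΓ i 0 (whiteVec ψ C j) zero_lt_one
      (by rw [zero_smul, zero_add, zero_mul, form_whiteVec ψ hC hA, if_pos rfl]; norm_num)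
    simpa only [pairForm_zero_apply] using this
  have h3 : ∀ ω, ENNReal.ofReal (momentSum ψ C c v (fun i => Ys i ω) fun i => Xs i ω) =
      ENNReal.ofReal (n : ℝ)⁻¹ *
        ∑ i, ENNReal.ofReal (((Ys i ω - ⟪lincomb ψ c, Xs i ω⟫) ^ 2 / v) ^ 4) +
      ENNReal.ofReal ((m : ℝ) ^ 3 * (n : ℝ)⁻¹) *
        ∑ i, ∑ j, ENNReal.ofReal ((⟪whiteVec ψ C j, Xs i ω⟫ ^ 2 / 1) ^ 4) := by
    intro ω
    rw [momentSum, ENNReal.ofReal_add (by positivity) (by positivity),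
      ENNReal.ofReal_mul (by positivity), ENNReal.ofReal_sum_of_nonneg fun _ _ => by positivity,
      ← mul_assoc, ENNReal.ofReal_mul (by positivity),
      ENNReal.ofReal_sum_of_nonneg fun _ _ => by positivity]
    congr 2
    exact Finset.sum_congr rfl fun i _ => ENNReal.ofReal_sum_of_nonneg fun _ _ => by positivity
  rw [lintegral_congr h3, lintegral_add_left' (by fun_prop),
    lintegral_const_mul' _ _ ENNReal.ofReal_ne_top, lintegral_const_mul' _ _ ENNReal.ofReal_ne_top,
    lintegral_finsetSum' _ (by fun_prop), lintegral_finsetSum' _ (by fun_prop)]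
  have h4 : ∀ i, ∫⁻ ω, ∑ j, ENNReal.ofReal ((⟪whiteVec ψ C j, Xs i ω⟫ ^ 2 / 1) ^ 4) ∂P ≤
      ENNReal.ofReal (m * 12288) := by
    intro i
    rw [lintegral_finsetSum' _ (by fun_prop)]
    refine (Finset.sum_le_sum fun j _ => h2 i j).trans (le_of_eq ?_)
    rw [Finset.sum_const, Finset.card_univ, Fintype.card_fin, nsmul_eq_mul,
      ENNReal.ofReal_mul (by positivity), ENNReal.ofReal_natCast]
  calc _ ≤ ENNReal.ofReal (n : ℝ)⁻¹ * ∑ i : Fin n, ENNReal.ofReal 12288 +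
        ENNReal.ofReal ((m : ℝ) ^ 3 * (n : ℝ)⁻¹) * ∑ i : Fin n, ENNReal.ofReal (m * 12288) :=
        add_le_add (mul_le_mul_right (Finset.sum_le_sum fun i _ => h1 i) _)
          (mul_le_mul_right (Finset.sum_le_sum fun i _ => h4 i) _)
    _ = _ := by
        rw [Finset.sum_const, Finset.sum_const, Finset.card_univ, Fintype.card_fin, nsmul_eq_mul,
          nsmul_eq_mul, ← ENNReal.ofReal_natCast, ← ENNReal.ofReal_mul (by positivity),
          ← ENNReal.ofReal_mul (by positivity), ← ENNReal.ofReal_mul (by positivity),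
          ← ENNReal.ofReal_mul (by positivity),
          ← ENNReal.ofReal_add (by positivity) (by positivity)]
        congr 1
        field_simp

/-- The residuals are independent of the whitened coordinates by Galerkin orthogonality and joint
normality, so the exponential moment of a scaled χ² variable applies. -/
theorem lintegral_exp_residualSq_le (hG : GaussianDesign P₀ X ε)
    (hS : IsSample P₀ (response φ σ X ε) X P Ys Xs) (hΓ : covarianceOperator (P₀.map X) = T)
    (hn : 0 < n) {m : ℕ}
    {C : Matrix (Fin m) (Fin m) ℝ} (hC : IsUnit C.det) (hA : opMat ψ T m = Cᵀ * C)
    (c : Fin m → ℝ) (hc : ∀ u : Fin m → ℝ, ⟪lincomb ψ u, T (φ - lincomb ψ c)⟫ = 0)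
    {v : ℝ} (hv0 : 0 < v) :
    ∫⁻ ω, (if ∑ i, (Ys i ω - ⟪lincomb ψ c, Xs i ω⟫) ^ 2 ≤ 2 * n * v then
      ENNReal.ofReal (Real.exp (n / (8 * v) *
        residualSq ψ (fun i => Ys i ω) (fun i => Xs i ω) C c)) else 0) ∂P ≤
      ENNReal.ofReal (√2 ^ m) := by
  have hn0 : (0 : ℝ) < n := by exact_mod_cast hn
  set U : Fin n → Ω → ℝ := fun i ω => pairForm 1 (-lincomb ψ c) (Ys i ω, Xs i ω) with hU
  set Z : Fin n × Fin m → Ω → ℝ := fun p ω => pairForm 0 (whiteVec ψ C p.2) (Ys p.1 ω, Xs p.1 ω)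
    with hZ
  set L₁ : (Fin n → ℝ × H) →L[ℝ] (Fin n → ℝ) := ContinuousLinearMap.pi fun i =>
    (pairForm 1 (-lincomb ψ c)).comp (ContinuousLinearMap.proj i) with hL₁
  set L₂ : (Fin n → ℝ × H) →L[ℝ] (Fin n × Fin m → ℝ) := ContinuousLinearMap.pi fun p =>
    (pairForm 0 (whiteVec ψ C p.2)).comp (ContinuousLinearMap.proj p.1) with hL₂
  have hUZ : HasGaussianLaw (fun ω => (fun i => U i ω, fun p => Z p ω)) P :=
    sample_pairForm_hasGaussianLaw hG hS (L₁.prod L₂)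
  -- Within one observation the covariance is the Galerkin residual tested against a white vector;
  -- between observations it vanishes by independence.
  have hcovUZ : ∀ i p, cov[U i, Z p; P] = 0 := by
    intro i p
    rw [hU, hZ, sample_covariance_pairForm hG hS, hΓ]
    split_ifs
    · rw [one_smul, zero_smul, zero_add, zero_mul, mul_zero, add_zero, ← sub_eq_add_neg,
        real_inner_comm]
      exact hc _
    · rfl
  have hind := hUZ.indepFun_of_covariance_eval hcovUZ
  have hcovZ : ∀ p q, cov[Z p, Z q; P] = if p = q then 1 else 0 := by
    intro p q
    rw [hZ, sample_covariance_pairForm hG hS, hΓ]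
    simp only [zero_smul, zero_add, zero_mul, add_zero, form_whiteVec ψ hC hA, Prod.ext_iff]
    split_ifs <;> simp_all
  -- The product 2 c t is exactly 1/2 for these choices.
  have h1 := lintegral_exp_sum_sq_mix_le (c := 1 / (8 * v * n)) (t := 2 * n * v) hind
    (fun i => sample_aemeasurable_pairForm hS i _ _) hUZ.snd
    (fun p => sample_integral_pairForm hG hS _ _ _) hcovZ (by positivity)
    (le_of_eq (by field_simp; norm_num))
  refine le_trans (le_of_eq (lintegral_congr fun ω => ?_)) h1
  have h2 : (n : ℝ) / (8 * v) * residualSq ψ (fun i => Ys i ω) (fun i => Xs i ω) C c =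
      1 / (8 * v * n) * ∑ j, (∑ i, U i ω * Z (i, j) ω) ^ 2 := by
    simp only [residualSq, hU, hZ, pairForm_one_neg_apply, pairForm_zero_apply, mul_pow]
    rw [← Finset.mul_sum]
    field_simp
  rw [h2]
  simp only [hU, pairForm_one_neg_apply]

end Expectations

end FLR

namespace FLR

open Matrix
open scoped NNReal

/-! ### Identification of the population quantities -/

section Population

variable {H : Type*} [NormedAddCommGroup H] [InnerProductSpace ℝ H] [CompleteSpace H]
  [SecondCountableTopology H] [MeasurableSpace H] [BorelSpace H] (ψ : HilbertBasis ℕ ℝ H)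
  {Ω₀ : Type*} [MeasurableSpace Ω₀] {P₀ : Measure Ω₀} [IsProbabilityMeasure P₀]
  {X : Ω₀ → H} {ε : Ω₀ → ℝ} {T : H →L[ℝ] H}

theorem popG_response (hG : GaussianDesign P₀ X ε) (hΓ : covarianceOperator (P₀.map X) = T)
    (φ : H) (σ : ℝ) (j : ℕ) : popG ψ P₀ X (response φ σ X ε) j = ⟪ψ j, T φ⟫ := by
  have h := hG.integral_mul φ (ψ j) σ 0
  rw [hΓ, mul_zero, add_zero, real_inner_comm] at h
  rw [← h]
  refine integral_congr_ae (Filter.Eventually.of_forall fun ω => ?_)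
  simp only [response, zero_mul, add_zero, real_inner_comm (X ω) (ψ j)]

theorem integral_response_sq (hG : GaussianDesign P₀ X ε)
    (hΓ : covarianceOperator (P₀.map X) = T) (φ : H) (σ : ℝ) :
    ∫ ω, response φ σ X ε ω ^ 2 ∂P₀ = ⟪T φ, φ⟫ + σ ^ 2 := by
  have h := hG.integral_mul φ φ σ σ
  rw [hΓ, ← sq] at h
  rw [← h]
  refine integral_congr_ae (Filter.Eventually.of_forall fun ω => ?_)
  simp only [response, sq]

end Population

/-! ### The total excess and what its smallness implies -/

section Deterministic

variable {H : Type*} [NormedAddCommGroup H] [InnerProductSpace ℝ H] [CompleteSpace H]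
  (ψ : HilbertBasis ℕ ℝ H)
  {w b γ g : ℕ → ℝ} {d r σ : ℝ} {T : H →L[ℝ] H} {φ : H} {n : ℕ} {y : Fin n → ℝ} {x : Fin n → H}

/-- The coefficient vector of the Galerkin solution. -/
noncomputable def galerkinCoef (K : MatSeq) (g : ℕ → ℝ) (m : ℕ) : Fin m → ℝ :=
  (K m)⁻¹ *ᵥ headVec g m

theorem galerkin_eq_lincomb_galerkinCoef (K : MatSeq) (m : ℕ) :
    galerkin ψ K g m = lincomb ψ (galerkinCoef K g m) := rfl

/-- The variance of the residual `Y - ⟨φ^m, X⟩`. -/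
noncomputable def residualVar (T : H →L[ℝ] H) (φ : H) (σ : ℝ) (g : ℕ → ℝ) (m : ℕ) : ℝ :=
  ⟪T (φ - lincomb ψ (galerkinCoef (opMat ψ T) g m)),
    φ - lincomb ψ (galerkinCoef (opMat ψ T) g m)⟫ + σ ^ 2

theorem residualVar_pos (hT : T.IsPositive) (hσ : 0 < σ) (m : ℕ) :
    0 < residualVar ψ T φ σ g m := by
  have := hT.inner_nonneg_left (φ - lincomb ψ (galerkinCoef (opMat ψ T) g m))
  rw [residualVar]
  positivity

theorem headVec_form_nonneg (hT : T.IsPositive) (hpos : ∀ f : H, f ≠ 0 → 0 < ⟪T f, f⟫) (m : ℕ) :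
    0 ≤ headVec g m ⬝ᵥ (opMat ψ T m)⁻¹ *ᵥ headVec g m :=
  posSemidef_form_nonneg (posDef_opMat ψ hT hpos m).inv.posSemidef _

/-- E Y² is residual plus explained variance; in particular it dominates both. -/
theorem residualVar_add_form (hT : T.IsPositive) (hpos : ∀ f : H, f ≠ 0 → 0 < ⟪T f, f⟫)
    (hg : ∀ j, g j = ⟪ψ j, T φ⟫) (m : ℕ) :
    residualVar ψ T φ σ g m + headVec g m ⬝ᵥ (opMat ψ T m)⁻¹ *ᵥ headVec g m =
      ⟪T φ, φ⟫ + σ ^ 2 := by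
  rw [form_eq_add_galerkin ψ hT hpos hg m, residualVar, galerkin_eq_lincomb_galerkinCoef]
  ring

/-- The total excess over all dimensions up to `K`. -/
noncomputable def totalExcess (T : H →L[ℝ] H) (C : ∀ m, Matrix (Fin m) (Fin m) ℝ) (φ : H)
    (σ : ℝ) (g : ℕ → ℝ) (K : ℕ) (y : Fin n → ℝ) (x : Fin n → H) : ℝ :=
  chiExcess (1 / 2) (⟪T φ, φ⟫ + σ ^ 2) n (∑ i, y i ^ 2) + ∑ k ∈ Finset.Icc 1 K,
    dimExcess ψ T (C k) (galerkinCoef (opMat ψ T) g k) (residualVar ψ T φ σ g k) y x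

theorem totalExcess_nonneg (T : H →L[ℝ] H) (C : ∀ m, Matrix (Fin m) (Fin m) ℝ) (φ : H)
    (σ : ℝ) (g : ℕ → ℝ) (K : ℕ) (y : Fin n → ℝ) (x : Fin n → H) :
    0 ≤ totalExcess ψ T C φ σ g K y x :=
  add_nonneg (chiExcess_nonneg _ _ _ _) (Finset.sum_nonneg fun _ _ => dimExcess_nonneg ψ _ _ _ _ _ _)

theorem dimExcess_le_totalExcess (T : H →L[ℝ] H) (C : ∀ m, Matrix (Fin m) (Fin m) ℝ) (φ : H)
    (σ : ℝ) (g : ℕ → ℝ) {K k : ℕ} (hk : k ∈ Finset.Icc 1 K) (y : Fin n → ℝ) (x : Fin n → H) :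
    dimExcess ψ T (C k) (galerkinCoef (opMat ψ T) g k) (residualVar ψ T φ σ g k) y x ≤
      totalExcess ψ T C φ σ g K y x :=
  (Finset.single_le_sum (f := fun k => dimExcess ψ T (C k) (galerkinCoef (opMat ψ T) g k)
    (residualVar ψ T φ σ g k) y x) (fun _ _ => dimExcess_nonneg ψ _ _ _ _ _ _) hk).trans
    (le_add_of_nonneg_left (chiExcess_nonneg _ _ _ _))

theorem chiExcess_le_totalExcess (T : H →L[ℝ] H) (C : ∀ m, Matrix (Fin m) (Fin m) ℝ) (φ : H)
    (σ : ℝ) (g : ℕ → ℝ) (K : ℕ) (y : Fin n → ℝ) (x : Fin n → H) :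
    chiExcess (1 / 2) (⟪T φ, φ⟫ + σ ^ 2) n (∑ i, y i ^ 2) ≤ totalExcess ψ T C φ σ g K y x :=
  le_add_of_nonneg_right (Finset.sum_nonneg fun _ _ => dimExcess_nonneg ψ _ _ _ _ _ _)

theorem formClose_of_totalExcess_lt (hT : T ∈ opClass ψ γ d) (hσ : 0 < σ) (hn : 1 ≤ n)
    {C : ∀ m, Matrix (Fin m) (Fin m) ℝ} (hC : ∀ m, IsUnit (C m).det ∧ opMat ψ T m = (C m)ᵀ * C m)
    {K k : ℕ} (hk : k ∈ Finset.Icc 1 K) (h : totalExcess ψ T C φ σ g K y x < 1) :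
    FormClose (1 / 8) (opMat ψ T k) (empMat ψ x k) ∧
      (n : ℝ)⁻¹ * ∑ i, (y i - ⟪lincomb ψ (galerkinCoef (opMat ψ T) g k), x i⟫) ^ 2 ≤
        2 * residualVar ψ T φ σ g k :=
  formClose_of_dimExcess_lt ψ hT.2.1 (hC k).1 (hC k).2 (residualVar_pos ψ hT.1 hσ k) hn
    ((dimExcess_le_totalExcess ψ T C φ σ g hk y x).trans_lt h)

/-- If the total excess is small, the random penalties and dimension bounds are comparable to
the theoretical ones. -/
theorem good_event_of_totalExcess_lt (hR : RegularWeights w b γ) (hd : 1 ≤ d)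
    (hT : T ∈ opClass ψ γ d) (hg : ∀ j, g j = ⟪ψ j, T φ⟫) (hσ : 0 < σ) (hn : 1 ≤ n)
    {C : ∀ m, Matrix (Fin m) (Fin m) ℝ} (hC : ∀ m, IsUnit (C m).det ∧ opMat ψ T m = (C m)ᵀ * C m)
    (h : totalExcess ψ T C φ σ g (dimBound w n) y x < 1) :
    (∀ k ∈ Finset.Icc 1 (dimPlus w γ d n),
      penalty 96 w (⟪T φ, φ⟫ + σ ^ 2) (opMat ψ T) g n k ≤ hpen ψ y x 96 w k ∧
        hpen ψ y x 96 w k ≤ 72 * penalty 96 w (⟪T φ, φ⟫ + σ ^ 2) (opMat ψ T) g n k) ∧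
      dimMinus w γ d n ≤ hDim ψ x w ∧ hDim ψ x w ≤ dimPlus w γ d n := by
  have hclose : ∀ k ∈ Finset.Icc 1 (dimBound w n), FormClose (1 / 8) (opMat ψ T k) (empMat ψ x k) :=
    fun k hk => (formClose_of_totalExcess_lt ψ hT hσ hn hC hk h).1
  refine ⟨fun k hk => ?_, dimMinus_le_hDim ψ hR hd hT hclose, hDim_le_dimPlus ψ hR hd hT hclose⟩
  have hkK := (Finset.mem_Icc.1 hk).2.trans (dimCut_le_dimBound w n _)
  have hy2 : 0 < ⟪T φ, φ⟫ + σ ^ 2 := by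
    have := hT.1.inner_nonneg_left φ
    positivity
  refine pen_le_hpen_le ψ (fun j => (hR.w_pos j).le) hT.1 hT.2.1 (Finset.mem_Icc.1 hk).1
    (fun l hl => hclose l (Finset.mem_Icc.2 ⟨(Finset.mem_Icc.1 hl).1,
      (Finset.mem_Icc.1 hl).2.trans hkK⟩)) ?_ (headVec_form_nonneg ψ hT.1 hT.2.1 k) ?_
  · exact (abs_sub_le_or_one_le_chiExcess (by norm_num) hy2 hn _).resolve_right fun h1 =>
      absurd (h1.trans (chiExcess_le_totalExcess ψ T C φ σ g _ y x)) (not_le.2 h)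
  · rw [← residualVar_add_form ψ hT.1 hT.2.1 hg k]
    exact le_add_of_nonneg_left (residualVar_pos ψ hT.1 hσ k).le

/-- The squared `w`-norm of the Galerkin coefficients. -/
theorem sum_galerkinCoef_sq_le (hR : RegularWeights w b γ) (hd : 1 ≤ d) (hr : 0 ≤ r)
    (hT : T ∈ opClass ψ γ d) (hφ : φ ∈ ellipsoid ψ b r) (hg : ∀ j, g j = ⟪ψ j, T φ⟫) (m : ℕ) :
    ∑ j : Fin m, w j * galerkinCoef (opMat ψ T) g m j ^ 2 ≤ 4 * d ^ 2 * r := by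
  have h := wNormSq_galerkin_le ψ hR hd hr hT hφ hg m
  rw [galerkin_eq_lincomb_galerkinCoef, wNormSq_lincomb ψ fun j => (hR.w_pos j).le] at h
  exact (ENNReal.ofReal_le_ofReal_iff (by positivity)).1 h

theorem secondMoment_le (hR : RegularWeights w b γ) (hd : 1 ≤ d) (hr : 0 ≤ r)
    (hT : T ∈ opClass ψ γ d) (hφ : φ ∈ ellipsoid ψ b r) :
    ⟪T φ, φ⟫ + σ ^ 2 ≤ d * (σ ^ 2 + r) := by
  have := form_le_of_mem_ellipsoid ψ hR hd hr hT hφ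
  nlinarith [sq_nonneg σ]

end Deterministic

end FLR

namespace FLR

open Matrix
open scoped NNReal

/-! ### Pointwise error bounds on good and on bad data -/

section ErrorBounds

variable {H : Type*} [NormedAddCommGroup H] [InnerProductSpace ℝ H] [CompleteSpace H]
  (ψ : HilbertBasis ℕ ℝ H)
  {w b γ g : ℕ → ℝ} {d r σ : ℝ} {T : H →L[ℝ] H} {φ : H} {n : ℕ} {y : Fin n → ℝ} {x : Fin n → H}

/-- A bound for the estimation error that is used when the total excess `R` is large. -/
noncomputable def crudeBound {m : ℕ} (d r v : ℝ) (C : Matrix (Fin m) (Fin m) ℝ)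
    (c : Fin m → ℝ) (R : ℝ) (y : Fin n → ℝ) (x : Fin n → H) : ℝ :=
  d * v / n ^ 3 * momentSum ψ C c v y x + (d * v * n ^ 9 + 10 * d ^ 2 * r) * R

theorem momentSum_nonneg {m : ℕ} (C : Matrix (Fin m) (Fin m) ℝ) (c : Fin m → ℝ) (v : ℝ) :
    0 ≤ momentSum ψ C c v y x := by
  rw [momentSum]
  positivity

theorem crudeBound_ge {m : ℕ} (C : Matrix (Fin m) (Fin m) ℝ) (c : Fin m → ℝ) {v R : ℝ}
    (hd : 0 ≤ d) (hr : 0 ≤ r) (hv : 0 ≤ v) (hR : 1 ≤ R) :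
    10 * d ^ 2 * r ≤ crudeBound ψ d r v C c R y x := by
  have h1 := momentSum_nonneg ψ C c v (y := y) (x := x)
  have h2 : 0 ≤ d * v / n ^ 3 * momentSum ψ C c v y x := by positivity
  have h3 : 0 ≤ d * v * (n : ℝ) ^ 9 * R := by positivity
  have h4 : 10 * d ^ 2 * r * 1 ≤ 10 * d ^ 2 * r * R := by gcongr
  rw [crudeBound]
  linarith

theorem wNormSq_estimator_sub_le_crudeBound (hR : RegularWeights w b γ) (hd : 1 ≤ d) (hr : 0 ≤ r)
    (hT : T ∈ opClass ψ γ d) (hφ : φ ∈ ellipsoid ψ b r) (hg : ∀ j, g j = ⟪ψ j, T φ⟫)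
    (hn : 1 ≤ n) {k : ℕ} (hk : k ∈ Finset.Icc 1 (dimBound w n)) {C : Matrix (Fin k) (Fin k) ℝ}
    (hC : opMat ψ T k = Cᵀ * C) {v R : ℝ} (hv : 0 < v) (hR1 : 1 ≤ R) :
    (wNormSq ψ w (estimator ψ y x k - lincomb ψ (galerkinCoef (opMat ψ T) g k))).toReal ≤
      crudeBound ψ d r v C (galerkinCoef (opMat ψ T) g k) R y x := by
  have hn0 : (0 : ℝ) < n := by exact_mod_cast hn
  have hd0 : 0 < d := by linarith
  obtain ⟨-, -, hK⟩ := dimBound_spec (w := w) hR.w_one hn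
  set c := galerkinCoef (opMat ψ T) g k with hc
  have h1 := wNormSq_estimator_sub_le_crude ψ y x (fun j => (hR.w_pos j).le) (wm := n)
    (fun j => (le_wMax w (j.2.trans_le (Finset.mem_Icc.1 hk).2)).trans hK)
    (posDef_opMat ψ hT.1 hT.2.1 k) hC c (opMat_form_le ψ hR hd hT) hd0.le hn0.le
  have h2 := sum_galerkinCoef_sq_le ψ hR hd hr hT hφ hg k
  -- The crude bound carries n³, from the weights and the squared truncation level. N = n⁶ leaves
  -- n⁻³ on the moments and n⁹ on the excess.
  have h3 := residualSq_le_momentSum ψ C c hv hn y x (N := (n : ℝ) ^ 6) (by positivity)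
  have h4 : (n : ℝ) * n ^ 2 * d * residualSq ψ y x C c ≤
      d * v / n ^ 3 * momentSum ψ C c v y x + d * v * n ^ 9 := by
    calc _ ≤ (n : ℝ) * n ^ 2 * d * (v * (momentSum ψ C c v y x / n ^ 6 + n ^ 6)) := by gcongr
      _ = _ := by field_simp
  have h5 : d * v * (n : ℝ) ^ 9 * 1 ≤ d * v * (n : ℝ) ^ 9 * R := by gcongr
  have h6 : 10 * d ^ 2 * r * 1 ≤ 10 * d ^ 2 * r * R := by gcongr
  have h7 : 0 ≤ d ^ 2 * r := by positivity
  rw [crudeBound]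
  linarith

open Classical in
/-- A bound for the excess of the estimation error over a sixth of the penalty that is used when
the total excess is small. -/
noncomputable def mainBound {m : ℕ} (w : ℕ → ℝ) (K : MatSeq) (v : ℝ)
    (C : Matrix (Fin m) (Fin m) ℝ) (c : Fin m → ℝ) (y : Fin n → ℝ) (x : Fin n → H) : ℝ≥0∞ :=
  ENNReal.ofReal (11 * bigDelta w K m * v / n *
    Real.exp (-(3 * (m * logRatio (bigDelta w K m) m)))) *
  if ∑ i, (y i - ⟪lincomb ψ c, x i⟫) ^ 2 ≤ 2 * n * v then
    ENNReal.ofReal (Real.exp (n / (8 * v) * residualSq ψ y x C c)) else 0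

/-- 96 · 2 / 6 = 32, after dropping the nonnegative explained part. -/
theorem penalty_div_six_ge {y2 : ℝ} (hT : T.IsPositive)
    (hpos : ∀ f : H, f ≠ 0 → 0 < ⟪T f, f⟫) {k : ℕ} (hk : 1 ≤ k) (hn : 1 ≤ n) :
    32 * y2 * (k * bigDelta w (opMat ψ T) k * logRatio (bigDelta w (opMat ψ T) k) k) / n ≤
      penalty 96 w y2 (opMat ψ T) g n k / 6 := by
  have h1 := headVec_form_nonneg ψ hT hpos (g := g) k
  have h2 := smallDelta_nonneg w (opMat ψ T) hk
  have hn0 : (0 : ℝ) < n := by exact_mod_cast hn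
  rw [← smallDelta_eq, penalty, sigmaSq, div_div, div_le_div_iff₀ hn0 (by positivity)]
  have h3 : 0 ≤ (headVec g k ⬝ᵥ (opMat ψ T k)⁻¹ *ᵥ headVec g k) *
    smallDelta w (opMat ψ T) k * n := by positivity
  nlinarith

/-- Error and penalty are both multiples of D v / n. Their difference is linear in the exponent t of
the exponential moment, and u ≤ exp u turns it into something integrable. -/
theorem sub_penalty_le_mainBound (hR : RegularWeights w b γ)
    (hT : T ∈ opClass ψ γ d) (hg : ∀ j, g j = ⟪ψ j, T φ⟫) (hσ : 0 < σ) (hn : 1 ≤ n)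
    {C : ∀ m, Matrix (Fin m) (Fin m) ℝ} (hC : ∀ m, IsUnit (C m).det ∧ opMat ψ T m = (C m)ᵀ * C m)
    {K k : ℕ} (hk : k ∈ Finset.Icc 1 K) (h : totalExcess ψ T C φ σ g K y x < 1)
    (hbr : IsUnit (empMat ψ x k).det ∧ specNorm (empMat ψ x k)⁻¹ ≤ n) :
    ENNReal.ofReal ((wNormSq ψ w
      (estimator ψ y x k - lincomb ψ (galerkinCoef (opMat ψ T) g k))).toReal -
        penalty 96 w (⟪T φ, φ⟫ + σ ^ 2) (opMat ψ T) g n k / 6) ≤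
      mainBound ψ w (opMat ψ T) (⟪T φ, φ⟫ + σ ^ 2) (C k) (galerkinCoef (opMat ψ T) g k) y x := by
  have hn0 : (0 : ℝ) < n := by exact_mod_cast hn
  have hk1 := (Finset.mem_Icc.1 hk).1
  obtain ⟨hclose, hres⟩ := formClose_of_totalExcess_lt ψ hT hσ hn hC hk h
  have hpen := penalty_div_six_ge ψ (g := g) (w := w) (y2 := ⟪T φ, φ⟫ + σ ^ 2) hT.1 hT.2.1 hk1 hn
  have hq := residualVar_add_form ψ hT.1 hT.2.1 hg k (σ := σ)
  have hq0 := headVec_form_nonneg ψ hT.1 hT.2.1 (g := g) k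
  have hv0 := residualVar_pos ψ hT.1 hσ k (φ := φ) (g := g)
  have hQ := wNormSq_estimator_sub_le ψ y x (fun j => (hR.w_pos j).le)
    (posDef_opMat ψ hT.1 hT.2.1 k) (hC k).2 (galerkinCoef (opMat ψ T) g k) hclose.ge hbr
  set v := ⟪T φ, φ⟫ + σ ^ 2 with hv
  set c := galerkinCoef (opMat ψ T) g k with hc
  have hvpos : 0 < v := by linarith
  have hD0 := bigDelta_nonneg w (opMat ψ T) k
  have hL := one_le_logRatio (bigDelta w (opMat ψ T) k) hk1
  have hΔ := le_bigDelta w (opMat ψ T) (Finset.mem_Icc.2 ⟨hk1, le_refl k⟩)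
  set D := bigDelta w (opMat ψ T) k with hD
  set L := logRatio D k with hLd
  have hs : ∑ i, (y i - ⟪lincomb ψ c, x i⟫) ^ 2 ≤ 2 * n * v := by
    rw [inv_mul_le_iff₀ hn0] at hres
    nlinarith
  have hr0 : 0 ≤ residualSq ψ y x (C k) c := Finset.sum_nonneg fun _ _ => sq_nonneg _
  rw [mainBound, if_pos hs, ← ENNReal.ofReal_mul (by positivity)]
  refine ENNReal.ofReal_le_ofReal ?_
  set t := (n : ℝ) / (8 * v) * residualSq ψ y x (C k) c with ht
  have hres' : residualSq ψ y x (C k) c = 8 * v * t / n := by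
    rw [ht]; field_simp
  have hexp : t - 3 * (k * L) ≤ Real.exp (-(3 * (k * L))) * Real.exp t := by
    rw [← Real.exp_add]
    have := Real.add_one_le_exp (-(3 * (k * L)) + t)
    linarith
  have hkL : 0 ≤ (k : ℝ) * L := by positivity
  calc _ ≤ 64 / 49 * D * (8 * v * t / n) - 32 * v * (k * D * L) / n := by
        rw [← hres']
        refine sub_le_sub (hQ.trans ?_) hpen
        gcongr
    -- 32 · 49 / 512 = 3 + 1/16, so the penalty pays for the shift 3kL; the constant 11 below rounds
    -- up 512 / 49.
    _ = 512 / 49 * D * v / n * (t - 3 * (k * L) - (k * L) / 16) := by ring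
    _ ≤ 512 / 49 * D * v / n * (Real.exp (-(3 * (k * L))) * Real.exp t) := by
        gcongr
        linarith
    _ ≤ 11 * D * v / n * (Real.exp (-(3 * (k * L))) * Real.exp t) := by
        gcongr
        norm_num
    _ = _ := by ring

/-- Under a small total excess, the threshold of the estimator is not active for large `n`. -/
theorem le_exp_of_not_branch (hR : RegularWeights w b γ) (hd : 1 ≤ d)
    (hT : T ∈ opClass ψ γ d) (hn : 1 ≤ n) {k : ℕ} (hk : k ∈ Finset.Icc 1 (dimPlus w γ d n))
    (hclose : FormClose (1 / 8) (opMat ψ T k) (empMat ψ x k))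
    (hbr : ¬ (IsUnit (empMat ψ x k).det ∧ specNorm (empMat ψ x k)⁻¹ ≤ n)) :
    (n : ℝ) ≤ Real.exp (3 * d ^ 2) := by
  have hn1 : (1 : ℝ) ≤ n := by exact_mod_cast hn
  have hd2 : 1 ≤ d ^ 2 := one_le_pow₀ hd
  obtain ⟨hk1, hk2⟩ := Finset.mem_Icc.1 hk
  have hpd := hclose.posDef (posDef_opMat ψ hT.1 hT.2.1 k) (empMat_isHermitian ψ x)
  have hgt : (n : ℝ) < specNorm (empMat ψ x k)⁻¹ := by
    by_contra! hle
    exact hbr ⟨posDef_isUnit_det hpd, hle⟩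
  have hγ := hR.γ_pos (k - 1)
  have hlt := hgt.trans_le (specNorm_inv_le_of_formClose ψ hR hd hT hk1 (empMat_isHermitian ψ x)
    hclose)
  have hexp := Real.add_one_le_exp (3 * d ^ 2)
  -- The cut condition says nothing about dimension one, where γ_1 = 1 already bounds the inverse.
  rcases hk1.eq_or_lt with rfl | hk3
  · rw [Nat.sub_self, hR.γ_one, inv_one, mul_one] at hlt
    nlinarith
  · have hcut := le_of_le_dimCut hk3 hk2
    have hlog := Real.log_nonneg hn1
    have hwM : 1 ≤ wMax w k := by
      rw [← hR.w_one]
      exact le_wMax w (by omega)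
    have hk4 : (2 : ℝ) ≤ k := by exact_mod_cast hk3
    set G := (γ (k - 1))⁻¹ with hG
    have hG0 : 0 < G := by positivity
    have h1 : (4 * d * γ (k - 1))⁻¹ = G / (4 * d) := by
      rw [mul_inv, hG]; field_simp
    rw [h1] at hcut
    have h2 : 2 * 1 * (G / (4 * d)) ≤ n / (1 + Real.log n) :=
      le_trans (by gcongr) hcut
    have h3 : G ≤ 2 * d * (n / (1 + Real.log n)) := by
      have : 2 * 1 * (G / (4 * d)) = G / (2 * d) := by field_simp; norm_num
      rwa [this, div_le_iff₀' (by positivity)] at h2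
    have h4 : (n : ℝ) < 8 / 7 * d * (2 * d * (n / (1 + Real.log n))) :=
      hlt.trans_le (by gcongr)
    have h5 : 8 / 7 * d * (2 * d * (n / (1 + Real.log n))) =
        16 / 7 * d ^ 2 * n / (1 + Real.log n) := by ring
    rw [h5, lt_div_iff₀ (by positivity)] at h4
    -- The cut condition makes the norm of the inverse at most of order d² n / (1 + log n), which
    -- exceeds n only for n bounded in terms of d.
    have h6 : 1 + Real.log n < 16 / 7 * d ^ 2 := by
      by_contra! hle
      nlinarith
    rw [← Real.log_le_iff_le_exp (by positivity)]
    nlinarith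

/-- A pointwise bound for the excess of the estimation error over a sixth of the penalty. -/
theorem sub_penalty_le (hR : RegularWeights w b γ) (hd : 1 ≤ d) (hr : 0 ≤ r)
    (hT : T ∈ opClass ψ γ d) (hφ : φ ∈ ellipsoid ψ b r) (hg : ∀ j, g j = ⟪ψ j, T φ⟫)
    (hσ : 0 < σ) (hn : 1 ≤ n)
    {C : ∀ m, Matrix (Fin m) (Fin m) ℝ} (hC : ∀ m, IsUnit (C m).det ∧ opMat ψ T m = (C m)ᵀ * C m)
    {k : ℕ} (hk : k ∈ Finset.Icc 1 (dimPlus w γ d n)) :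
    ENNReal.ofReal (max ((wNormSq ψ w
      (estimator ψ y x k - lincomb ψ (galerkinCoef (opMat ψ T) g k))).toReal -
        penalty 96 w (⟪T φ, φ⟫ + σ ^ 2) (opMat ψ T) g n k / 6) 0) ≤
      mainBound ψ w (opMat ψ T) (⟪T φ, φ⟫ + σ ^ 2) (C k) (galerkinCoef (opMat ψ T) g k) y x +
      ENNReal.ofReal (crudeBound ψ d r (⟪T φ, φ⟫ + σ ^ 2) (C k) (galerkinCoef (opMat ψ T) g k)
        (totalExcess ψ T C φ σ g (dimBound w n) y x) y x) +
      ENNReal.ofReal (4 * d ^ 2 * r * (Real.exp (6 * d ^ 2) / n ^ 2)) := by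
  have hn0 : (0 : ℝ) < n := by exact_mod_cast hn
  have hkK : k ∈ Finset.Icc 1 (dimBound w n) := Finset.mem_Icc.2
    ⟨(Finset.mem_Icc.1 hk).1, (Finset.mem_Icc.1 hk).2.trans (dimCut_le_dimBound w n _)⟩
  have hv : 0 < ⟪T φ, φ⟫ + σ ^ 2 := by
    have := hT.1.inner_nonneg_left φ
    positivity
  have hpen0 : 0 ≤ penalty 96 w (⟪T φ, φ⟫ + σ ^ 2) (opMat ψ T) g n k / 6 := by
    refine le_trans ?_ (penalty_div_six_ge ψ (g := g) hT.1 hT.2.1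
      (Finset.mem_Icc.1 hk).1 hn)
    rw [← smallDelta_eq]
    have := smallDelta_nonneg w (opMat ψ T) (Finset.mem_Icc.1 hk).1
    positivity
  rw [ENNReal.ofReal_max, ENNReal.ofReal_zero, max_eq_left zero_le]
  rcases le_or_gt 1 (totalExcess ψ T C φ σ g (dimBound w n) y x) with h1 | h1
  · refine le_add_right (le_add_left (ENNReal.ofReal_le_ofReal ?_))
    have := wNormSq_estimator_sub_le_crudeBound ψ hR hd hr hT hφ hg hn hkK (hC k).2 hv h1
      (y := y) (x := x)
    linarith
  by_cases hbr : IsUnit (empMat ψ x k).det ∧ specNorm (empMat ψ x k)⁻¹ ≤ n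
  · exact le_add_right (le_add_right (sub_penalty_le_mainBound ψ hR hT hg hσ hn hC hkK h1 hbr))
  · refine le_add_left (ENNReal.ofReal_le_ofReal ?_)
    have hle := le_exp_of_not_branch ψ hR hd hT hn hk
      (formClose_of_totalExcess_lt ψ hT hσ hn hC hkK h1).1 hbr
    -- A truncated estimator is zero and its error bounded; as n is bounded too, a factor n⁻² is
    -- free, and it survives the sum over at most n dimensions.
    have hsq : 1 ≤ Real.exp (6 * d ^ 2) / (n : ℝ) ^ 2 := by
      rw [one_le_div (by positivity)]
      calc (n : ℝ) ^ 2 ≤ Real.exp (3 * d ^ 2) ^ 2 := by gcongr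
        _ = _ := by rw [← Real.exp_nat_mul]; congr 1; push_cast; ring
    have h2 := sum_galerkinCoef_sq_le ψ hR hd hr hT hφ hg k
    rw [wNormSq_estimator_sub_of_not ψ y x (fun j => (hR.w_pos j).le) _ hbr]
    have h3 : 4 * d ^ 2 * r * 1 ≤ 4 * d ^ 2 * r * (Real.exp (6 * d ^ 2) / (n : ℝ) ^ 2) := by
      gcongr
    linarith

/-- A pointwise bound for the total error when the total excess is large. -/
theorem wNormSq_estimator_sub_le_sum (hR : RegularWeights w b γ) (hd : 1 ≤ d) (hr : 0 ≤ r)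
    (hT : T ∈ opClass ψ γ d) (hφ : φ ∈ ellipsoid ψ b r) (hg : ∀ j, g j = ⟪ψ j, T φ⟫)
    (hn : 1 ≤ n) {C : ∀ m, Matrix (Fin m) (Fin m) ℝ} (hC : ∀ m, opMat ψ T m = (C m)ᵀ * C m)
    {k : ℕ} (hk : k ∈ Finset.Icc 1 (dimBound w n)) {v R : ℝ} (hv : 0 < v) (hR1 : 1 ≤ R) :
    wNormSq ψ w (estimator ψ y x k - φ) ≤ ∑ k ∈ Finset.Icc 1 (dimBound w n),
      4 * ENNReal.ofReal
        (crudeBound ψ d r v (C k) (galerkinCoef (opMat ψ T) g k) R y x) := by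
  -- The sum over all dimensions makes the bound independent of k, so k may be data-dependent.
  refine le_trans ?_ (Finset.single_le_sum (f := fun k => 4 * ENNReal.ofReal
        (crudeBound ψ d r v (C k) (galerkinCoef (opMat ψ T) g k) R y x))
        (fun _ _ => zero_le) hk)
  set c := galerkinCoef (opMat ψ T) g k with hc
  have h1 : estimator ψ y x k - φ =
      (estimator ψ y x k - lincomb ψ c) - (φ - lincomb ψ c) := by abel
  have h2 : wNormSq ψ w (φ - lincomb ψ c) ≤ ENNReal.ofReal (10 * d ^ 2 * r) := by
    have := wNormSq_galerkin_sub_le ψ hR hd hr hT hφ hg k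
    rw [galerkin_eq_lincomb_galerkinCoef, ← hc] at this
    refine le_trans (le_of_eq ?_) this
    simp only [wNormSq, ← neg_sub (lincomb ψ c) φ, inner_neg_right, neg_sq]
  have h3 := wNormSq_estimator_sub_le_crudeBound ψ hR hd hr hT hφ hg hn hk (hC k) hv hR1
    (y := y) (x := x)
  rw [← hc, ← ENNReal.le_ofReal_iff_toReal_le (wNormSq_estimator_sub_ne_top ψ y x
    (fun j => (hR.w_pos j).le) c) (by
      have := crudeBound_ge ψ (C k) c (by linarith : 0 ≤ d) hr hv.le hR1 (y := y) (x := x)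
      have : 0 ≤ 10 * d ^ 2 * r := by positivity
      linarith)] at h3
  rw [h1]
  calc _ ≤ _ := wNormSq_sub_le ψ (fun j => (hR.w_pos j).le) _ _
    _ ≤ 2 * ENNReal.ofReal (crudeBound ψ d r v (C k) c R y x) +
        2 * ENNReal.ofReal (crudeBound ψ d r v (C k) c R y x) := by
      gcongr
      exact h2.trans (ENNReal.ofReal_le_ofReal
        (crudeBound_ge ψ (C k) c (by linarith) hr hv.le hR1))
    _ = _ := by rw [← add_mul]; norm_num

end ErrorBounds

end FLR

namespace FLR

open Matrix
open scoped NNReal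

/-! ### Use of the constant Σ -/

section Series

variable {w γ : ℕ → ℝ} {d S : ℝ}

/-- The first summand γ_1 = 1 already gives this; it lets terms without Σ be absorbed into the final
bound. -/
theorem IsSigmaConst.one_le (h : IsSigmaConst w γ d S) (hγ : γ 0 = 1) : 1 ≤ S := by
  have h1 := (ENNReal.le_tsum (f := fun j => ENNReal.ofReal (γ j)) 0).trans h.1
  rw [hγ] at h1
  by_contra! hlt
  exact absurd h1 (not_le.2 ((ENNReal.ofReal_lt_ofReal_iff zero_lt_one).2 hlt))

theorem IsSigmaConst.sum_le (h : IsSigmaConst w γ d S) (M : ℕ) :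
    ∑ m ∈ Finset.Icc 1 M, ENNReal.ofReal (bigDelta w (diagMat γ) m *
      Real.exp (-(m * logRatio (bigDelta w (diagMat γ) m) m / (16 * (1 + Real.log d))))) ≤
      ENNReal.ofReal S := by
  refine le_trans ?_ h.2
  set f : ℕ → ℝ≥0∞ := fun m => ENNReal.ofReal (bigDelta w (diagMat γ) m *
      Real.exp (-((m : ℝ) * Real.log (max (bigDelta w (diagMat γ) m) ((m : ℝ) + 2)) /
        (16 * (1 + Real.log d) * Real.log ((m : ℝ) + 2))))) with hf
  have h1 : ∑' m : {m : ℕ // 1 ≤ m}, f m = ∑' m, {m : ℕ | 1 ≤ m}.indicator f m :=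
    tsum_subtype {m : ℕ | 1 ≤ m} f
  rw [h1]
  refine le_trans (Finset.sum_le_sum fun m hm => le_of_eq ?_) (ENNReal.sum_le_tsum (Finset.Icc 1 M))
  rw [Set.indicator_of_mem (show m ∈ {m : ℕ | 1 ≤ m} from (Finset.mem_Icc.1 hm).1), hf]
  simp only
  congr 4
  rw [logRatio, ← mul_div_assoc, div_div, mul_comm (Real.log ((m : ℝ) + 2))]

end Series

/-- The constant in the polynomial bound for the expected total excess. -/
noncomputable def decayConst : ℝ := 8 * (1024 ^ 24 * (Nat.factorial 24 : ℝ))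

theorem decayConst_pos : 0 < decayConst := by
  rw [decayConst]
  positivity

/-- The Taylor term of order 24 yields n⁻¹² and one power is lost to 8n. The remaining n⁻¹¹ beats
the n⁹ of the crude bound and leaves n⁻². -/
theorem exp_neg_sqrt_le {n : ℕ} (hn : 1 ≤ n) :
    8 * n * Real.exp (-(√n / 1024)) ≤ decayConst / n ^ 11 := by
  have hn0 : (0 : ℝ) < n := by exact_mod_cast hn
  have h1 := Real.pow_div_factorial_le_exp (√n / 1024) (by positivity) 24
  have h2 : (√n / 1024) ^ 24 = (n : ℝ) ^ 12 / 1024 ^ 24 := by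
    rw [div_pow, show 24 = 2 * 12 from rfl, pow_mul √(n : ℝ), Real.sq_sqrt hn0.le]
  rw [h2, div_div] at h1
  have h3 : Real.exp (-(√n / 1024)) ≤ 1024 ^ 24 * (Nat.factorial 24 : ℝ) / n ^ 12 := by
    rw [Real.exp_neg, inv_le_comm₀ (Real.exp_pos _) (by positivity), inv_div]
    exact h1
  calc 8 * n * Real.exp (-(√n / 1024))
      ≤ 8 * n * (1024 ^ 24 * (Nat.factorial 24 : ℝ) / n ^ 12) := by gcongr
    _ = decayConst / n ^ 11 := by
      rw [decayConst, pow_succ (n : ℝ) 11]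
      field_simp

/-! ### Integrated bounds and summation over dimensions -/

section Expectations

variable {H : Type*} [NormedAddCommGroup H] [InnerProductSpace ℝ H] [CompleteSpace H]
  [SecondCountableTopology H] [MeasurableSpace H] [BorelSpace H] (ψ : HilbertBasis ℕ ℝ H)
  {Ω₀ : Type*} [MeasurableSpace Ω₀] {P₀ : Measure Ω₀} [IsProbabilityMeasure P₀]
  {X : Ω₀ → H} {ε : Ω₀ → ℝ} {φ : H} {σ : ℝ}
  {Ω : Type*} [MeasurableSpace Ω] {P : Measure Ω} [IsProbabilityMeasure P]
  {n : ℕ} {Ys : Fin n → Ω → ℝ} {Xs : Fin n → Ω → H} {T : H →L[ℝ] H}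
  {w b γ g : ℕ → ℝ} {d r S : ℝ}

theorem aemeasurable_response_sample (hS : IsSample P₀ (response φ σ X ε) X P Ys Xs) (i : Fin n) :
    AEMeasurable (Ys i) P :=
  (hS.copies i).aemeasurable_fst.fst

theorem aemeasurable_totalExcess (hS : IsSample P₀ (response φ σ X ε) X P Ys Xs)
    (C : ∀ m, Matrix (Fin m) (Fin m) ℝ) (K : ℕ) :
    AEMeasurable (fun ω => totalExcess ψ T C φ σ g K (fun i => Ys i ω) fun i => Xs i ω) P := by
  unfold totalExcess
  have := aemeasurable_response_sample hS
  refine AEMeasurable.add ?_ (Finset.aemeasurable_fun_sum _ fun k _ =>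
    aemeasurable_dimExcess ψ hS _ _ _)
  exact (measurable_chiExcess _ _ _).comp_aemeasurable (by fun_prop)

theorem lintegral_totalExcess_le (hG : GaussianDesign P₀ X ε)
    (hS : IsSample P₀ (response φ σ X ε) X P Ys Xs) (hΓ : covarianceOperator (P₀.map X) = T)
    (hT : T.IsPositive) (hpos : ∀ f : H, f ≠ 0 → 0 < ⟪T f, f⟫) (hσ : 0 < σ) (hn : 1 ≤ n)
    (C : ∀ m, Matrix (Fin m) (Fin m) ℝ) {K : ℕ} (hK1 : 1 ≤ K) (hK : K ^ 4 ≤ n) :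
    ∫⁻ ω, ENNReal.ofReal (totalExcess ψ T C φ σ g K (fun i => Ys i ω) fun i => Xs i ω) ∂P ≤
      ENNReal.ofReal (decayConst / n ^ 11) := by
  have hn1 : (1 : ℝ) ≤ n := by exact_mod_cast hn
  have hK4 : (K : ℝ) ^ 4 ≤ n := by exact_mod_cast hK
  have hK1' : (1 : ℝ) ≤ K := by exact_mod_cast hK1
  have hsn : √(n : ℝ) ^ 2 = n := Real.sq_sqrt (by linarith)
  have hsn1 : 1 ≤ √(n : ℝ) := Real.one_le_sqrt.2 hn1
  -- K ≤ n^{1/4} gives n / k² ≥ √n, whence a rate that is uniform in the dimension.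
  have hK2 : (K : ℝ) ^ 2 ≤ √n := Real.le_sqrt_of_sq_le (by rw [← pow_mul]; exact hK4)
  set E := Real.exp (-(√n / 1024)) with hE
  have hE0 : 0 < E := Real.exp_pos _
  have h1 : ∀ k ∈ Finset.Icc 1 K, ∫⁻ ω, ENNReal.ofReal (dimExcess ψ T (C k)
      (galerkinCoef (opMat ψ T) g k) (residualVar ψ T φ σ g k) (fun i => Ys i ω)
      fun i => Xs i ω) ∂P ≤ ENNReal.ofReal (6 * K ^ 2 * E) := by
    intro k hk
    obtain ⟨hk1, hkK⟩ := Finset.mem_Icc.1 hk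
    have hk1' : (1 : ℝ) ≤ k := by exact_mod_cast hk1
    have hkK' : (k : ℝ) ≤ K := by exact_mod_cast hkK
    have hk2 : (k : ℝ) ^ 2 ≤ K ^ 2 := by gcongr
    refine (lintegral_dimExcess_le ψ hG hS hΓ hpos hk1 (C k) _ rfl
      (residualVar_pos ψ hT hσ k)).trans (ENNReal.ofReal_le_ofReal ?_)
    have h2 : Real.exp (-((n : ℝ) / (1024 * k ^ 2))) ≤ E := by
      refine Real.exp_le_exp.2 (neg_le_neg ?_)
      rw [div_le_div_iff₀ (by norm_num) (by positivity)]
      nlinarith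
    calc _ ≤ (2 * (K : ℝ) ^ 2 + K ^ 2) * (2 * E) := by
          gcongr
          nlinarith
      _ = _ := by ring
  have h2 : ∫⁻ ω, ENNReal.ofReal (chiExcess (1 / 2) (⟪T φ, φ⟫ + σ ^ 2) n (∑ i, Ys i ω ^ 2)) ∂P ≤
      ENNReal.ofReal (2 * E) := by
    have h3 := lintegral_chiExcess_pairForm_le (n := n) hG hS hΓ 1 0 (v := ⟪T φ, φ⟫ + σ ^ 2)
      (by rw [one_smul, add_zero, one_mul])
      (by have := hT.inner_nonneg_left φ; positivity) (by norm_num : (0 : ℝ) ≤ 1 / 2) (by norm_num)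
    simp only [pairForm_apply, inner_zero_left, one_mul, add_zero] at h3
    refine h3.trans (ENNReal.ofReal_le_ofReal ?_)
    refine mul_le_mul_of_nonneg_left (Real.exp_le_exp.2 (neg_le_neg ?_)) zero_le_two
    nlinarith
  have hm := fun k => (aemeasurable_dimExcess ψ (T := T) hS (C k) (galerkinCoef (opMat ψ T) g k)
    (residualVar ψ T φ σ g k)).ennreal_ofReal
  have h3 : ∀ ω, ENNReal.ofReal (totalExcess ψ T C φ σ g K (fun i => Ys i ω) fun i => Xs i ω) =
      ENNReal.ofReal (chiExcess (1 / 2) (⟪T φ, φ⟫ + σ ^ 2) n (∑ i, Ys i ω ^ 2)) +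
      ∑ k ∈ Finset.Icc 1 K, ENNReal.ofReal (dimExcess ψ T (C k)
        (galerkinCoef (opMat ψ T) g k) (residualVar ψ T φ σ g k) (fun i => Ys i ω)
        fun i => Xs i ω) := by
    intro ω
    rw [totalExcess, ENNReal.ofReal_add (chiExcess_nonneg _ _ _ _)
      (Finset.sum_nonneg fun _ _ => dimExcess_nonneg ψ _ _ _ _ _ _),
      ENNReal.ofReal_sum_of_nonneg fun _ _ => dimExcess_nonneg ψ _ _ _ _ _ _]
  rw [lintegral_congr h3, lintegral_add_right' _ (Finset.aemeasurable_fun_sum _ fun k _ => hm k),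
    lintegral_finsetSum' _ fun k _ => hm k]
  calc _ ≤ ENNReal.ofReal (2 * E) + ∑ k ∈ Finset.Icc 1 K, ENNReal.ofReal (6 * K ^ 2 * E) :=
        add_le_add h2 (Finset.sum_le_sum h1)
    _ = ENNReal.ofReal (2 * E + K * (6 * K ^ 2 * E)) := by
        rw [Finset.sum_const, Nat.card_Icc, Nat.add_sub_cancel, nsmul_eq_mul,
          ← ENNReal.ofReal_natCast, ← ENNReal.ofReal_mul (by positivity),
          ← ENNReal.ofReal_add (by positivity) (by positivity)]
    _ ≤ ENNReal.ofReal (decayConst / n ^ 11) := by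
        refine ENNReal.ofReal_le_ofReal (le_trans ?_ (exp_neg_sqrt_le hn))
        have h4 : (K : ℝ) ^ 3 ≤ n := le_trans (pow_le_pow_right₀ hK1' (by norm_num)) hK4
        rw [← hE]
        nlinarith

theorem aemeasurable_crudeBound (hS : IsSample P₀ (response φ σ X ε) X P Ys Xs) {m : ℕ} (v : ℝ)
    (C : Matrix (Fin m) (Fin m) ℝ) (c : Fin m → ℝ) {R : Ω → ℝ} (hR : AEMeasurable R P) :
    AEMeasurable (fun ω => crudeBound ψ d r v C c (R ω) (fun i => Ys i ω) fun i => Xs i ω) P := by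
  unfold crudeBound
  exact ((aemeasurable_momentSum ψ hS C c v).const_mul _).add (hR.const_mul _)

theorem lintegral_crudeBound_le (hd : 1 ≤ d) (hr : 0 ≤ r) (hG : GaussianDesign P₀ X ε)
    (hS : IsSample P₀ (response φ σ X ε) X P Ys Xs) (hΓ : covarianceOperator (P₀.map X) = T)
    (hn : 1 ≤ n) {m : ℕ} (hm : m ^ 4 ≤ n)
    {C : Matrix (Fin m) (Fin m) ℝ} (hC : IsUnit C.det) (hA : opMat ψ T m = Cᵀ * C)
    (c : Fin m → ℝ) {v : ℝ} (hv0 : 0 < v)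
    (hv : ⟪T (φ - lincomb ψ c), φ - lincomb ψ c⟫ + σ ^ 2 ≤ v) {R : Ω → ℝ}
    (hR : AEMeasurable R P) (hR0 : ∀ ω, 0 ≤ R ω)
    (hRint : ∫⁻ ω, ENNReal.ofReal (R ω) ∂P ≤ ENNReal.ofReal (decayConst / n ^ 11)) :
    ∫⁻ ω, ENNReal.ofReal (crudeBound ψ d r v C c (R ω) (fun i => Ys i ω) fun i => Xs i ω) ∂P ≤
      ENNReal.ofReal (((24576 + decayConst) * d * v + 10 * decayConst * d ^ 2 * r) / n ^ 2) := by
  have hn1 : (1 : ℝ) ≤ n := by exact_mod_cast hn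
  have hn0 : (0 : ℝ) < n := by linarith
  have hd0 : 0 < d := by linarith
  have hm4 : (m : ℝ) ^ 4 ≤ n := by exact_mod_cast hm
  have hC0 := decayConst_pos
  have h1 : ∀ ω, ENNReal.ofReal (crudeBound ψ d r v C c (R ω) (fun i => Ys i ω) fun i => Xs i ω) =
      ENNReal.ofReal (d * v / n ^ 3) *
        ENNReal.ofReal (momentSum ψ C c v (fun i => Ys i ω) fun i => Xs i ω) +
      ENNReal.ofReal (d * v * n ^ 9 + 10 * d ^ 2 * r) * ENNReal.ofReal (R ω) := by
    intro ω
    have := momentSum_nonneg ψ C c v (y := fun i => Ys i ω) (x := fun i => Xs i ω)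
    rw [crudeBound, ENNReal.ofReal_add (by positivity) (mul_nonneg (by positivity) (hR0 ω)),
      ENNReal.ofReal_mul (by positivity), ENNReal.ofReal_mul (by positivity)]
  rw [lintegral_congr h1, lintegral_add_right' _ (hR.ennreal_ofReal.const_mul _),
    lintegral_const_mul' _ _ ENNReal.ofReal_ne_top, lintegral_const_mul' _ _ ENNReal.ofReal_ne_top]
  calc _ ≤ ENNReal.ofReal (d * v / n ^ 3) * ENNReal.ofReal (12288 * (1 + m ^ 4)) +
        ENNReal.ofReal (d * v * n ^ 9 + 10 * d ^ 2 * r) * ENNReal.ofReal (decayConst / n ^ 11) := by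
        gcongr
        exact lintegral_momentSum_le ψ hG hS hΓ hn hC hA c hv0 hv
    _ = ENNReal.ofReal (d * v / n ^ 3 * (12288 * (1 + m ^ 4)) +
        (d * v * n ^ 9 + 10 * d ^ 2 * r) * (decayConst / n ^ 11)) := by
        rw [← ENNReal.ofReal_mul (by positivity), ← ENNReal.ofReal_mul (by positivity),
          ← ENNReal.ofReal_add (by positivity) (by positivity)]
    _ ≤ _ := by
        refine ENNReal.ofReal_le_ofReal ?_
        have h2 : d * v / n ^ 3 * (12288 * (1 + m ^ 4)) ≤ 24576 * d * v / (n : ℝ) ^ 2 := by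
          calc _ ≤ d * v / n ^ 3 * (12288 * (n + n)) := by gcongr
            _ = _ := by field_simp; ring
        have h3 : 10 * d ^ 2 * r * (decayConst / (n : ℝ) ^ 11) ≤
            10 * d ^ 2 * r * (decayConst / (n : ℝ) ^ 2) := by
          have := pow_le_pow_right₀ hn1 (by norm_num : 2 ≤ 11)
          gcongr
        have h4 : d * v * (n : ℝ) ^ 9 * (decayConst / n ^ 11) = decayConst * d * v / n ^ 2 := by
          field_simp
        calc _ ≤ 24576 * d * v / (n : ℝ) ^ 2 + (decayConst * d * v / n ^ 2 +
              10 * d ^ 2 * r * (decayConst / (n : ℝ) ^ 2)) := by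
              rw [add_mul, h4]
              gcongr
          _ = _ := by ring

theorem aemeasurable_mainBound (hS : IsSample P₀ (response φ σ X ε) X P Ys Xs) {m : ℕ}
    (K : MatSeq) (v : ℝ) (C : Matrix (Fin m) (Fin m) ℝ) (c : Fin m → ℝ) :
    AEMeasurable (fun ω => mainBound ψ w K v C c (fun i => Ys i ω) fun i => Xs i ω) P := by
  have h1 := fun i => aemeasurable_residual_sample hS i (lincomb ψ c)
  have h2 := fun i j => aemeasurable_inner_sample hS i (whiteVec ψ C j)
  have h3 : AEMeasurable (fun ω => ∑ i, (Ys i ω - ⟪lincomb ψ c, Xs i ω⟫) ^ 2) P := by fun_prop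
  have h4 : AEMeasurable (fun ω => residualSq ψ (fun i => Ys i ω) (fun i => Xs i ω) C c) P := by
    unfold residualSq
    fun_prop
  have h5 : Measurable fun p : ℝ × ℝ => if p.1 ≤ 2 * n * v then
      ENNReal.ofReal (Real.exp (n / (8 * v) * p.2)) else 0 :=
    Measurable.ite (measurableSet_le measurable_fst measurable_const) (by fun_prop)
      measurable_const
  unfold mainBound
  exact (h5.comp_aemeasurable (h3.prodMk h4)).const_mul _

theorem lintegral_mainBound_le (hG : GaussianDesign P₀ X ε)
    (hS : IsSample P₀ (response φ σ X ε) X P Ys Xs) (hΓ : covarianceOperator (P₀.map X) = T)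
    (hn : 1 ≤ n) {m : ℕ} (hm : 1 ≤ m)
    {C : Matrix (Fin m) (Fin m) ℝ} (hC : IsUnit C.det) (hA : opMat ψ T m = Cᵀ * C)
    (c : Fin m → ℝ) (hc : ∀ u : Fin m → ℝ, ⟪lincomb ψ u, T (φ - lincomb ψ c)⟫ = 0)
    {v : ℝ} (hv0 : 0 < v) :
    ∫⁻ ω, mainBound ψ w (opMat ψ T) v C c (fun i => Ys i ω) (fun i => Xs i ω) ∂P ≤
      ENNReal.ofReal (11 * v / n * (bigDelta w (opMat ψ T) m *
        Real.exp (-(2 * (m * logRatio (bigDelta w (opMat ψ T) m) m))))) := by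
  unfold mainBound
  have hD0 := bigDelta_nonneg w (opMat ψ T) m
  have hL := one_le_logRatio (bigDelta w (opMat ψ T) m) hm
  rw [lintegral_const_mul' _ _ ENNReal.ofReal_ne_top]
  refine (mul_le_mul_right (lintegral_exp_residualSq_le ψ hG hS hΓ hn hC hA c hc hv0) _).trans ?_
  rw [← ENNReal.ofReal_mul (by positivity)]
  refine ENNReal.ofReal_le_ofReal ?_
  set L := logRatio (bigDelta w (opMat ψ T) m) m
  -- The exponential moment uses up one of the three copies of mL; two remain for summability.
  have h1 : √(2 : ℝ) ^ m ≤ Real.exp (m * L) := by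
    have h2 : √(2 : ℝ) ≤ Real.exp 1 := by
      rw [Real.sqrt_le_left (Real.exp_pos _).le]
      nlinarith [Real.add_one_le_exp (1 : ℝ)]
    calc √(2 : ℝ) ^ m ≤ Real.exp 1 ^ m := by gcongr
      _ = Real.exp (m * 1) := by rw [← Real.exp_nat_mul]
      _ ≤ _ := Real.exp_le_exp.2 (mul_le_mul_of_nonneg_left hL (Nat.cast_nonneg m))
  calc _ ≤ 11 * bigDelta w (opMat ψ T) m * v / n * Real.exp (-(3 * (m * L))) *
        Real.exp (m * L) := by gcongr
    _ = 11 * v / n * (bigDelta w (opMat ψ T) m *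
        (Real.exp (-(3 * (m * L))) * Real.exp (m * L))) := by ring
    _ = _ := by
        rw [← Real.exp_add]
        congr 4
        ring

/-- Replacing Γ by γ costs d in front and 1 + log d in the exponent. The series defining Σ has the
divisor 1 + log d, and 16 is more than needed. -/
theorem bigDelta_mul_exp_le (hR : RegularWeights w b γ) (hd : 1 ≤ d) (hT : T ∈ opClass ψ γ d)
    {m : ℕ} (hm : 1 ≤ m) :
    bigDelta w (opMat ψ T) m * Real.exp (-(2 * (m * logRatio (bigDelta w (opMat ψ T) m) m))) ≤
      d * (bigDelta w (diagMat γ) m *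
        Real.exp (-(m * logRatio (bigDelta w (diagMat γ) m) m / (16 * (1 + Real.log d))))) := by
  obtain ⟨h1, h2⟩ := bigDelta_opMat_le ψ hR hd hT m
  have h3 := logRatio_le_mul hd h2 hm
  have hL := one_le_logRatio (bigDelta w (opMat ψ T) m) hm
  have hD := bigDelta_nonneg w (diagMat γ) m
  have hlog := Real.log_nonneg hd
  rw [← mul_assoc d]
  refine mul_le_mul h1 (Real.exp_le_exp.2 (neg_le_neg ?_)) (Real.exp_pos _).le
    (mul_nonneg (by linarith) hD)
  rw [div_le_iff₀ (by positivity)]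
  have hm0 : (0 : ℝ) ≤ m := Nat.cast_nonneg m
  have h4 := mul_le_mul_of_nonneg_left h3 hm0
  have h5 : 0 ≤ (m : ℝ) * ((1 + Real.log d) * logRatio (bigDelta w (opMat ψ T) m) m) := by
    positivity
  linarith

theorem sum_lintegral_mainBound_le (hR : RegularWeights w b γ) (hd : 1 ≤ d)
    (hT : T ∈ opClass ψ γ d) (hSig : IsSigmaConst w γ d S)
    (hg : ∀ j, g j = ⟪ψ j, T φ⟫) (hG : GaussianDesign P₀ X ε)
    (hS : IsSample P₀ (response φ σ X ε) X P Ys Xs) (hΓ : covarianceOperator (P₀.map X) = T)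
    (hn : 1 ≤ n)
    {C : ∀ m, Matrix (Fin m) (Fin m) ℝ} (hC : ∀ m, IsUnit (C m).det ∧ opMat ψ T m = (C m)ᵀ * C m)
    {v : ℝ} (hv : 0 < v) (K : ℕ) :
    ∑ k ∈ Finset.Icc 1 K, ∫⁻ ω, mainBound ψ w (opMat ψ T) v (C k)
      (galerkinCoef (opMat ψ T) g k) (fun i => Ys i ω) (fun i => Xs i ω) ∂P ≤
      ENNReal.ofReal (11 * v / n * d * S) := by
  have hd0 : 0 < d := by linarith
  rw [ENNReal.ofReal_mul (by positivity)]
  refine le_trans ?_ (mul_le_mul_right (hSig.sum_le K) _)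
  rw [Finset.mul_sum]
  refine Finset.sum_le_sum fun k hk => ?_
  have hk1 := (Finset.mem_Icc.1 hk).1
  refine (lintegral_mainBound_le ψ hG hS hΓ hn hk1 (hC k).1 (hC k).2 _
    (inner_galerkin_residual ψ hT.1 hT.2.1 hg k) hv).trans ?_
  rw [← ENNReal.ofReal_mul (by positivity)]
  refine ENNReal.ofReal_le_ofReal ?_
  rw [mul_assoc _ d]
  exact mul_le_mul_of_nonneg_left (bigDelta_mul_exp_le ψ hR hd hT hk1) (by positivity)

theorem sum_lintegral_crudeBound_le (hd : 1 ≤ d) (hr : 0 ≤ r)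
    (hT : T ∈ opClass ψ γ d) (hg : ∀ j, g j = ⟪ψ j, T φ⟫) (hσ : 0 < σ)
    (hG : GaussianDesign P₀ X ε)
    (hS : IsSample P₀ (response φ σ X ε) X P Ys Xs) (hΓ : covarianceOperator (P₀.map X) = T)
    (hn : 1 ≤ n)
    {C : ∀ m, Matrix (Fin m) (Fin m) ℝ} (hC : ∀ m, IsUnit (C m).det ∧ opMat ψ T m = (C m)ᵀ * C m)
    {K : ℕ} (hK1 : 1 ≤ K) (hK : K ^ 4 ≤ n) :
    ∑ k ∈ Finset.Icc 1 K, ∫⁻ ω, ENNReal.ofReal (crudeBound ψ d r (⟪T φ, φ⟫ + σ ^ 2) (C k)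
      (galerkinCoef (opMat ψ T) g k)
      (totalExcess ψ T C φ σ g K (fun i => Ys i ω) fun i => Xs i ω)
      (fun i => Ys i ω) fun i => Xs i ω) ∂P ≤
      ENNReal.ofReal (((24576 + decayConst) * d * (⟪T φ, φ⟫ + σ ^ 2) +
        10 * decayConst * d ^ 2 * r) / n) := by
  have hd0 : 0 < d := by linarith
  have hn0 : (0 : ℝ) < n := by exact_mod_cast hn
  have hC0 := decayConst_pos
  have hv : 0 < ⟪T φ, φ⟫ + σ ^ 2 := by
    have := hT.1.inner_nonneg_left φ
    positivity
  have hKn : (K : ℝ) ≤ n := by exact_mod_cast (Nat.le_self_pow (by norm_num) K).trans hK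
  calc _ ≤ ∑ k ∈ Finset.Icc 1 K, ENNReal.ofReal (((24576 + decayConst) * d *
        (⟪T φ, φ⟫ + σ ^ 2) + 10 * decayConst * d ^ 2 * r) / n ^ 2) := by
        refine Finset.sum_le_sum fun k hk => ?_
        refine lintegral_crudeBound_le ψ hd hr hG hS hΓ hn
          ((Nat.pow_le_pow_left (Finset.mem_Icc.1 hk).2 4).trans hK) (hC k).1 (hC k).2 _ hv ?_
          (aemeasurable_totalExcess ψ hS C K) (fun ω => totalExcess_nonneg ψ _ _ _ _ _ _ _ _)
          (lintegral_totalExcess_le ψ hG hS hΓ hT.1 hT.2.1 hσ hn C hK1 hK)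
        rw [← residualVar_add_form ψ hT.1 hT.2.1 hg k, ← residualVar]
        exact le_add_of_nonneg_right (headVec_form_nonneg ψ hT.1 hT.2.1 k)
    _ = ENNReal.ofReal (K * (((24576 + decayConst) * d *
        (⟪T φ, φ⟫ + σ ^ 2) + 10 * decayConst * d ^ 2 * r) / n ^ 2)) := by
        rw [Finset.sum_const, Nat.card_Icc, Nat.add_sub_cancel, nsmul_eq_mul,
          ← ENNReal.ofReal_natCast, ← ENNReal.ofReal_mul (by positivity)]
    _ ≤ _ := by
        refine ENNReal.ofReal_le_ofReal ?_
        calc _ ≤ n * (((24576 + decayConst) * d *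
            (⟪T φ, φ⟫ + σ ^ 2) + 10 * decayConst * d ^ 2 * r) / n ^ 2) := by gcongr
          _ = _ := by field_simp

end Expectations

end FLR

namespace FLR

/-! ### The two bounds -/

section Main

open Matrix

variable {H : Type*} [NormedAddCommGroup H] [InnerProductSpace ℝ H] [CompleteSpace H]
  [SecondCountableTopology H] [MeasurableSpace H] [BorelSpace H] (ψ : HilbertBasis ℕ ℝ H)
  {Ω₀ : Type*} [MeasurableSpace Ω₀] {P₀ : Measure Ω₀} [IsProbabilityMeasure P₀]
  {X : Ω₀ → H} {ε : Ω₀ → ℝ} {φ : H} {σ : ℝ}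
  {Ω : Type*} [MeasurableSpace Ω] {P : Measure Ω} [IsProbabilityMeasure P]
  {n : ℕ} {Ys : Fin n → Ω → ℝ} {Xs : Fin n → Ω → H} {T : H →L[ℝ] H}
  {w b γ g : ℕ → ℝ} {d r S : ℝ}

/-- The expected maximal excess of the stochastic error over a sixth of the penalty. -/
theorem lintegral_iSup_sub_penalty_le (hR : RegularWeights w b γ) (hd : 1 ≤ d) (hr : 0 ≤ r)
    (hT : T ∈ opClass ψ γ d) (hSig : IsSigmaConst w γ d S) (hφ : φ ∈ ellipsoid ψ b r)
    (hg : ∀ j, g j = ⟪ψ j, T φ⟫) (hσ : 0 < σ) (hG : GaussianDesign P₀ X ε)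
    (hS : IsSample P₀ (response φ σ X ε) X P Ys Xs) (hΓ : covarianceOperator (P₀.map X) = T)
    (hn : 1 ≤ n) {s : Finset ℕ} (hs : s ⊆ Finset.Icc 1 (dimPlus w γ d n)) :
    ∫⁻ ω, ⨆ k ∈ s, ENNReal.ofReal (max ((wNormSq ψ w
      (estimator ψ (fun i => Ys i ω) (fun i => Xs i ω) k - galerkin ψ (opMat ψ T) g k)).toReal -
        penalty 96 w (⟪T φ, φ⟫ + σ ^ 2) (opMat ψ T) g n k / 6) 0) ∂P ≤
      ENNReal.ofReal (d ^ 2 * (24587 + 11 * decayConst + 4 * Real.exp (6 * d ^ 2)) *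
        (σ ^ 2 + r) * S / n) := by
  have hn0 : (0 : ℝ) < n := by exact_mod_cast hn
  have hd0 : 0 < d := by linarith
  have hC0 := decayConst_pos
  have hS1 := hSig.one_le hR.γ_one
  have hv : 0 < ⟪T φ, φ⟫ + σ ^ 2 := by
    have := hT.1.inner_nonneg_left φ
    positivity
  have hvle := secondMoment_le ψ hR hd hr hT hφ (σ := σ)
  choose C hC using fun m => exists_whitening (posDef_opMat ψ hT.1 hT.2.1 m)
  obtain ⟨hK1, hK4, -⟩ := dimBound_spec (w := w) hR.w_one hn
  set K := dimBound w n with hK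
  have hKn : (K : ℝ) ≤ n := by exact_mod_cast (Nat.le_self_pow (by norm_num) K).trans hK4
  set v := ⟪T φ, φ⟫ + σ ^ 2 with hvd
  set M : ℕ → Ω → ℝ≥0∞ := fun k ω => mainBound ψ w (opMat ψ T) v (C k)
    (galerkinCoef (opMat ψ T) g k) (fun i => Ys i ω) fun i => Xs i ω with hM
  set D : ℕ → Ω → ℝ≥0∞ := fun k ω => ENNReal.ofReal (crudeBound ψ d r v (C k)
    (galerkinCoef (opMat ψ T) g k) (totalExcess ψ T C φ σ g K (fun i => Ys i ω) fun i => Xs i ω)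
    (fun i => Ys i ω) fun i => Xs i ω) with hD
  set e := ENNReal.ofReal (4 * d ^ 2 * r * (Real.exp (6 * d ^ 2) / n ^ 2)) with he
  have hMm : ∀ k, AEMeasurable (M k) P := fun k => aemeasurable_mainBound ψ hS _ _ _ _
  have hDm : ∀ k, AEMeasurable (D k) P := fun k =>
    (aemeasurable_crudeBound ψ hS _ _ _ (aemeasurable_totalExcess ψ hS C K)).ennreal_ofReal
  have hpt : ∀ ω, ⨆ k ∈ s, ENNReal.ofReal (max ((wNormSq ψ w
      (estimator ψ (fun i => Ys i ω) (fun i => Xs i ω) k - galerkin ψ (opMat ψ T) g k)).toReal -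
        penalty 96 w v (opMat ψ T) g n k / 6) 0) ≤
      ∑ k ∈ Finset.Icc 1 K, (M k ω + D k ω + e) := by
    intro ω
    -- A maximum of nonnegative excesses is at most their sum.
    refine iSup₂_le fun k hk => ?_
    have hk' := hs hk
    refine (sub_penalty_le ψ hR hd hr hT hφ hg hσ hn hC hk').trans ?_
    exact Finset.single_le_sum (f := fun k => M k ω + D k ω + e) (fun _ _ => zero_le)
      (Finset.mem_Icc.2 ⟨(Finset.mem_Icc.1 hk').1,
        (Finset.mem_Icc.1 hk').2.trans (dimCut_le_dimBound w n _)⟩)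
  have hsplit : ∀ k, ∫⁻ ω, (M k ω + D k ω + e) ∂P = ∫⁻ ω, M k ω ∂P + ∫⁻ ω, D k ω ∂P + e := by
    intro k
    rw [lintegral_add_right' _ aemeasurable_const, lintegral_add_right' _ (hDm k),
      lintegral_const, measure_univ, mul_one]
  have hsum : ∀ k, AEMeasurable (fun ω => M k ω + D k ω + e) P := fun k =>
    ((hMm k).add (hDm k)).add aemeasurable_const
  refine (lintegral_mono hpt).trans ?_
  rw [lintegral_finsetSum' _ fun k _ => hsum k,
    Finset.sum_congr rfl fun k _ => hsplit k, Finset.sum_add_distrib, Finset.sum_add_distrib]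
  have he' : ∑ k ∈ Finset.Icc 1 K, e ≤
      ENNReal.ofReal (4 * d ^ 2 * r * Real.exp (6 * d ^ 2) / n) := by
    rw [Finset.sum_const, Nat.card_Icc, Nat.add_sub_cancel, nsmul_eq_mul,
      ← ENNReal.ofReal_natCast, ← ENNReal.ofReal_mul (by positivity)]
    refine ENNReal.ofReal_le_ofReal ?_
    calc _ ≤ n * (4 * d ^ 2 * r * (Real.exp (6 * d ^ 2) / n ^ 2)) := by gcongr
      _ = _ := by field_simp
  refine (add_le_add (add_le_add (sum_lintegral_mainBound_le ψ hR hd hT hSig hg hG hS hΓ hn hC hv K)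
    (sum_lintegral_crudeBound_le ψ hd hr hT hg hσ hG hS hΓ hn hC hK1 hK4)) he').trans ?_
  rw [← ENNReal.ofReal_add (by positivity) (by positivity),
    ← ENNReal.ofReal_add (by positivity) (by positivity)]
  refine ENNReal.ofReal_le_ofReal ?_
  have hr' : r ≤ σ ^ 2 + r := by nlinarith
  calc _ ≤ 11 * (d * (σ ^ 2 + r)) / n * d * S + ((24576 + decayConst) * d * (d * (σ ^ 2 + r)) * S +
        10 * decayConst * d ^ 2 * (σ ^ 2 + r) * S) / n +
        4 * d ^ 2 * (σ ^ 2 + r) * Real.exp (6 * d ^ 2) * S / n := by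
        gcongr ?_ + (?_ + ?_) / _ + ?_ / _
        · gcongr
        · exact le_trans (by gcongr) (le_mul_of_one_le_right (by positivity) hS1)
        · exact le_trans (by gcongr) (le_mul_of_one_le_right (by positivity) hS1)
        · exact le_trans (by gcongr) (le_mul_of_one_le_right (by positivity) hS1)
    _ = _ := by ring

/-- The expected error outside any event that contains the set where the total excess is
small. -/
theorem lintegral_indicator_wNormSq_le (hR : RegularWeights w b γ) (hd : 1 ≤ d) (hr : 0 ≤ r)
    (hT : T ∈ opClass ψ γ d) (hSig : IsSigmaConst w γ d S) (hφ : φ ∈ ellipsoid ψ b r)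
    (hg : ∀ j, g j = ⟪ψ j, T φ⟫) (hσ : 0 < σ) (hG : GaussianDesign P₀ X ε)
    (hS : IsSample P₀ (response φ σ X ε) X P Ys Xs) (hΓ : covarianceOperator (P₀.map X) = T)
    (hn : 1 ≤ n) {E : Set Ω} (hE : ∀ ω, ((∀ k ∈ Finset.Icc 1 (dimPlus w γ d n),
      penalty 96 w (⟪T φ, φ⟫ + σ ^ 2) (opMat ψ T) g n k ≤
          hpen ψ (fun i => Ys i ω) (fun i => Xs i ω) 96 w k ∧
        hpen ψ (fun i => Ys i ω) (fun i => Xs i ω) 96 w k ≤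
          72 * penalty 96 w (⟪T φ, φ⟫ + σ ^ 2) (opMat ψ T) g n k) ∧
      dimMinus w γ d n ≤ hDim ψ (fun i => Xs i ω) w ∧
      hDim ψ (fun i => Xs i ω) w ≤ dimPlus w γ d n) → ω ∈ E)
    {m : Ω → ℕ} (hm : ∀ ω, m ω ∈ Finset.Icc 1 (dimBound w n)) :
    ∫⁻ ω, Eᶜ.indicator (fun ω => wNormSq ψ w
      (estimator ψ (fun i => Ys i ω) (fun i => Xs i ω) (m ω) - φ)) ω ∂P ≤
      ENNReal.ofReal (4 * d ^ 2 * (24576 + 11 * decayConst) * (σ ^ 2 + r) * S / n) := by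
  have hn0 : (0 : ℝ) < n := by exact_mod_cast hn
  have hd0 : 0 < d := by linarith
  have hC0 := decayConst_pos
  have hS1 := hSig.one_le hR.γ_one
  have hv : 0 < ⟪T φ, φ⟫ + σ ^ 2 := by
    have := hT.1.inner_nonneg_left φ
    positivity
  have hvle := secondMoment_le ψ hR hd hr hT hφ (σ := σ)
  choose C hC using fun m => exists_whitening (posDef_opMat ψ hT.1 hT.2.1 m)
  obtain ⟨hK1, hK4, -⟩ := dimBound_spec (w := w) hR.w_one hn
  set K := dimBound w n with hK
  set v := ⟪T φ, φ⟫ + σ ^ 2 with hvd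
  set D : ℕ → Ω → ℝ≥0∞ := fun k ω => ENNReal.ofReal (crudeBound ψ d r v (C k)
    (galerkinCoef (opMat ψ T) g k) (totalExcess ψ T C φ σ g K (fun i => Ys i ω) fun i => Xs i ω)
    (fun i => Ys i ω) fun i => Xs i ω) with hD
  have hDm : ∀ k, AEMeasurable (D k) P := fun k =>
    (aemeasurable_crudeBound ψ hS _ _ _ (aemeasurable_totalExcess ψ hS C K)).ennreal_ofReal
  have hpt : ∀ ω, Eᶜ.indicator (fun ω => wNormSq ψ w
      (estimator ψ (fun i => Ys i ω) (fun i => Xs i ω) (m ω) - φ)) ω ≤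
      ∑ k ∈ Finset.Icc 1 K, 4 * D k ω := by
    intro ω
    refine Set.indicator_apply_le' (fun hω => ?_) fun _ => zero_le
    refine wNormSq_estimator_sub_le_sum ψ hR hd hr hT hφ hg hn (fun m => (hC m).2) (hm ω) hv ?_
    -- A total excess below 1 would put the data in the good event, so outside it the crude bound
    -- applies.
    by_contra! hlt
    exact hω (hE ω (good_event_of_totalExcess_lt ψ hR hd hT hg hσ hn hC hlt))
  refine (lintegral_mono hpt).trans ?_
  have h4 : (4 : ℝ≥0∞) = ENNReal.ofReal 4 := by norm_num
  rw [lintegral_finsetSum' _ fun k _ => (hDm k).const_mul _,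
    Finset.sum_congr rfl fun k _ => lintegral_const_mul'' _ (hDm k), ← Finset.mul_sum]
  refine (mul_le_mul_right
    (sum_lintegral_crudeBound_le ψ hd hr hT hg hσ hG hS hΓ hn hC hK1 hK4) _).trans ?_
  rw [h4, ← ENNReal.ofReal_mul (by norm_num)]
  refine ENNReal.ofReal_le_ofReal ?_
  have hr' : r ≤ σ ^ 2 + r := by nlinarith
  calc _ ≤ 4 * (((24576 + decayConst) * d * (d * (σ ^ 2 + r)) * S +
        10 * decayConst * d ^ 2 * (σ ^ 2 + r) * S) / n) := by
        gcongr ?_ * ((?_ + ?_) / _)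
        · exact le_trans (by gcongr) (le_mul_of_one_le_right (by positivity) hS1)
        · exact le_trans (by gcongr) (le_mul_of_one_le_right (by positivity) hS1)
    _ = _ := by ring

end Main

end FLR

theorem proposition3p1 (d : ℝ) (hd : 1 ≤ d) :
    ∃ C₁ C₂ : ℝ, 0 < C₁ ∧ 0 < C₂ ∧
      ∀ (H : Type*) [NormedAddCommGroup H] [InnerProductSpace ℝ H] [CompleteSpace H]
        [SecondCountableTopology H] [MeasurableSpace H] [BorelSpace H]
        (ψ : HilbertBasis ℕ ℝ H)
        (w b γ : ℕ → ℝ), FLR.RegularWeights w b γ →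
      ∀ (r : ℝ), 0 < r →
      ∀ (S : ℝ), FLR.IsSigmaConst w γ d S →
      ∀ (σ : ℝ), 0 < σ →
      ∀ (n : ℕ), 1 ≤ n →
      ∀ φ ∈ FLR.ellipsoid ψ b r,
      ∀ Γ ∈ FLR.opClass ψ γ d,
      ∀ (Ω₀ : Type*) [MeasurableSpace Ω₀] (P₀ : Measure Ω₀) [IsProbabilityMeasure P₀]
        (X : Ω₀ → H) (ε : Ω₀ → ℝ), FLR.GaussianDesign P₀ X ε →
        covarianceOperator (P₀.map X) = Γ →
      ∀ (Y : Ω₀ → ℝ), Y = FLR.response φ σ X ε →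
      ∀ (Ω : Type*) [MeasurableSpace Ω] (P : Measure Ω) [IsProbabilityMeasure P]
        (Ys : Fin n → Ω → ℝ) (Xs : Fin n → Ω → H), FLR.IsSample P₀ Y X P Ys Xs →
      -- the data, the theoretical and the random penalty, with `κ = 96`
      let y : Ω → Fin n → ℝ := fun ω i => Ys i ω
      let x : Ω → Fin n → H := fun ω i => Xs i ω
      let pen : ℕ → ℝ := FLR.pen ψ P₀ X Y 96 w n
      let hpen : Ω → ℕ → ℝ := fun ω => FLR.hpen ψ (y ω) (x ω) 96 w
      let Mminus : ℕ := FLR.dimMinus w γ d n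
      let Mplus : ℕ := FLR.dimPlus w γ d n
      let Mhat : Ω → ℕ := fun ω => FLR.hDim ψ (x ω) w
      let est : Ω → ℕ → H := fun ω => FLR.estimator ψ (y ω) (x ω)
      let E : Set Ω := {ω | (∀ k ∈ Finset.Icc 1 Mplus,
          pen k ≤ hpen ω k ∧ hpen ω k ≤ 72 * pen k) ∧ Mminus ≤ Mhat ω ∧ Mhat ω ≤ Mplus}
      (∫⁻ ω, ⨆ k ∈ Finset.Icc (FLR.dimDiamond w b γ d n) Mplus,
          ENNReal.ofReal (max ((FLR.wNormSq ψ w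
            (est ω k - FLR.galerkinSol ψ P₀ X Y k)).toReal - pen k / 6) 0) ∂P)
        ≤ ENNReal.ofReal (C₁ * (σ ^ 2 + r) * S / n) ∧
      (∫⁻ ω, Eᶜ.indicator (fun ω => FLR.wNormSq ψ w
            (est ω (FLR.selected ψ (y ω) (x ω) 96 w) - φ)) ω ∂P)
        ≤ ENNReal.ofReal (C₂ * (σ ^ 2 + r) * S / n) := by
  refine ⟨d ^ 2 * (24587 + 11 * FLR.decayConst + 4 * Real.exp (6 * d ^ 2)),
    4 * d ^ 2 * (24576 + 11 * FLR.decayConst), ?_, ?_, ?_⟩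
  · have := FLR.decayConst_pos
    positivity
  · have := FLR.decayConst_pos
    positivity
  intro H _ _ _ _ _ _ ψ w b γ hR r hr S hSig σ hσ n hn φ hφ T hT Ω₀ _ P₀ _ X ε hG hΓ Y hY
    Ω _ P _ Ys Xs hS y x pen hpen Mminus Mplus Mhat est E
  subst hY
  have hg := FLR.popG_response ψ hG hΓ φ σ
  have hy2 := FLR.integral_response_sq hG hΓ φ σ
  have hpen : ∀ k, pen k = FLR.penalty 96 w (⟪T φ, φ⟫ + σ ^ 2) (FLR.opMat ψ T)
      (FLR.popG ψ P₀ X (FLR.response φ σ X ε)) n k := by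
    intro k
    rw [← hy2, ← hΓ]
    rfl
  constructor
  -- The bound holds over all dimensions up to M_n^+, so it is enough that the lower end is at least
  -- one.
  · have hs : Finset.Icc (FLR.dimDiamond w b γ d n) Mplus ⊆ Finset.Icc 1 (FLR.dimPlus w γ d n) :=
      Finset.Icc_subset_Icc (Finset.mem_Icc.1
        (FLR.argminUpTo_mem (FLR.one_le_dimCut hR.w_one hn _) _)).1 le_rfl
    have h := FLR.lintegral_iSup_sub_penalty_le ψ hR hd hr.le hT hSig hφ hg hσ hG hS hΓ hn hs
    simp only [← hpen] at h
    rw [← hΓ] at h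
    exact h
  · refine FLR.lintegral_indicator_wNormSq_le ψ hR hd hr.le hT hSig hφ hg hσ hG hS hΓ hn
      (fun ω hω => ?_) fun ω => ?_
    · simp only [← hpen] at hω
      exact hω
    · have h := FLR.argminUpTo_mem (M := FLR.hDim ψ (x ω) w) (FLR.one_le_dimCut hR.w_one hn _)
        fun m => FLR.contrast ψ (y ω) (x ω) 96 w m + FLR.hpen ψ (y ω) (x ω) 96 w m
      exact Finset.mem_Icc.2 ⟨(Finset.mem_Icc.1 h).1,
        (Finset.mem_Icc.1 h).2.trans (FLR.dimCut_le_dimBound w n _)⟩
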